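/- Fix $S\ge 1$. An $S$-sided Letter Boxed puzzle consists of a finite alphabet $\Sigma$, a finite dictionary $D$ of nonempty words over $\Sigma$, and $S$ multisets $\Gamma_1,\dots,\Gamma_S$ of letters of $\Sigma$ (the sides), each with exactly $n\ge 1$ elements counted with multiplicity. $L$ is the length of the longest word of $D$; the size of the puzzle is $|\Sigma|+Sn+\sum_{w\in D}|w|$ (the sides are represented explicitly, as lists of letters). A solution of length $k$ is a sequence of words $w^{(1)},\dots,w^{(k)}\in D$ with a side $s_j\in\{1,\dots,S\}$ for each position $j$ of the concatenation $\sigma=w^{(1)}\circ\cdots\circ w^{(k)}$ such that: (1) for $1\le i<k$, the last letter of $w^{(i)}$ is the first letter of $w^{(i+1)}$; (2) for $1\le j<|\sigma|$, $s_j=s_{j+1}$ if position $j$ is the end of one of the words, and $s_j\ne s_{j+1}$ otherwise; (3) $\sigma_j\in\Gamma_{s_j}$ for all $j$; (4) for each side $i$ and each $\gamma\in\Gamma_i$, the number of positions $j$ with $\sigma_j=\gamma$, $s_j=i$, and either $j=|\sigma|$ or $j$ not the end of a word, is at least the multiplicity of $\gamma$ in $\Gamma_i$. Its number of letters is $|\sigma|-(k-1)$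 (the letter shared by two consecutive words is played once). The puzzle is solvable with at most $k$ words if it has a solution of some length $k'\le k$. Running times are numbers of steps on a unit-cost random access machine over the natural numbers with addition and truncated subtraction (no multiplication). **Theorem.** There is one algorithm that, given $S\ge1$ and any $S$-sided Letter Boxed puzzle with $D\neq\varnothing$, decides whether the puzzle has a solution and, if so, outputs the minimum number of words and the minimum number of letters of a solution, in time $$O\bigl(S^2\,(n+1)^{S|\Sigma|}\,|D|^2\,L\bigr),$$ with an absolute implied constant. **Corollary.** Consider the decision problem LETTER BOXED: given a puzzle with four sides and an integer $k\ge 1$ in binary, is the puzzle solvable with at most $k$ words? For all constants $c,d$, its restriction to the instances with (i) $|\Sigma|\le c$, or (ii) $|D|\le c$ and $L\le d$, or (iii) $L\le c$ and $k\le d$, is solvable in time polynomial in the size of the instance. -/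

import Mathlib

/-! ## The game -/

namespace LetterBoxed

/-- A Letter Boxed puzzle with `S` sides over the alphabet `Fin q`: a finite dictionary of nonempty
words and, for each side, a multiset of `n ≥ 1` letters. -/
structure Puzzle (S q : ℕ) where
  n : ℕ
  n_pos : 1 ≤ n
  dict : Finset (List (Fin q))
  word_ne_nil : ∀ w ∈ dict, w ≠ []
  side : Fin S → Multiset (Fin q)
  card_side : ∀ i, (side i).card = n

namespace Puzzle

variable {S q : ℕ}

/-- The length of the longest word in the dictionary. -/
def maxLen (P : Puzzle S q) : ℕ := P.dict.sup List.length

/-- The size of the puzzle, with the sides represented explicitly. -/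
def size (P : Puzzle S q) : ℕ := q + S * P.n + ∑ w ∈ P.dict, w.length

end Puzzle

/-- Position `j` (counted from 0) of the concatenation of `words` is the end of one of the words. -/
def IsWordEnd {α : Type*} (words : List (List α)) (j : ℕ) : Prop :=
  ∃ m, m < words.length ∧ (words.take (m + 1)).flatten.length = j + 1

/-- `(words, sides)` is a solution of the puzzle; `words.flatten` is the concatenation of the words
and `sides` gives a side for each of its positions. -/
structure IsSolution {S q : ℕ} (P : Puzzle S q) (words : List (List (Fin q)))
    (sides : List (Fin S)) : Prop where
  mem_dict : ∀ w ∈ words, w ∈ P.dict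
  length_sides : sides.length = words.flatten.length
  /-- Each word starts with the letter that ended the previous word. -/
  linked : ∀ (i : ℕ) u v, words[i]? = some u → words[i + 1]? = some v → u.getLast? = v.head?
  /-- The side changes at each step inside a word. -/
  side_ne : ∀ (j : ℕ) a b, sides[j]? = some a → sides[j + 1]? = some b → ¬ IsWordEnd words j → a ≠ b
  /-- The side is kept when a new word is started. -/
  side_eq : ∀ (j : ℕ) a b, sides[j]? = some a → sides[j + 1]? = some b → IsWordEnd words j → a = b
  /-- Each letter occurs on the side on which it is played. -/
  mem_side : ∀ (j : ℕ) (c : Fin q) (a : Fin S), words.flatten[j]? = some c → sides[j]? = some a → c ∈ P.side a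
  /-- Each letter is played on each side at least as often as it occurs there, where the end of a
  word and the start of the next one count once. -/
  cover : ∀ a, ∀ c ∈ P.side a, (P.side a).count c ≤
    Set.ncard {j : ℕ | words.flatten[j]? = some c ∧ sides[j]? = some a ∧
      (j + 1 = words.flatten.length ∨ ¬ IsWordEnd words j)}

/-- The number of letters played with a sequence of words: the letter shared by two consecutive
words is played once. -/
def numLetters {α : Type*} (words : List (List α)) : ℕ :=
  words.flatten.length - (words.length - 1)

namespace Puzzle

variable {S q : ℕ}

/-- The numbers of words of the solutions. -/
def wordCounts (P : Puzzle S q) : Set ℕ :=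
  {k | ∃ words sides, IsSolution P words sides ∧ words.length = k}

/-- The numbers of letters of the solutions. -/
def letterCounts (P : Puzzle S q) : Set ℕ :=
  {l | ∃ words sides, IsSolution P words sides ∧ numLetters words = l}

def SolvableWithAtMost (P : Puzzle S q) (k : ℕ) : Prop := ∃ k' ≤ k, k' ∈ P.wordCounts

/-- `x` is a representation of the puzzle as a list of numbers: a header `S, |Σ|, n, |D|`, then the
letters of each side, then each dictionary word preceded by its length; the elements of a side and
the words of the dictionary may be listed in any order. -/
def Encodes (P : Puzzle S q) (x : List ℕ) : Prop :=
  ∃ (ws : List (List (Fin q))) (gs : Fin S → List (Fin q)),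
    ws.Nodup ∧ ws.toFinset = P.dict ∧ (∀ i, (gs i : Multiset (Fin q)) = P.side i) ∧
    x = [S, q, P.n, ws.length] ++ (List.ofFn gs).flatten.map Fin.val ++
      ws.flatMap (fun w => w.length :: w.map Fin.val)

end Puzzle

end LetterBoxed

/-! ## The machine model

Unit-cost random access machines on natural numbers, whose only arithmetic operations are addition
and truncated subtraction, with structured control flow.  There is no multiplication, so that `t`
steps lengthen the numbers by at most `t + O(1)` bits, and polynomial time is the same notion as for Turing
machines.  A program uses finitely many registers and finitely many arrays. -/

namespace RAM

inductive Prog where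
  | skip
  /-- `r x := c` -/
  | const (x c : ℕ)
  /-- `r x := r y` -/
  | copy (x y : ℕ)
  /-- `r x := r y + r z` -/
  | add (x y z : ℕ)
  /-- `r x := r y - r z`, truncated at 0 -/
  | sub (x y z : ℕ)
  /-- `r x := a[r y]` -/
  | load (x a y : ℕ)
  /-- `a[r x] := r y` -/
  | store (a x y : ℕ)
  | seq (p p' : Prog)
  /-- if `r x < r y` then `p` else `p'` -/
  | ifLt (x y : ℕ) (p p' : Prog)
  /-- while `r x < r y` do `p` -/
  | whileLt (x y : ℕ) (p : Prog)

structure State where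
  reg : ℕ → ℕ
  arr : ℕ → ℕ → ℕ

namespace State

def setReg (s : State) (x v : ℕ) : State := ⟨Function.update s.reg x v, s.arr⟩

def setArr (s : State) (a i v : ℕ) : State :=
  ⟨s.reg, Function.update s.arr a (Function.update (s.arr a) i v)⟩

/-- The input is in array 0; everything else is 0. -/
def ofInput (x : List ℕ) : State := ⟨fun _ => 0, fun a i => if a = 0 then x.getD i 0 else 0⟩

end State

/-- `Exec p s t s'`: started in `s`, the program `p` halts in `s'` after exactly `t` steps, where each
instruction and each evaluation of a condition is one step. -/
inductive Exec : Prog → State → ℕ → State → Prop where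
  | skip (s) : Exec .skip s 1 s
  | const (s x c) : Exec (.const x c) s 1 (s.setReg x c)
  | copy (s x y) : Exec (.copy x y) s 1 (s.setReg x (s.reg y))
  | add (s x y z) : Exec (.add x y z) s 1 (s.setReg x (s.reg y + s.reg z))
  | sub (s x y z) : Exec (.sub x y z) s 1 (s.setReg x (s.reg y - s.reg z))
  | load (s x a y) : Exec (.load x a y) s 1 (s.setReg x (s.arr a (s.reg y)))
  | store (s a x y) : Exec (.store a x y) s 1 (s.setArr a (s.reg x) (s.reg y))
  | seq {p p' s s' s'' t t'} : Exec p s t s' → Exec p' s' t' s'' →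
      Exec (.seq p p') s (t + t') s''
  | if_true {x y p p' s t s'} : s.reg x < s.reg y → Exec p s t s' →
      Exec (.ifLt x y p p') s (t + 1) s'
  | if_false {x y p p' s t s'} : ¬ s.reg x < s.reg y → Exec p' s t s' →
      Exec (.ifLt x y p p') s (t + 1) s'
  | while_true {x y p s t s' t' s''} : s.reg x < s.reg y → Exec p s t s' →
      Exec (.whileLt x y p) s' t' s'' → Exec (.whileLt x y p) s (t + t' + 1) s''
  | while_false {x y p s} : ¬ s.reg x < s.reg y → Exec (.whileLt x y p) s 1 s

end RAM

namespace LetterBoxed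

/-- Letter Boxed with four sides, restricted to the instances `(P, k)` with `A P k`, is solvable in
polynomial time: some program decides, with answer 1 or 0 in register 0 and in a number of steps
polynomial in the size of the instance (`k` counts with its number of binary digits), whether `P` is
solvable with at most `k` words. -/
def SolvableInPolyTime (A : ∀ {q : ℕ}, Puzzle 4 q → ℕ → Prop) : Prop :=
  ∃ (prog : RAM.Prog) (f : Polynomial ℕ), ∀ (q : ℕ) (P : Puzzle 4 q) (k : ℕ), 1 ≤ k → A P k →
    ∀ x : List ℕ, P.Encodes x →
      ∃ t s, RAM.Exec prog (RAM.State.ofInput (x ++ [k])) t s ∧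
        t ≤ f.eval (P.size + Nat.size k) ∧
        (P.SolvableWithAtMost k → s.reg 0 = 1) ∧ (¬ P.SolvableWithAtMost k → s.reg 0 = 0)

end LetterBoxed

/-! ## Reasoning about programs -/

namespace RAM

namespace State

/-! A play is a walk in a finite graph. All that matters about a partially played solution is the
position `g` reached in the concatenated dictionary, the side `a` on which that letter was played,
and, for each pair of a side and a letter, how often the letter was played there, capped at its
multiplicity. The capped counts are the digits of a mixed radix number `v` below V = ∏ (multiplicity
+ 1), so the nodes are triples `(g, a, v)` and there are at most |D|·L·S·V of them. An edge `Step`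
plays the next letter of the word on a different side; an edge `Switch` passes from the end of a
word to the start of a word beginning with the same letter, with side and counts unchanged, because
the shared letter is played once. The walk enters at the first letter of a word, and reaches a goal
at the end of a word when all digits are maximal.

The letters of a solution number one plus the `Step` edges, and its words one plus the `Switch`
edges. Both minima are therefore shortest path lengths with edge weights 0 and 1.
`isSolution_iff_reach` turns solutions into the step-by-step plays `Reach`, and
`Input.Represents.exists_goal_iff` turns these into walks from a source to a goal, for both
weightings.

Each weighting is handled by a 0-1 breadth first search. Its correctness is proved for abstract
relations (`Between`, `During`), its running time with the potential function `potential`. A node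
has at most S + |D| outgoing edges, so the search takes O(|D|·L·S·V·(S + |D|)) steps, which is
O(S²·V·|D|²·L), and V ≤ (n+1)^(S|Σ|). Without multiplication, the radix units are computed by
repeated addition, and digits are extracted by counting through all codes like an odometer.

For the corollary, the program checks first that every letter of the sides occurs in the dictionary;
otherwise there is no solution, and the tables of size proportional to V are never built. So it
suffices to bound V for playable puzzles. If |Σ| is bounded, V is polynomial in n by the general
bound. If |D| and L are bounded, only boundedly many letters occur and the others contribute factors
1. If L and k are bounded, a solution with at most k words can cover only boundedly many letters, so
either n is too large and the answer is no, or V ≤ 2^(4n) is bounded. -/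

@[simp] theorem reg_setReg (s : State) (x v y : ℕ) :
    (s.setReg x v).reg y = if y = x then v else s.reg y := by
  simp [setReg, Function.update_apply]

@[simp] theorem arr_setReg (s : State) (x v : ℕ) : (s.setReg x v).arr = s.arr := rfl

@[simp] theorem reg_setArr (s : State) (a i v : ℕ) : (s.setArr a i v).reg = s.reg := rfl

@[simp] theorem arr_setArr (s : State) (a i v b : ℕ) :
    (s.setArr a i v).arr b = if b = a then Function.update (s.arr a) i v else s.arr b := by
  simp only [setArr, Function.update_apply]

end State

namespace Prog

/-- Does the program have an instruction that writes register `r`? -/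
def writesReg : Prog → ℕ → Bool
  | skip, _ => false
  | const x _, r => x == r
  | copy x _, r => x == r
  | add x _ _, r => x == r
  | sub x _ _, r => x == r
  | load x _ _, r => x == r
  | store _ _ _, _ => false
  | seq p p', r => p.writesReg r || p'.writesReg r
  | ifLt _ _ p p', r => p.writesReg r || p'.writesReg r
  | whileLt _ _ p, r => p.writesReg r

/-- Does the program have an instruction that writes array `a`? -/
def writesArr : Prog → ℕ → Bool
  | store b _ _, a => b == a
  | seq p p', a => p.writesArr a || p'.writesArr a
  | ifLt _ _ p p', a => p.writesArr a || p'.writesArr a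
  | whileLt _ _ p, a => p.writesArr a
  | _, _ => false

def loopFree : Prog → Bool
  | seq p p' => p.loopFree && p'.loopFree
  | ifLt _ _ p p' => p.loopFree && p'.loopFree
  | whileLt _ _ _ => false
  | _ => true

/-- A bound on the number of steps of a loop-free program. -/
def cost : Prog → ℕ
  | seq p p' => p.cost + p'.cost
  | ifLt _ _ p p' => max p.cost p'.cost + 1
  | _ => 1

/-- The function computed by a loop-free program. -/
@[simp] def den : Prog → State → State
  | skip, s => s
  | const x c, s => s.setReg x c
  | copy x y, s => s.setReg x (s.reg y)
  | add x y z, s => s.setReg x (s.reg y + s.reg z)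
  | sub x y z, s => s.setReg x (s.reg y - s.reg z)
  | load x a y, s => s.setReg x (s.arr a (s.reg y))
  | store a x y, s => s.setArr a (s.reg x) (s.reg y)
  | seq p p', s => p'.den (p.den s)
  | ifLt x y p p', s => if s.reg x < s.reg y then p.den s else p'.den s
  | whileLt _ _ _, s => s

/-- Increment a register; register 3 is scratch. -/
abbrev inc (x : ℕ) : Prog := seq (const 3 1) (add x x 3)

/-- `for i := 0, …, r n - 1 do p` -/
def forLt (i n : ℕ) (p : Prog) : Prog := seq (const i 0) (whileLt i n (seq p (inc i)))

end Prog

/-- `s'` differs from `s` only in registers and arrays that `p` writes. -/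
structure Agree (p : Prog) (s s' : State) : Prop where
  reg : ∀ r, p.writesReg r = false → s'.reg r = s.reg r
  arr : ∀ a, p.writesArr a = false → s'.arr a = s.arr a

theorem Agree.refl (p : Prog) (s : State) : Agree p s s := ⟨fun _ _ => rfl, fun _ _ => rfl⟩

theorem Agree.trans {p : Prog} {s s' s'' : State} (h : Agree p s s') (h' : Agree p s' s'') :
    Agree p s s'' :=
  ⟨fun r hr => (h'.reg r hr).trans (h.reg r hr), fun a ha => (h'.arr a ha).trans (h.arr a ha)⟩

/-- The frame rule. Since `writesReg` and `writesArr` are computed from the syntax, the fact that a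
concrete program leaves a register or an array alone is proved by `rfl`, and this is how facts are
carried past program parts everywhere below. -/
theorem Exec.agree {p : Prog} {s s' : State} {t : ℕ} (h : Exec p s t s') : Agree p s s' := by
  induction h with
  | skip s => exact Agree.refl _ _
  | const s x c =>
    refine ⟨fun r hr => ?_, fun _ _ => rfl⟩
    have : r ≠ x := by rintro rfl; simp [Prog.writesReg] at hr
    simp [this]
  | copy s x y =>
    refine ⟨fun r hr => ?_, fun _ _ => rfl⟩
    have : r ≠ x := by rintro rfl; simp [Prog.writesReg] at hr
    simp [this]
  | add s x y z =>
    refine ⟨fun r hr => ?_, fun _ _ => rfl⟩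
    have : r ≠ x := by rintro rfl; simp [Prog.writesReg] at hr
    simp [this]
  | sub s x y z =>
    refine ⟨fun r hr => ?_, fun _ _ => rfl⟩
    have : r ≠ x := by rintro rfl; simp [Prog.writesReg] at hr
    simp [this]
  | load s x a y =>
    refine ⟨fun r hr => ?_, fun _ _ => rfl⟩
    have : r ≠ x := by rintro rfl; simp [Prog.writesReg] at hr
    simp [this]
  | store s a x y =>
    refine ⟨fun _ _ => rfl, fun b hb => ?_⟩
    have : b ≠ a := by rintro rfl; simp [Prog.writesArr] at hb
    simp [this]
  | seq _ _ ih ih' =>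
    refine ⟨fun r hr => ?_, fun a ha => ?_⟩
    · simp only [Prog.writesReg, Bool.or_eq_false_iff] at hr
      rw [ih'.reg r hr.2, ih.reg r hr.1]
    · simp only [Prog.writesArr, Bool.or_eq_false_iff] at ha
      rw [ih'.arr a ha.2, ih.arr a ha.1]
  | if_true _ _ ih =>
    refine ⟨fun r hr => ?_, fun a ha => ?_⟩
    · simp only [Prog.writesReg, Bool.or_eq_false_iff] at hr
      exact ih.reg r hr.1
    · simp only [Prog.writesArr, Bool.or_eq_false_iff] at ha
      exact ih.arr a ha.1
  | if_false _ _ ih =>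
    refine ⟨fun r hr => ?_, fun a ha => ?_⟩
    · simp only [Prog.writesReg, Bool.or_eq_false_iff] at hr
      exact ih.reg r hr.2
    · simp only [Prog.writesArr, Bool.or_eq_false_iff] at ha
      exact ih.arr a ha.2
  | while_true _ _ _ ih ih' =>
    exact Agree.trans ⟨fun r hr => ih.reg r hr, fun a ha => ih.arr a ha⟩ ih'
  | while_false _ => exact Agree.refl _ _

/-- `p` halts when started in `s`, and the number of steps and the final state satisfy `Q`. -/
def Runs (p : Prog) (s : State) (Q : ℕ → State → Prop) : Prop := ∃ t s', Exec p s t s' ∧ Q t s'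

/-- `p` halts within `B` steps when started in `s`, and the final state satisfies `Q`. -/
def Within (p : Prog) (s : State) (B : ℕ) (Q : State → Prop) : Prop :=
  Runs p s fun t s' => t ≤ B ∧ Q s'

variable {p p' : Prog} {s : State}

theorem Runs.mono {Q Q' : ℕ → State → Prop} (h : Runs p s Q)
    (hQ : ∀ t s', Agree p s s' → Q t s' → Q' t s') : Runs p s Q' := by
  obtain ⟨t, s', he, hq⟩ := h
  exact ⟨t, s', he, hQ t s' he.agree hq⟩

theorem Within.mono {Q Q' : State → Prop} {B B' : ℕ} (h : Within p s B Q) (hB : B ≤ B')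
    (hQ : ∀ s', Agree p s s' → Q s' → Q' s') : Within p s B' Q' :=
  Runs.mono h fun _ s' ha hq => ⟨hq.1.trans hB, hQ s' ha hq.2⟩

/-- Straight-line code is never run through `Exec` by hand: its effect is the function `den`, which
`simp` unfolds, and its time is the syntactic bound `cost`. -/
theorem Within.block {Q : State → Prop} (h : p.loopFree = true) (hQ : Q (p.den s)) :
    Within p s p.cost Q := by
  suffices ∀ s, ∃ t, Exec p s t (p.den s) ∧ t ≤ p.cost by
    obtain ⟨t, he, ht⟩ := this s
    exact ⟨t, _, he, ht, hQ⟩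
  clear hQ
  induction p with
  | skip => exact fun s => ⟨1, .skip s, le_rfl⟩
  | const x c => exact fun s => ⟨1, .const s x c, le_rfl⟩
  | copy x y => exact fun s => ⟨1, .copy s x y, le_rfl⟩
  | add x y z => exact fun s => ⟨1, .add s x y z, le_rfl⟩
  | sub x y z => exact fun s => ⟨1, .sub s x y z, le_rfl⟩
  | load x a y => exact fun s => ⟨1, .load s x a y, le_rfl⟩
  | store a x y => exact fun s => ⟨1, .store s a x y, le_rfl⟩
  | seq p p' ih ih' =>
    intro s
    simp only [Prog.loopFree, Bool.and_eq_true] at h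
    obtain ⟨t, he, ht⟩ := ih h.1 s
    obtain ⟨t', he', ht'⟩ := ih' h.2 (p.den s)
    exact ⟨t + t', .seq he he', Nat.add_le_add ht ht'⟩
  | ifLt x y p p' ih ih' =>
    intro s
    simp only [Prog.loopFree, Bool.and_eq_true] at h
    by_cases hc : s.reg x < s.reg y
    · obtain ⟨t, he, ht⟩ := ih h.1 s
      refine ⟨t + 1, ?_, by simp only [Prog.cost]; omega⟩
      simpa [hc] using Exec.if_true hc he
    · obtain ⟨t, he, ht⟩ := ih' h.2 s
      refine ⟨t + 1, ?_, by simp only [Prog.cost]; omega⟩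
      simpa [hc] using Exec.if_false hc he
  | whileLt x y p => simp [Prog.loopFree] at h

theorem Runs.seq {Q : ℕ → State → Prop}
    (h : Runs p s fun t s' => Runs p' s' fun t' s'' => Q (t + t') s'') :
    Runs (.seq p p') s Q := by
  obtain ⟨t, s', he, t', s'', he', hq⟩ := h
  exact ⟨_, _, .seq he he', hq⟩

theorem Within.seq {Q : State → Prop} {B B' : ℕ}
    (h : Within p s B fun s' => Within p' s' B' Q) : Within (.seq p p') s (B + B') Q :=
  Runs.seq (Runs.mono h fun _ _ _ h1 =>
    Runs.mono h1.2 fun _ _ _ h2 => ⟨Nat.add_le_add h1.1 h2.1, h2.2⟩)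

theorem Runs.ifLt {Q : ℕ → State → Prop} {x y : ℕ}
    (ht : s.reg x < s.reg y → Runs p s fun t s' => Q (t + 1) s')
    (hf : ¬ s.reg x < s.reg y → Runs p' s fun t s' => Q (t + 1) s') :
    Runs (.ifLt x y p p') s Q := by
  by_cases hc : s.reg x < s.reg y
  · obtain ⟨t, s', he, hq⟩ := ht hc
    exact ⟨_, _, .if_true hc he, hq⟩
  · obtain ⟨t, s', he, hq⟩ := hf hc
    exact ⟨_, _, .if_false hc he, hq⟩

theorem Within.ifLt {Q : State → Prop} {x y B : ℕ}
    (ht : s.reg x < s.reg y → Within p s B Q) (hf : ¬ s.reg x < s.reg y → Within p' s B Q) :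
    Within (.ifLt x y p p') s (B + 1) Q :=
  Runs.ifLt (fun h => Runs.mono (ht h) fun _ _ _ h => ⟨Nat.succ_le_succ h.1, h.2⟩)
    (fun h => Runs.mono (hf h) fun _ _ _ h => ⟨Nat.succ_le_succ h.1, h.2⟩)

/-- While loops, with a potential that pays for the steps. -/
theorem Runs.whileLt {x y : ℕ} (I : State → Prop) (Φ : State → ℕ) (h0 : I s)
    (hstep : ∀ s', I s' → s'.reg x < s'.reg y → Agree (.whileLt x y p) s s' →
      Runs p s' fun t s'' => I s'' ∧ Φ s'' + t + 1 ≤ Φ s') :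
    Runs (.whileLt x y p) s fun t s' => I s' ∧ ¬ s'.reg x < s'.reg y ∧ Φ s' + t ≤ Φ s + 1 := by
  -- Each round lowers the potential by at least 1, the price of the test, so induction on a bound
  -- for the potential gives termination. The extra 1 in the conclusion is the last, failing test.
  suffices ∀ k s', Φ s' ≤ k → I s' → Agree (.whileLt x y p) s s' →
      Runs (.whileLt x y p) s' fun t s'' =>
        I s'' ∧ ¬ s''.reg x < s''.reg y ∧ Φ s'' + t ≤ Φ s' + 1 from
    this _ s le_rfl h0 (Agree.refl _ _)
  intro k
  induction k with
  | zero =>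
    intro s' hk hI ha
    by_cases hc : s'.reg x < s'.reg y
    · obtain ⟨t, s'', he, hI', ht⟩ := hstep s' hI hc ha
      omega
    · exact ⟨1, s', .while_false hc, hI, hc, le_rfl⟩
  | succ k ih =>
    intro s' hk hI ha
    by_cases hc : s'.reg x < s'.reg y
    · obtain ⟨t, s'', he, hI', ht⟩ := hstep s' hI hc ha
      obtain ⟨t', s3, he', hI3, hc3, ht3⟩ := ih s'' (by omega) hI'
        (ha.trans ⟨fun r hr => he.agree.reg r hr, fun a ha => he.agree.arr a ha⟩)
      exact ⟨_, _, .while_true hc he he', hI3, hc3, by omega⟩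
    · exact ⟨1, s', .while_false hc, hI, hc, le_rfl⟩

/-- The side conditions of `Within.forLt`, in a form that evaluates. -/
def Prog.forOk (i n : ℕ) (p : Prog) : Bool :=
  !p.writesReg i && !p.writesReg n && i != n && i != 3 && n != 3

/-- For loops, with a uniform bound for the body. -/
theorem Within.forLt {i n N B : ℕ} (I : ℕ → State → Prop) (hok : p.forOk i n = true)
    (hn : s.reg n = N) (h0 : I 0 (s.setReg i 0))
    (hstep : ∀ j s', j < N → I j s' → s'.reg i = j → Agree (.forLt i n p) s s' →
      Within p s' B fun s'' => I (j + 1) ((s''.setReg 3 1).setReg i (j + 1))) :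
    Within (.forLt i n p) s (N * (B + 3) + 2) (I N) := by
  simp only [Prog.forOk, Bool.and_eq_true, Bool.not_eq_true', bne_iff_ne] at hok
  obtain ⟨⟨⟨⟨hi, hnn⟩, hne⟩, hi3⟩, hn3⟩ := hok
  -- Every remaining round is paid with `B + 3`: the body, two steps for the increment and one for
  -- the test. The initialization and the failing test give the `+ 2` of the statement.
  have key := Runs.whileLt (x := i) (y := n) (p := .seq p (Prog.inc i)) (s := s.setReg i 0)
    (fun s' => s'.reg n = N ∧ s'.reg i ≤ N ∧ I (s'.reg i) s')
    (fun s' => (N - s'.reg i) * (B + 3)) ⟨by simp [hne.symm, hn], by simp, by simpa using h0⟩ ?_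
  · refine Runs.seq (Runs.mono (Within.block (p := .const i 0) rfl rfl) ?_)
    rintro t s' - ⟨ht, rfl⟩
    refine Runs.mono key fun t' s'' _ ⟨⟨h1, h2, h3⟩, h4, h5⟩ => ?_
    have h6 : s''.reg i = N := by omega
    rw [h6] at h3
    refine ⟨?_, h3⟩
    simp [Prog.cost] at h5 ht
    omega
  · rintro s' ⟨h1, h2, h3⟩ hc ha
    have hlt : s'.reg i < N := by omega
    have ha' : Agree (.forLt i n p) s s' := by
      refine ⟨fun r hr => ?_, fun a hr => ?_⟩
      · rw [ha.reg r]
        · have : r ≠ i := by rintro rfl; simp [Prog.forLt, Prog.writesReg] at hr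
          simp [this]
        · simpa [Prog.forLt, Prog.writesReg] using (Bool.or_eq_false_iff.1 hr).2
      · rw [ha.arr a]
        · rfl
        · simpa [Prog.forLt, Prog.writesArr] using hr
    refine Runs.seq (Runs.mono (hstep _ s' hlt h3 rfl ha') ?_)
    rintro t s2 hag ⟨ht, hI⟩
    refine Runs.mono (Within.block (p := Prog.inc i) rfl rfl) ?_
    rintro t' s3 - ⟨ht', rfl⟩
    have e1 : s2.reg i = s'.reg i := hag.reg i hi
    have e2 : s2.reg n = s'.reg n := hag.reg n hnn
    have e3 : (Prog.inc i).den s2 = (s2.setReg 3 1).setReg i (s'.reg i + 1) := by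
      simp [e1, hi3]
    rw [e3]
    refine ⟨⟨by simp [hne.symm, hn3, e2, h1], by simpa using hlt, by simpa using hI⟩, ?_⟩
    simp only [State.reg_setReg, if_true]
    have : N - s'.reg i = (N - (s'.reg i + 1)) + 1 := by omega
    rw [this, Nat.add_mul]
    simp [Prog.cost] at ht'
    omega

end RAM

/-! ## The program -/

namespace LetterBoxed

open RAM RAM.Prog

infixr:65 " ;; " => RAM.Prog.seq

/-! Registers. -/
notation "ρZero" => (4 : ℕ)
notation "ρOne" => (5 : ℕ)
notation "ρTwo" => (6 : ℕ)
notation "ρS" => (10 : ℕ)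
notation "ρq" => (11 : ℕ)
notation "ρn" => (12 : ℕ)
notation "ρD" => (13 : ℕ)
notation "ρp" => (14 : ℕ)
notation "ρM" => (15 : ℕ)
notation "ρK" => (16 : ℕ)
notation "ρV" => (17 : ℕ)
notation "ρbad" => (18 : ℕ)
notation "ρa" => (20 : ℕ)
notation "ρb" => (21 : ℕ)
notation "ρc" => (22 : ℕ)
notation "ρd" => (23 : ℕ)
notation "ρg" => (24 : ℕ)
notation "ρh" => (25 : ℕ)
notation "ρi" => (26 : ℕ)
notation "ρj" => (27 : ℕ)
notation "ρl" => (28 : ℕ)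
notation "ρm" => (29 : ℕ)
notation "ρr" => (30 : ℕ)
notation "ρt" => (31 : ℕ)
notation "ρu" => (32 : ℕ)
notation "ρv" => (33 : ℕ)
notation "ρx" => (34 : ℕ)
notation "ρy" => (35 : ℕ)
notation "ρo" => (37 : ℕ)
notation "ρRem" => (38 : ℕ)
notation "ρnA" => (40 : ℕ)
notation "ρnB" => (41 : ℕ)
notation "ρKind" => (42 : ℕ)
notation "ρMark" => (43 : ℕ)
notation "ρDist" => (44 : ℕ)
notation "ρAns" => (45 : ℕ)

/-! Arrays. -/
notation "αIn" => (0 : ℕ)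
notation "αMult" => (1 : ℕ)
notation "αUnit" => (2 : ℕ)
notation "αOcc" => (3 : ℕ)
notation "αStart" => (4 : ℕ)
notation "αLetter" => (5 : ℕ)
notation "αRem" => (6 : ℕ)
notation "αBase" => (7 : ℕ)
notation "αArrive" => (8 : ℕ)
notation "αPos" => (9 : ℕ)
notation "αSide" => (10 : ℕ)
notation "αCode" => (11 : ℕ)
notation "αGoal" => (12 : ℕ)
notation "αVis" => (13 : ℕ)
notation "αA" => (14 : ℕ)
notation "αB" => (15 : ℕ)

def header : Prog :=
  const ρZero 0 ;; const ρOne 1 ;; const ρTwo 2 ;; load ρS αIn ρZero ;; load ρq αIn ρOne ;;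
  load ρn αIn ρTwo ;; const ρp 3 ;; load ρD αIn ρp ;; const ρp 4

/-- Compute the multiplicity of letter `c` on side `a` as entry `a * q + c` of `αMult`. -/
def readSides : Prog :=
  const ρi 0 ;;
  forLt ρa ρS (
    forLt ρj ρn (
      load ρc αIn ρp ;; add ρx ρi ρc ;; load ρm αMult ρx ;; inc ρm ;; store αMult ρx ρm ;;
      inc ρp) ;;
    add ρi ρi ρq)

/-- Read the dictionary: the letter at each position of its concatenation, the number of letters
left in the word there, the start of each word, and the set of the letters that occur. -/
def readWords : Prog :=
  const ρM 0 ;;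
  (forLt ρi ρD (
    (load ρl αIn ρp ;; inc ρp ;; store αStart ρi ρM) ;;
    forLt ρj ρl (
      load ρc αIn ρp ;; store αLetter ρM ρc ;; store αOcc ρc ρOne ;; sub ρr ρl ρj ;;
      store αRem ρM ρr ;; inc ρM ;; inc ρp)) ;;
  load ρK αIn ρp)

/-- Compute the mixed radix units, and whether some letter of the sides is not in the dictionary. -/
def mkUnits : Prog :=
  (const ρV 1 ;; const ρi 0 ;; const ρbad 0) ;;
  forLt ρa ρS (
    forLt ρc ρq (
      (load ρm αMult ρi ;; load ρt αOcc ρc ;;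
      ifLt ρZero ρm (ifLt ρt ρOne (const ρbad 1) skip) skip ;;
      store αUnit ρi ρV ;; copy ρx ρV) ;;
      forLt ρj ρm (add ρx ρx ρV) ;;
      (copy ρV ρx ;; inc ρi)))

/-- Compute the node reached on arrival at a position and side with a given code, plus one; or zero
if the letter is not on that side. -/
def entryArrive : Prog :=
  const ρy 0 ;;
  ifLt ρZero ρm (ifLt ρd ρm (add ρy ρx ρu) (copy ρy ρx) ;; inc ρy) skip ;;
  store αArrive ρx ρy

def entryNode : Prog :=
  store αPos ρx ρg ;; store αSide ρx ρa ;; store αCode ρx ρv ;;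
  const ρy 0 ;; add ρt ρv ρOne ;;
  ifLt ρRem ρTwo (ifLt ρt ρV skip (const ρy 1)) skip ;; store αGoal ρx ρy

/-- Go to the next node; `ρd` is the digit of the code and `ρr` is the part below the digit. -/
def entryNext : Prog :=
  inc ρx ;; inc ρr ;;
  ifLt ρr ρu skip (const ρr 0 ;; ifLt ρd ρm (inc ρd) (const ρd 0))

/-- Compute the tables for the nodes. -/
def fill : Prog :=
  const ρx 0 ;;
  forLt ρg ρM (
    (store αBase ρg ρx ;; load ρl αLetter ρg ;; load ρRem αRem ρg ;; const ρi 0) ;;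
    forLt ρa ρS (
      (add ρt ρi ρl ;; load ρm αMult ρt ;; load ρu αUnit ρt ;; const ρr 0 ;; const ρd 0) ;;
      forLt ρv ρV (entryArrive ;; entryNode ;; entryNext) ;;
      add ρi ρi ρq))

def pushA (y : ℕ) : Prog := store αA ρnA y ;; inc ρnA
def pushB (y : ℕ) : Prog := store αB ρnB y ;; inc ρnB

/-- Push a node reached by playing a letter. -/
def pushStep (y : ℕ) : Prog := ifLt ρKind ρOne (pushB y) (pushA y)

/-- Push a node reached by starting a word. -/
def pushSwitch (y : ℕ) : Prog := ifLt ρKind ρOne (pushA y) (pushB y)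

def sources : Prog :=
  const ρnB 0 ;;
  forLt ρi ρD (
    (load ρg αStart ρi ;; load ρx αBase ρg) ;;
    forLt ρb ρS (
      load ρy αArrive ρx ;; ifLt ρZero ρy (sub ρy ρy ρOne ;; pushB ρy) skip ;; add ρx ρx ρV))

/-- Push the nodes that are reached by starting a new word. -/
def expandSwitch : Prog :=
  (load ρt αBase ρg ;; sub ρo ρx ρt ;; load ρl αLetter ρg) ;;
  forLt ρi ρD (
    load ρh αStart ρi ;; load ρt αLetter ρh ;;
    ifLt ρt ρl skip (ifLt ρl ρt skip (
      load ρy αBase ρh ;; add ρy ρy ρo ;; pushSwitch ρy)))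

/-- Push the nodes that are reached by playing the next letter of a word. -/
def expandStep : Prog :=
  (load ρa αSide ρx ;; load ρv αCode ρx ;; inc ρg ;; load ρy αBase ρg ;; add ρy ρy ρv) ;;
  forLt ρb ρS (
    load ρt αArrive ρy ;; add ρy ρy ρV ;;
    ifLt ρZero ρt (
      sub ρt ρt ρOne ;;
      ifLt ρb ρa (pushStep ρt)
        (ifLt ρa ρb (pushStep ρt) skip)) skip)

def expand : Prog :=
  (load ρg αPos ρx ;; load ρRem αRem ρg) ;; ifLt ρRem ρTwo expandSwitch expandStep

/-- Mark a new node as visited, and record the distance of the first goal. -/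
def markNode : Prog :=
  store αVis ρx ρMark ;;
  ifLt ρAns ρOne (load ρy αGoal ρx ;; ifLt ρZero ρy (copy ρAns ρDist) skip) skip

/-- Pop a node and, if it is new, process it. -/
def visit : Prog :=
  (sub ρnA ρnA ρOne ;; load ρx αA ρnA ;; load ρy αVis ρx) ;;
  ifLt ρy ρMark (markNode ;; expand) skip

def level : Prog :=
  forLt ρj ρnB (load ρy αB ρj ;; store αA ρj ρy) ;;
  (copy ρnA ρnB ;; const ρnB 0 ;; inc ρDist) ;;
  whileLt ρZero ρnA visit

/-- 0-1 breadth first search. -/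
def bfs : Prog := (const ρDist 0 ;; const ρAns 0) ;; whileLt ρZero ρnB level

/-- Kind 0 counts letters (playing a letter costs 1, starting another word is free); kind 1 counts
words (the other way round). A node counts as visited if its entry in `αVis` is at least `mark`. -/
def search (kind mark out : ℕ) : Prog :=
  (const ρKind kind ;; const ρMark mark) ;; sources ;; bfs ;; copy out ρAns

/-- The minimum number of letters goes to register 2, that of words to register 1, and solvability
to register 0. The flag `ρbad` is tested before `fill`, so that tables of size proportional to `V`
are built only if every letter of the sides occurs in the dictionary. The marks 1 and 2 make it
unnecessary to clear `αVis` between the searches. -/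
def core : Prog :=
  header ;; readSides ;; readWords ;; mkUnits ;; const 0 0 ;;
  ifLt ρbad ρOne (fill ;; search 0 1 2 ;; search 1 2 1 ;; ifLt ρZero 1 (const 0 1) skip) skip

/-! ## The coded graph -/

theorem mul_add_inj {b x y x' y' : ℕ} (hy : y < b) (hy' : y' < b) (e : x * b + y = x' * b + y') :
    x = x' ∧ y = y' := by
  have hb : 0 < b := by omega
  have e1 := congrArg (· / b) e
  have e2 := congrArg (· % b) e
  simp only [Nat.mul_comm _ b, Nat.mul_add_div hb, Nat.div_eq_of_lt hy, Nat.div_eq_of_lt hy',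
    Nat.mul_add_mod, Nat.mod_eq_of_lt hy, Nat.mod_eq_of_lt hy', Nat.add_zero] at e1 e2
  exact ⟨e1, e2⟩

/-- The data from which the graph is built. -/
structure Tables where
  S : ℕ
  q : ℕ
  D : ℕ
  V : ℕ
  M : ℕ
  start : ℕ → ℕ
  letter : ℕ → ℕ
  rem : ℕ → ℕ
  mult : ℕ → ℕ
  unit : ℕ → ℕ

namespace Tables

variable (L : Tables)

/-- The code varies fastest, so a counter that is only incremented meets all nodes in order, and
adding `V` moves to the next side. -/
def idx (g a v : ℕ) : ℕ := (g * L.S + a) * L.V + v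

/-- The code after playing the letter-side pair `i`. -/
def cap (v i : ℕ) : ℕ := if v / L.unit i % (L.mult i + 1) < L.mult i then v + L.unit i else v

def pair (g a : ℕ) : ℕ := a * L.q + L.letter g

def IsNode (g a v : ℕ) : Prop := g < L.M ∧ a < L.S ∧ v < L.V

def Step (x y : ℕ) : Prop := ∃ g a v b, L.IsNode g a v ∧ x = L.idx g a v ∧ 2 ≤ L.rem g ∧ b < L.S ∧
  b ≠ a ∧ 0 < L.mult (L.pair (g + 1) b) ∧ y = L.idx (g + 1) b (L.cap v (L.pair (g + 1) b))

/-- Side and code are unchanged because the letter shared by the two words is played, and counted,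
only once. For the same reason no multiplicity is tested: the letter is known to be on that side. -/
def Switch (x y : ℕ) : Prop := ∃ g a v i, L.IsNode g a v ∧ x = L.idx g a v ∧ L.rem g < 2 ∧
  i < L.D ∧ L.letter (L.start i) = L.letter g ∧ y = L.idx (L.start i) a v

def Source (y : ℕ) : Prop := ∃ i a, i < L.D ∧ a < L.S ∧ 0 < L.mult (L.pair (L.start i) a) ∧
  y = L.idx (L.start i) a (L.cap 0 (L.pair (L.start i) a))

def Goal (x : ℕ) : Prop := ∃ g a v, L.IsNode g a v ∧ x = L.idx g a v ∧ L.rem g < 2 ∧ v + 1 = L.V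

/-- Well-formedness. -/
structure WF : Prop where
  V_pos : 0 < L.V
  start_lt : ∀ i < L.D, L.start i < L.M
  next_lt : ∀ g < L.M, 2 ≤ L.rem g → g + 1 < L.M
  cap_lt : ∀ g < L.M, ∀ a < L.S, ∀ v < L.V, L.cap v (L.pair g a) < L.V

/-- The registers and arrays that describe the dictionary and the sides hold the right values. -/
structure Base (s : State) : Prop where
  zero : s.reg ρZero = 0
  one : s.reg ρOne = 1
  two : s.reg ρTwo = 2
  S : s.reg ρS = L.S
  q : s.reg ρq = L.q
  D : s.reg ρD = L.D
  V : s.reg ρV = L.V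
  M : s.reg ρM = L.M
  start : ∀ i < L.D, s.arr αStart i = L.start i
  letter : ∀ g < L.M, s.arr αLetter g = L.letter g
  rem : ∀ g < L.M, s.arr αRem g = L.rem g

/-- The node tables hold the right values. -/
structure Layout (s : State) : Prop extends L.Base s where
  base : ∀ g < L.M, s.arr αBase g = L.idx g 0 0
  arrive : ∀ g a v, L.IsNode g a v → s.arr αArrive (L.idx g a v) =
    if 0 < L.mult (L.pair g a) then L.idx g a (L.cap v (L.pair g a)) + 1 else 0
  pos : ∀ g a v, L.IsNode g a v → s.arr αPos (L.idx g a v) = g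
  side : ∀ g a v, L.IsNode g a v → s.arr αSide (L.idx g a v) = a
  code : ∀ g a v, L.IsNode g a v → s.arr αCode (L.idx g a v) = v
  goal : ∀ g a v, L.IsNode g a v →
    s.arr αGoal (L.idx g a v) = if L.rem g < 2 ∧ v + 1 = L.V then 1 else 0

variable {L}

theorem Base.of_agree {p : Prog} {s s' : State} (h : L.Base s) (ha : Agree p s s')
    (hr : ([ρZero, ρOne, ρTwo, ρS, ρq, ρD, ρV, ρM].all fun r => !p.writesReg r) = true)
    (hw : ([αStart, αLetter, αRem].all fun a => !p.writesArr a) = true) : L.Base s' := by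
  simp only [List.all_cons, List.all_nil, Bool.and_true, Bool.and_eq_true, Bool.not_eq_true'] at hr hw
  obtain ⟨r1, r2, r3, r4, r5, r6, r7, r8⟩ := hr
  obtain ⟨w1, w2, w3⟩ := hw
  constructor
  · rw [ha.reg _ r1, h.zero]
  · rw [ha.reg _ r2, h.one]
  · rw [ha.reg _ r3, h.two]
  · rw [ha.reg _ r4, h.S]
  · rw [ha.reg _ r5, h.q]
  · rw [ha.reg _ r6, h.D]
  · rw [ha.reg _ r7, h.V]
  · rw [ha.reg _ r8, h.M]
  · rw [ha.arr _ w1]; exact h.start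
  · rw [ha.arr _ w2]; exact h.letter
  · rw [ha.arr _ w3]; exact h.rem

theorem Layout.of_agree {p : Prog} {s s' : State} (h : L.Layout s) (ha : Agree p s s')
    (hr : ([ρZero, ρOne, ρTwo, ρS, ρq, ρD, ρV, ρM].all fun r => !p.writesReg r) = true)
    (hw : ([αStart, αLetter, αRem].all fun a => !p.writesArr a) = true)
    (hw' : ([αBase, αArrive, αPos, αSide, αCode, αGoal].all fun a => !p.writesArr a) = true) :
    L.Layout s' := by
  simp only [List.all_cons, List.all_nil, Bool.and_true, Bool.and_eq_true, Bool.not_eq_true'] at hw'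
  obtain ⟨w1, w2, w3, w4, w5, w6⟩ := hw'
  refine ⟨h.toBase.of_agree ha hr hw, ?_, ?_, ?_, ?_, ?_, ?_⟩
  · rw [ha.arr _ w1]; exact h.base
  · rw [ha.arr _ w2]; exact h.arrive
  · rw [ha.arr _ w3]; exact h.pos
  · rw [ha.arr _ w4]; exact h.side
  · rw [ha.arr _ w5]; exact h.code
  · rw [ha.arr _ w6]; exact h.goal

theorem idx_inj {g a v g' a' v' : ℕ} (h : L.IsNode g a v) (h' : L.IsNode g' a' v')
    (e : L.idx g a v = L.idx g' a' v') : g = g' ∧ a = a' ∧ v = v' := by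
  obtain ⟨e1, e2⟩ := mul_add_inj h.2.2 h'.2.2 e
  obtain ⟨e3, e4⟩ := mul_add_inj h.2.1 h'.2.1 e1
  exact ⟨e3, e4, e2⟩

theorem idx_lt {g a v : ℕ} (h : L.IsNode g a v) : L.idx g a v < L.M * L.S * L.V := by
  obtain ⟨hg, ha, hv⟩ := h
  unfold idx
  calc (g * L.S + a) * L.V + v < (g * L.S + a) * L.V + L.V := by omega
    _ = (g * L.S + a + 1) * L.V := by ring
    _ ≤ ((g + 1) * L.S) * L.V := Nat.mul_le_mul_right _ (by rw [Nat.add_mul]; omega)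
    _ ≤ _ := Nat.mul_le_mul_right _ (Nat.mul_le_mul_right _ hg)

/-- The offset of a node from the base of its position depends only on side and code. A `Switch`
keeps the offset and changes the base, which needs no multiplication. -/
theorem idx_add (g a v : ℕ) : L.idx g a v = L.idx g 0 0 + (a * L.V + v) := by
  unfold idx; ring

end Tables

/-! ## Expanding a node -/

/-- The elements of a stack. -/
def stack (f : ℕ → ℕ) (n : ℕ) : Set ℕ := {y | ∃ j < n, f j = y}

theorem stack_push (f : ℕ → ℕ) (n y : ℕ) :
    stack (Function.update f n y) (n + 1) = insert y (stack f n) := by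
  ext z
  simp only [stack, Set.mem_ofPred_eq, Set.mem_insert_iff]
  constructor
  · rintro ⟨j, hj, rfl⟩
    by_cases h : j = n
    · left; simp [h]
    · right; exact ⟨j, by omega, by simp [h]⟩
  · rintro (rfl | ⟨j, hj, rfl⟩)
    · exact ⟨n, by omega, by simp⟩
    · exact ⟨j, by omega, by rw [Function.update_of_ne (by omega)]⟩

/-- The contents of the current stack. -/
def cur (s : State) : Set ℕ := stack (s.arr αA) (s.reg ρnA)

/-- The contents of the stack for the next level. -/
def nxt (s : State) : Set ℕ := stack (s.arr αB) (s.reg ρnB)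

section push

variable (s : State)

@[simp] theorem cur_setReg {x v : ℕ} (h : x ≠ ρnA) : cur (s.setReg x v) = cur s := by
  simp [cur, h.symm]

@[simp] theorem nxt_setReg {x v : ℕ} (h : x ≠ ρnB) : nxt (s.setReg x v) = nxt s := by
  simp [nxt, h.symm]

@[simp] theorem cur_pushA (y : ℕ) : cur ((pushA y).den s) = insert (s.reg y) (cur s) := by
  simp [cur, pushA, stack_push]

@[simp] theorem nxt_pushA (y : ℕ) : nxt ((pushA y).den s) = nxt s := by
  simp [nxt, pushA]

@[simp] theorem cur_pushB (y : ℕ) : cur ((pushB y).den s) = cur s := by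
  simp [cur, pushB]

@[simp] theorem nxt_pushB (y : ℕ) : nxt ((pushB y).den s) = insert (s.reg y) (nxt s) := by
  simp [nxt, pushB, stack_push]

theorem reg_pushA (y r : ℕ) (h3 : r ≠ 3) :
    ((pushA y).den s).reg r = s.reg r + if r = ρnA then 1 else 0 := by
  by_cases h : r = ρnA
  · simp [pushA, h]
  · simp [pushA, h, h3]

theorem reg_pushB (y r : ℕ) (h3 : r ≠ 3) :
    ((pushB y).den s).reg r = s.reg r + if r = ρnB then 1 else 0 := by
  by_cases h : r = ρnB
  · simp [pushB, h]
  · simp [pushB, h, h3]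

variable {s}

theorem cur_pushStep (ho : s.reg ρOne = 1) (y : ℕ) :
    cur ((pushStep y).den s) = cur s ∪ {z | s.reg ρKind ≠ 0 ∧ z = s.reg y} := by
  by_cases h : s.reg ρKind = 0 <;> simp [pushStep, ho, h]

theorem nxt_pushStep (ho : s.reg ρOne = 1) (y : ℕ) :
    nxt ((pushStep y).den s) = nxt s ∪ {z | s.reg ρKind = 0 ∧ z = s.reg y} := by
  by_cases h : s.reg ρKind = 0 <;> simp [pushStep, ho, h]

theorem cur_pushSwitch (ho : s.reg ρOne = 1) (y : ℕ) :
    cur ((pushSwitch y).den s) = cur s ∪ {z | s.reg ρKind = 0 ∧ z = s.reg y} := by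
  by_cases h : s.reg ρKind = 0 <;> simp [pushSwitch, ho, h]

theorem nxt_pushSwitch (ho : s.reg ρOne = 1) (y : ℕ) :
    nxt ((pushSwitch y).den s) = nxt s ∪ {z | s.reg ρKind ≠ 0 ∧ z = s.reg y} := by
  by_cases h : s.reg ρKind = 0 <;> simp [pushSwitch, ho, h]

theorem reg_pushStep (y r : ℕ) (h3 : r ≠ 3) (hA : r ≠ ρnA) (hB : r ≠ ρnB) :
    ((pushStep y).den s).reg r = s.reg r := by
  simp only [pushStep, den]; split_ifs <;> simp [reg_pushA, reg_pushB, h3, hA, hB]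

theorem nA_pushStep (ho : s.reg ρOne = 1) (y : ℕ) :
    ((pushStep y).den s).reg ρnA = s.reg ρnA + (1 - (1 - s.reg ρKind)) := by
  simp only [pushStep, den, ho]; split_ifs <;> simp [reg_pushA, reg_pushB] <;> omega

theorem nB_pushStep (ho : s.reg ρOne = 1) (y : ℕ) :
    ((pushStep y).den s).reg ρnB = s.reg ρnB + (1 - s.reg ρKind) := by
  simp only [pushStep, den, ho]; split_ifs <;> simp [reg_pushA, reg_pushB] <;> omega

theorem nA_pushSwitch (ho : s.reg ρOne = 1) (y : ℕ) :
    ((pushSwitch y).den s).reg ρnA = s.reg ρnA + (1 - s.reg ρKind) := by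
  simp only [pushSwitch, den, ho]; split_ifs <;> simp [reg_pushA, reg_pushB] <;> omega

theorem nB_pushSwitch (ho : s.reg ρOne = 1) (y : ℕ) :
    ((pushSwitch y).den s).reg ρnB = s.reg ρnB + (1 - (1 - s.reg ρKind)) := by
  simp only [pushSwitch, den, ho]; split_ifs <;> simp [reg_pushA, reg_pushB] <;> omega

end push

/-- `X` with the first `j` families of candidates added. -/
def added (X : Set ℕ) (p : Prop) (C : ℕ → ℕ → Prop) (j : ℕ) : Set ℕ := X ∪ {y | p ∧ ∃ b < j, C b y}

@[simp] theorem added_zero (X : Set ℕ) (p : Prop) (C : ℕ → ℕ → Prop) : added X p C 0 = X := by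
  simp [added]

theorem added_succ {X Y Z : Set ℕ} {p : Prop} {C : ℕ → ℕ → Prop} {j : ℕ}
    (hY : Y = added X p C j) (hZ : Z = Y ∪ {y | p ∧ C j y}) : Z = added X p C (j + 1) := by
  ext y
  simp only [hZ, hY, added, Nat.lt_succ_iff_lt_or_eq, Set.mem_union, Set.mem_ofPred_eq,
    or_and_right, exists_or, exists_eq_left, and_or_left, or_assoc]

theorem added_succ_of_not {X Y : Set ℕ} {p : Prop} {C : ℕ → ℕ → Prop} {j : ℕ}
    (hY : Y = added X p C j) (h : ∀ y, ¬ C j y) : Y = added X p C (j + 1) :=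
  added_succ hY (by simp [h])

end LetterBoxed

namespace LetterBoxed

open RAM RAM.Prog Tables

theorem expandStep_spec {L : Tables} (wf : L.WF) {s : State} (hL : L.Layout s) {g a v : ℕ}
    (hn : L.IsNode g a v) (hx : s.reg ρx = L.idx g a v) (hg : s.reg ρg = g) (hr : 2 ≤ L.rem g) :
    Within expandStep s (L.S * 20 + 20) fun s' =>
      cur s' = cur s ∪ {y | s.reg ρKind ≠ 0 ∧ L.Step (L.idx g a v) y} ∧
      nxt s' = nxt s ∪ {y | s.reg ρKind = 0 ∧ L.Step (L.idx g a v) y} ∧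
      s'.reg ρnA ≤ s.reg ρnA + L.S ∧ s'.reg ρnB ≤ s.reg ρnB + L.S := by
  have hstep : ∀ y, L.Step (L.idx g a v) y ↔ ∃ b < L.S, b ≠ a ∧ 0 < L.mult (L.pair (g + 1) b) ∧
      y = L.idx (g + 1) b (L.cap v (L.pair (g + 1) b)) := by
    intro y
    constructor
    · rintro ⟨g', a', v', b, hn', e, -, hb, hba, hm, hy⟩
      obtain ⟨rfl, rfl, rfl⟩ := idx_inj hn hn' e
      exact ⟨b, hb, hba, hm, hy⟩
    · rintro ⟨b, hb, hba, hm, hy⟩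
      exact ⟨g, a, v, b, hn, rfl, hr, hb, hba, hm, hy⟩
  let C : ℕ → ℕ → Prop := fun b y => b ≠ a ∧ 0 < L.mult (L.pair (g + 1) b) ∧
    y = L.idx (g + 1) b (L.cap v (L.pair (g + 1) b))
  have hg1 := wf.next_lt g hn.1 hr
  refine Within.mono (B := 8 + (L.S * (15 + 3) + 2)) (Within.seq (Within.mono (B' := 8)
    (Within.block rfl rfl) (by decide) ?_)) (by omega) (fun _ _ h => h)
  rintro s1 ha1 rfl
  -- The address in `ρy` runs through the nodes at the next position with the old code `v`; their
  -- entries in `αArrive` already contain the code after the letter has been counted.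
  refine Within.mono (Within.forLt (N := L.S) (B := 15) (fun j s' =>
    s'.reg ρy = L.idx (g + 1) j v ∧
      cur s' = added (cur s) (s.reg ρKind ≠ 0) C j ∧ nxt s' = added (nxt s) (s.reg ρKind = 0) C j ∧
      s'.reg ρnA ≤ s.reg ρnA + j ∧ s'.reg ρnB ≤ s.reg ρnB + j) rfl ?_ ?_ ?_) le_rfl ?_
  · simp [hL.S]
  · simp [hx, hg, hL.code _ _ _ hn, hL.base _ hg1]
    simp [idx]
  · rintro j s2 hj ⟨h1, h2, h3, h4⟩ hb ha2
    have hN : L.IsNode (g + 1) j v := ⟨hg1, hj, hn.2.2⟩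
    have hT : s2.arr αArrive (L.idx (g + 1) j v) = if 0 < L.mult (L.pair (g + 1) j) then
        L.idx (g + 1) j (L.cap v (L.pair (g + 1) j)) + 1 else 0 := by
      rw [← hL.arrive _ _ _ hN, ha2.arr αArrive rfl]; rfl
    have hV : s2.reg ρV = L.V := by rw [ha2.reg ρV rfl, ← hL.V]; rfl
    have hK : s2.reg ρKind = s.reg ρKind := by rw [ha2.reg ρKind rfl]; rfl
    have h0 : s2.reg ρZero = 0 := by rw [ha2.reg ρZero rfl, ← hL.zero]; rfl
    have ho : s2.reg ρOne = 1 := by rw [ha2.reg ρOne rfl, ← hL.one]; rfl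
    have ha : s2.reg ρa = a := by rw [ha2.reg ρa rfl]; simp [hx, hL.side _ _ _ hn]
    have hy : L.idx (g + 1) j v + L.V = L.idx (g + 1) (j + 1) v := by unfold idx; ring
    refine Within.mono (Within.block rfl ?_) (by decide) (fun _ _ h => h)
    by_cases hm : 0 < L.mult (L.pair (g + 1) j)
    · rw [if_pos hm] at hT
      -- The machine compares only by `<`, so `b ≠ a` is tested as two inequalities.
      rcases Nat.lt_trichotomy j a with hja | hja | hja
      · simp [h1, hT, hV, h0, ho, ha, hy, hb, hja, reg_pushStep, nA_pushStep, nB_pushStep, nxt_pushStep, cur_pushStep]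
        refine ⟨added_succ h2 ?_, added_succ h3 ?_, by omega⟩ <;> simp [C, hm, hja.ne, hK]
      · simp [h1, hT, hV, h0, ho, ha, hy, hb, ← hja]
        refine ⟨added_succ_of_not h2 ?_, added_succ_of_not h3 ?_, by omega⟩ <;> simp [C, hja]
      · simp [h1, hT, hV, h0, ho, ha, hy, hb, hja, hja.not_gt, reg_pushStep, nA_pushStep, nB_pushStep, nxt_pushStep, cur_pushStep]
        refine ⟨added_succ h2 ?_, added_succ h3 ?_, by omega⟩ <;> simp [C, hm, hja.ne', hK]
    · rw [if_neg hm] at hT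
      simp [h1, hT, hV, h0, hy]
      refine ⟨added_succ_of_not h2 ?_, added_succ_of_not h3 ?_, by omega⟩ <;> simp [C, hm]
  · rintro s3 - ⟨-, h2, h3, h4⟩
    simp only [hstep]
    exact ⟨h2, h3, h4⟩

theorem expandSwitch_spec {L : Tables} (wf : L.WF) {s : State} (hL : L.Layout s) {g a v : ℕ}
    (hn : L.IsNode g a v) (hx : s.reg ρx = L.idx g a v) (hg : s.reg ρg = g) (hr : L.rem g < 2) :
    Within expandSwitch s (L.D * 20 + 20) fun s' =>
      cur s' = cur s ∪ {y | s.reg ρKind = 0 ∧ L.Switch (L.idx g a v) y} ∧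
      nxt s' = nxt s ∪ {y | s.reg ρKind ≠ 0 ∧ L.Switch (L.idx g a v) y} ∧
      s'.reg ρnA ≤ s.reg ρnA + L.D ∧ s'.reg ρnB ≤ s.reg ρnB + L.D := by
  have hswitch : ∀ y, L.Switch (L.idx g a v) y ↔ ∃ i < L.D, L.letter (L.start i) = L.letter g ∧
      y = L.idx (L.start i) a v := by
    intro y
    constructor
    · rintro ⟨g', a', v', b, hn', e, -, hb, hl, hy⟩
      obtain ⟨rfl, rfl, rfl⟩ := idx_inj hn hn' e
      exact ⟨b, hb, hl, hy⟩
    · rintro ⟨b, hb, hl, hy⟩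
      exact ⟨g, a, v, b, hn, rfl, hr, hb, hl, hy⟩
  let C : ℕ → ℕ → Prop := fun i y => L.letter (L.start i) = L.letter g ∧ y = L.idx (L.start i) a v
  refine Within.mono (B := 8 + (L.D * (15 + 3) + 2)) (Within.seq (Within.mono (B' := 8)
    (Within.block rfl rfl) (by decide) ?_)) (by omega) (fun _ _ h => h)
  rintro s1 ha1 rfl
  refine Within.mono (Within.forLt (N := L.D) (B := 15) (fun j s' =>
      cur s' = added (cur s) (s.reg ρKind = 0) C j ∧ nxt s' = added (nxt s) (s.reg ρKind ≠ 0) C j ∧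
      s'.reg ρnA ≤ s.reg ρnA + j ∧ s'.reg ρnB ≤ s.reg ρnB + j) rfl ?_ ?_ ?_) le_rfl ?_
  · simp [hL.D]
  · simp
  · rintro j s2 hj ⟨h2, h3, h4⟩ hb ha2
    have hg' := wf.start_lt _ hj
    have hst : s2.arr αStart j = L.start j := by
      rw [← hL.start _ hj, ha2.arr αStart rfl]; rfl
    have hlt : s2.arr αLetter (L.start j) = L.letter (L.start j) := by
      rw [← hL.letter _ hg', ha2.arr αLetter rfl]; rfl
    have hbase : s2.arr αBase (L.start j) = L.idx (L.start j) 0 0 := by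
      rw [← hL.base _ hg', ha2.arr αBase rfl]; rfl
    have hK : s2.reg ρKind = s.reg ρKind := by rw [ha2.reg ρKind rfl]; rfl
    have ho : s2.reg ρOne = 1 := by rw [ha2.reg ρOne rfl, ← hL.one]; rfl
    have hl : s2.reg ρl = L.letter g := by rw [ha2.reg ρl rfl]; simp [hg, hL.letter _ hn.1]
    -- Subtracting the base of the position from the node leaves exactly the offset given by side
    -- and code.
    have hoff : s2.reg ρo = a * L.V + v := by
      rw [ha2.reg ρo rfl]
      simp [hg, hx, hL.base _ hn.1]
      rw [idx_add g a v]; omega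
    have hy : L.idx (L.start j) 0 0 + (a * L.V + v) = L.idx (L.start j) a v := (idx_add _ _ _).symm
    refine Within.mono (Within.block rfl ?_) (by decide) (fun _ _ h => h)
    rcases Nat.lt_trichotomy (L.letter (L.start j)) (L.letter g) with hja | hja | hja
    · simp [hst, hlt, hl, hb, hja]
      refine ⟨added_succ_of_not h2 ?_, added_succ_of_not h3 ?_, by omega⟩ <;> simp [C, hja.ne]
    · simp [hst, hlt, hl, hb, hja, hbase, hoff, ho, hy, nA_pushSwitch, nB_pushSwitch, nxt_pushSwitch, cur_pushSwitch]
      refine ⟨added_succ h2 ?_, added_succ h3 ?_, by omega⟩ <;> simp [C, hK, hja]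
    · simp [hst, hlt, hl, hb, hja, hja.not_gt]
      refine ⟨added_succ_of_not h2 ?_, added_succ_of_not h3 ?_, by omega⟩ <;> simp [C, hja.ne']
  · rintro s3 - ⟨h2, h3, h4⟩
    simp only [hswitch]
    exact ⟨h2, h3, h4⟩

namespace Tables

/-- The edges that do not count. -/
def Free (L : Tables) (κ x y : ℕ) : Prop := κ ≠ 0 ∧ L.Step x y ∨ κ = 0 ∧ L.Switch x y

/-- The edges that count. -/
def Paid (L : Tables) (κ x y : ℕ) : Prop := κ = 0 ∧ L.Step x y ∨ κ ≠ 0 ∧ L.Switch x y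

end Tables

/-- All edges out of a node are of one kind: `Step` edges before the end of a word, `Switch` edges
at its end. So in each branch the edges of the other kind are vacuous, and which stack receives the
targets depends on the kind of search. -/
theorem expand_spec {L : Tables} (wf : L.WF) {s : State} (hL : L.Layout s) {g a v : ℕ}
    (hn : L.IsNode g a v) (hx : s.reg ρx = L.idx g a v) :
    Within expand s ((L.S + L.D) * 20 + 30) fun s' =>
      cur s' = cur s ∪ {y | L.Free (s.reg ρKind) (s.reg ρx) y} ∧
      nxt s' = nxt s ∪ {y | L.Paid (s.reg ρKind) (s.reg ρx) y} ∧
      s'.reg ρnA ≤ s.reg ρnA + (L.S + L.D) ∧ s'.reg ρnB ≤ s.reg ρnB + (L.S + L.D) := by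
  refine Within.mono (B := 2 + ((L.S + L.D) * 20 + 20 + 1)) (Within.seq (Within.mono (B' := 2)
    (Within.block rfl rfl) (by decide) ?_)) (by omega) (fun _ _ h => h)
  rintro s1 ha1 rfl
  have hL' := hL.of_agree ha1 rfl rfl rfl
  have hrem : s.arr αRem g = L.rem g := hL.rem g hn.1
  refine Within.ifLt (fun h => ?_) (fun h => ?_)
  · have h' : L.rem g < 2 := by
      simp [hx, hL.pos _ _ _ hn, hrem, hL.two] at h; omega
    refine Within.mono (expandSwitch_spec wf hL' hn (by simp [hx]) (by simp [hx, hL.pos _ _ _ hn]) h')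
      (by omega) ?_
    rintro s2 - ⟨h1, h2, h3⟩
    have hno : ∀ y, ¬ L.Step (L.idx g a v) y := by
      rintro y ⟨g', a', v', b, hn', e, hr', -⟩
      obtain ⟨rfl, rfl, rfl⟩ := idx_inj hn hn' e
      omega
    simp at h1 h2 h3
    simp [Free, Paid, h1, h2, hx, hno]
    omega
  · have h' : 2 ≤ L.rem g := by
      simp [hx, hL.pos _ _ _ hn, hrem, hL.two] at h; omega
    refine Within.mono (expandStep_spec wf hL' hn (by simp [hx]) (by simp [hx, hL.pos _ _ _ hn]) h')
      (by omega) ?_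
    rintro s2 - ⟨h1, h2, h3⟩
    have hno : ∀ y, ¬ L.Switch (L.idx g a v) y := by
      rintro y ⟨g', a', v', b, hn', e, hr', -⟩
      obtain ⟨rfl, rfl, rfl⟩ := idx_inj hn hn' e
      omega
    simp at h1 h2 h3
    simp [Free, Paid, h1, h2, hx, hno]
    omega

theorem sources_spec {L : Tables} (wf : L.WF) {s : State} (hL : L.Layout s) :
    Within sources s (L.D * (L.S * 20 + 20) + 20) fun s' =>
      nxt s' = {y | L.Source y} ∧ s'.reg ρnB ≤ L.D * L.S := by
  let C (i a y : ℕ) : Prop := 0 < L.mult (L.pair (L.start i) a) ∧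
    y = L.idx (L.start i) a (L.cap 0 (L.pair (L.start i) a))
  let C' (i y : ℕ) : Prop := ∃ a < L.S, C i a y
  refine Within.mono (B := 1 + (L.D * ((2 + (L.S * (15 + 3) + 2)) + 3) + 2))
    (Within.seq (Within.mono (B' := 1) (Within.block rfl rfl) (by decide) ?_))
    (by have : L.S * (15 + 3) ≤ L.S * 20 := by omega
        have := Nat.mul_le_mul_left L.D (show (2 + (L.S * (15 + 3) + 2)) + 3 ≤ L.S * 20 + 20 by omega)
        omega) (fun _ _ h => h)
  rintro s1 ha1 rfl
  have hL1 := hL.of_agree ha1 rfl rfl rfl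
  refine Within.mono (Within.forLt (N := L.D) (fun i s' =>
    nxt s' = added ∅ True C' i ∧ s'.reg ρnB ≤ i * L.S) rfl hL1.D ?_ ?_) le_rfl ?_
  · simp [nxt, stack]
  · rintro i s2 hi ⟨h1, h2⟩ hri ha2
    have hL2 := hL1.of_agree ha2 rfl rfl rfl
    refine Within.seq (Within.mono (B' := 2) (Within.block rfl rfl) (by decide) ?_)
    rintro s3 ha3 rfl
    have hL3 := hL2.of_agree ha3 rfl rfl rfl
    have hg := wf.start_lt _ hi
    refine Within.mono (Within.forLt (N := L.S) (B := 15) (fun a s' =>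
      s'.reg ρx = L.idx (L.start i) a 0 ∧ nxt s' = added (nxt s2) True (C i) a ∧
      s'.reg ρnB ≤ i * L.S + a) rfl hL3.S ?_ ?_) le_rfl ?_
    · simp [hri, hL2.start _ hi, hL2.base _ hg, h2]
    · rintro a s4 ha ⟨h3, h4, h5⟩ hra ha4
      have hL4 := hL3.of_agree ha4 rfl rfl rfl
      have hy : L.idx (L.start i) a 0 + L.V = L.idx (L.start i) (a + 1) 0 := by unfold idx; ring
      have hT := hL4.arrive (L.start i) a 0 ⟨hg, ha, wf.V_pos⟩
      refine Within.mono (Within.block rfl ?_) (by decide) (fun _ _ h => h)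
      by_cases hm : 0 < L.mult (L.pair (L.start i) a)
      · rw [if_pos hm] at hT
        simp [h3, hT, hL4.zero, hL4.one, hL4.V, hy, reg_pushB]
        refine ⟨added_succ h4 ?_, by omega⟩
        ext y; simp [C, hm]
      · rw [if_neg hm] at hT
        simp [h3, hT, hL4.zero, hL4.V, hy]
        refine ⟨added_succ_of_not h4 ?_, by omega⟩
        simp [C, hm]
    · rintro s5 - ⟨-, h3, h4⟩
      simp
      refine ⟨added_succ h1 ?_, by rw [Nat.add_mul]; omega⟩
      rw [h3]
      ext y
      simp [added, C']
  · rintro s6 - ⟨h1, h2⟩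
    refine ⟨?_, h2⟩
    rw [h1]
    ext y
    simp only [added, C', C, Source, Set.mem_union, Set.mem_ofPred_eq, Set.mem_empty_iff_false,
      false_or, true_and]
    constructor
    · rintro ⟨i, hi, a, ha, h⟩; exact ⟨i, a, hi, ha, h⟩
    · rintro ⟨i, a, hi, ha, h⟩; exact ⟨i, hi, a, ha, h⟩

end LetterBoxed

/-! ## Breadth first search -/

namespace LetterBoxed

open RAM RAM.Prog Tables

/-! ### 0-1 breadth first search on an abstract graph -/

section abstract

/-- `Cost src F P d x`: there is a walk from a source to `x`, where entering at a source and each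
edge in `P` costs 1 and the edges in `F` are free. -/
inductive Cost (src : ℕ → Prop) (F P : ℕ → ℕ → Prop) : ℕ → ℕ → Prop
  | source {x} : src x → Cost src F P 1 x
  | free {d x y} : Cost src F P d x → F x y → Cost src F P d y
  | paid {d x y} : Cost src F P d x → P x y → Cost src F P (d + 1) y

variable {src goal : ℕ → Prop} {F P : ℕ → ℕ → Prop}

/-- What is known about the goals when the nodes in `X` have been visited. -/
def AnsOk (src goal : ℕ → Prop) (F P : ℕ → ℕ → Prop) (X : Set ℕ) (ans : ℕ) : Prop :=
  (ans = 0 ∧ ∀ x ∈ X, ¬ goal x) ∨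
    (0 < ans ∧ IsLeast {d | ∃ x, goal x ∧ Cost src F P d x} ans)

/-- The invariant between levels. -/
structure Between (src goal : ℕ → Prop) (F P : ℕ → ℕ → Prop) (d ans : ℕ) (X B : Set ℕ) : Prop where
  visited : ∀ x ∈ X, ∃ d' ≤ d, Cost src F P d' x
  next : ∀ x ∈ B, ∃ d' ≤ d + 1, Cost src F P d' x
  free : ∀ x ∈ X, ∀ y, F x y → y ∈ X
  paid : ∀ x ∈ X, ∀ y, P x y → y ∈ X ∪ B
  source : ∀ x, src x → x ∈ X ∪ B
  all : ∀ d' x, d' ≤ d → Cost src F P d' x → x ∈ X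
  ans : AnsOk src goal F P X ans

/-- The invariant within level `d + 1`. -/
structure During (src goal : ℕ → Prop) (F P : ℕ → ℕ → Prop) (d ans : ℕ) (X A B : Set ℕ) :
    Prop where
  visited : ∀ x ∈ X ∪ A, ∃ d' ≤ d + 1, Cost src F P d' x
  next : ∀ x ∈ B, ∃ d' ≤ d + 2, Cost src F P d' x
  free : ∀ x ∈ X, ∀ y, F x y → y ∈ X ∪ A
  paid : ∀ x ∈ X, ∀ y, P x y → y ∈ X ∪ A ∪ B
  source : ∀ x, src x → x ∈ X ∪ A
  all : ∀ d' x, d' ≤ d → Cost src F P d' x → x ∈ X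
  old : ∀ d' x, d' ≤ d → Cost src F P d' x → ∀ y, P x y → y ∈ X ∪ A
  ans : AnsOk src goal F P X ans

theorem Between.during {d ans : ℕ} {X B : Set ℕ} (h : Between src goal F P d ans X B) :
    During src goal F P d ans X B ∅ where
  visited := by
    rintro x (hx | hx)
    · obtain ⟨d', h1, h2⟩ := h.visited x hx
      exact ⟨d', by omega, h2⟩
    · exact h.next x hx
  next := by simp
  free x hx y hy := .inl (h.free x hx y hy)
  paid x hx y hy := .inl (h.paid x hx y hy)
  source := h.source
  all := h.all
  old d' x hd hx y hy := h.paid x (h.all d' x hd hx) y hy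
  ans := h.ans

/-- With nothing pending, every node of cost at most `d + 1` has been visited. Along a walk, a
source is visited by `source`, a free edge stays in the closed set `X`, and a last paid edge starts
at a node of cost at most `d`, where `old` applies; `paid` alone would allow its target to be still
in `B`. -/
theorem During.between {d ans : ℕ} {X B : Set ℕ} (h : During src goal F P d ans X ∅ B) :
    Between src goal F P (d + 1) ans X B where
  visited x hx := h.visited x (.inl hx)
  next := h.next
  free x hx y hy := by simpa using h.free x hx y hy
  paid x hx y hy := by simpa using h.paid x hx y hy
  source x hx := by have := h.source x hx; simp at this; exact .inl this
  all := by
    intro d' x hd hx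
    induction hx with
    | source hs => simpa using h.source _ hs
    | free _ hF ih => simpa using h.free _ (ih hd) _ hF
    | paid hx hP _ => simpa using h.old _ _ (by omega) hx _ hP
  ans := h.ans

/-- Nodes are marked when popped, not when pushed, so a node may be found on a stack again after its
visit. -/
theorem During.pop_old {d ans x : ℕ} {X A B : Set ℕ}
    (h : During src goal F P d ans X (insert x A) B) (hx : x ∈ X) :
    During src goal F P d ans X A B := by
  have e : X ∪ insert x A = X ∪ A := by
    ext y; simp only [Set.mem_union, Set.mem_insert_iff]
    constructor
    · rintro (h | rfl | h)
      exacts [.inl h, .inl hx, .inr h]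
    · rintro (h | h)
      exacts [.inl h, .inr (.inr h)]
  constructor
  · rw [← e]; exact h.visited
  · exact h.next
  · rw [← e]; exact h.free
  · rw [← e]; exact h.paid
  · rw [← e]; exact h.source
  · exact h.all
  · rw [← e]; exact h.old
  · exact h.ans

/-- The first goal to be visited has the least cost: all nodes of cost at most `d` are in `X`, which
has contained no goal so far, and the new node `x` has cost at most `d + 1`. -/
theorem During.pop_new {d ans ans' x : ℕ} {X A B : Set ℕ}
    (h : During src goal F P d ans X (insert x A) B) (hx : x ∉ X)
    (h1 : ans = 0 → goal x → ans' = d + 1) (h2 : ans ≠ 0 ∨ ¬ goal x → ans' = ans) :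
    During src goal F P d ans' (insert x X) (A ∪ {y | F x y}) (B ∪ {y | P x y}) := by
  obtain ⟨d0, hd0, hc⟩ := h.visited x (.inr (.inl rfl))
  have hsub : ∀ y, y ∈ X ∪ insert x A → y ∈ insert x X ∪ (A ∪ {y | F x y}) := by
    rintro y (h | rfl | h)
    exacts [.inl (.inr h), .inl (.inl rfl), .inr (.inl h)]
  constructor
  · rintro y ((rfl | hy) | hy | hy)
    · exact ⟨d0, hd0, hc⟩
    · exact h.visited y (.inl hy)
    · exact h.visited y (.inr (.inr hy))
    · exact ⟨d0, hd0, hc.free hy⟩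
  · rintro y (hy | hy)
    · exact h.next y hy
    · exact ⟨d0 + 1, by omega, hc.paid hy⟩
  · rintro z (rfl | hz) y hy
    · exact .inr (.inr hy)
    · exact hsub y (h.free z hz y hy)
  · rintro z (rfl | hz) y hy
    · exact .inr (.inr hy)
    · rcases h.paid z hz y hy with hy | hy
      · exact .inl (hsub y hy)
      · exact .inr (.inl hy)
  · exact fun z hz => hsub z (h.source z hz)
  · exact fun d' z hd hz => .inr (h.all d' z hd hz)
  · exact fun d' z hd hz y hy => hsub y (h.old d' z hd hz y hy)
  · rcases h.ans with ⟨ha, hX⟩ | ⟨ha, hX⟩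
    · by_cases hg : goal x
      · rw [h1 ha hg]
        refine .inr ⟨by omega, ⟨x, hg, ?_⟩, ?_⟩
        · obtain rfl : d0 = d + 1 := by
            by_contra hne
            exact hx (h.all d0 x (by omega) hc)
          exact hc
        · rintro d' ⟨z, hz, hcz⟩
          by_contra hlt
          exact hX z (h.all d' z (by omega) hcz) hz
      · rw [h2 (.inr hg)]
        exact .inl ⟨ha, by rintro y (rfl | hy); exacts [hg, hX y hy]⟩
    · rw [h2 (.inl (by omega))]
      exact .inr ⟨ha, hX⟩

/-- With an empty next stack, `X` contains the sources and is closed under all edges, hence contains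
every reachable node; answer 0 then means that no goal is reachable. -/
theorem Between.final {d ans : ℕ} {X : Set ℕ} (h : Between src goal F P d ans X ∅) :
    (ans = 0 ∧ ∀ d x, Cost src F P d x → ¬ goal x) ∨
      (0 < ans ∧ IsLeast {d | ∃ x, goal x ∧ Cost src F P d x} ans) := by
  have hall : ∀ d x, Cost src F P d x → x ∈ X := by
    intro d x hx
    induction hx with
    | source hs => simpa using h.source _ hs
    | free _ hF ih => exact h.free _ ih _ hF
    | paid _ hP ih => simpa using h.paid _ ih _ hP
  rcases h.ans with ⟨ha, hX⟩ | h'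
  · exact .inl ⟨ha, fun d x hx => hX x (hall d x hx)⟩
  · exact .inr h'

end abstract

/-- The visited nodes. -/
def visited (s : State) : Set ℕ := {x | s.reg ρMark ≤ s.arr αVis x}

/-- Nothing above the current mark has been written. -/
def MarksLe (s : State) : Prop := ∀ x, s.arr αVis x ≤ s.reg ρMark

/-- The number of nodes not yet visited. -/
def unvisited (N : ℕ) (s : State) : ℕ :=
  ((Finset.range N).filter fun x => s.arr αVis x < s.reg ρMark).card

namespace Tables

variable (L : Tables)

abbrev numNodes : ℕ := L.M * L.S * L.V

/-- The potential that pays for the search. -/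
def potential (s : State) : ℕ :=
  ((L.S + L.D) * 60 + 60) * unvisited L.numNodes s + 10 * s.reg ρnA + 30 * s.reg ρnB

variable {L}

/-- Walks never leave the range of the tables. This makes the table entries of a popped address
meaningful, and makes its first visit lower the number of unvisited nodes. -/
theorem Cost.isNode (wf : L.WF) {κ d x : ℕ} (h : Cost L.Source (L.Free κ) (L.Paid κ) d x) :
    ∃ g a v, L.IsNode g a v ∧ x = L.idx g a v := by
  have hS : ∀ x y, L.Step x y → ∃ g a v, L.IsNode g a v ∧ y = L.idx g a v := by
    rintro x y ⟨g, a, v, b, hn, -, hr, hb, -, -, rfl⟩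
    have := wf.next_lt g hn.1 hr
    exact ⟨_, _, _, ⟨this, hb, wf.cap_lt _ this _ hb _ hn.2.2⟩, rfl⟩
  have hW : ∀ x y, L.Switch x y → ∃ g a v, L.IsNode g a v ∧ y = L.idx g a v := by
    rintro x y ⟨g, a, v, i, hn, -, hr, hi, -, rfl⟩
    exact ⟨_, _, _, ⟨wf.start_lt i hi, hn.2.1, hn.2.2⟩, rfl⟩
  cases h with
  | source h =>
    obtain ⟨i, a, hi, ha, -, rfl⟩ := h
    exact ⟨_, _, _, ⟨wf.start_lt i hi, ha, wf.cap_lt _ (wf.start_lt i hi) _ ha _ wf.V_pos⟩, rfl⟩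
  | free _ h => rcases h with ⟨-, h⟩ | ⟨-, h⟩; exacts [hS _ _ h, hW _ _ h]
  | paid _ h => rcases h with ⟨-, h⟩ | ⟨-, h⟩; exacts [hS _ _ h, hW _ _ h]

end Tables

theorem unvisited_mark {N x m : ℕ} {s s' : State} (hx : x < N) (h : s.arr αVis x < s.reg ρMark)
    (hm : s'.reg ρMark = s.reg ρMark) (hv : s'.arr αVis = Function.update (s.arr αVis) x m)
    (hmm : s.reg ρMark ≤ m) :
    unvisited N s' + 1 = unvisited N s := by
  unfold unvisited
  rw [← Finset.card_erase_add_one (s := (Finset.range N).filter fun x => s.arr αVis x < s.reg ρMark)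
    (a := x) (by simp [hx, h])]
  congr 2
  ext y
  simp only [Finset.mem_filter, Finset.mem_range, Finset.mem_erase, hv, hm]
  by_cases hy : y = x
  · subst hy; simp; intro _; exact hmm
  · simp [hy]

open Classical in
theorem visit_spec {L : Tables} (wf : L.WF) {s : State} (hL : L.Layout s) {d : ℕ}
    (hd : s.reg ρDist = d + 1) (hnA : 0 < s.reg ρnA) (hM : MarksLe s)
    (hI : During L.Source L.Goal (L.Free (s.reg ρKind)) (L.Paid (s.reg ρKind)) d (s.reg ρAns)
      (visited s) (cur s) (nxt s)) :
    Runs visit s fun t s' => (MarksLe s' ∧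
      During L.Source L.Goal (L.Free (s.reg ρKind)) (L.Paid (s.reg ρKind)) d
      (s'.reg ρAns) (visited s') (cur s') (nxt s')) ∧ L.potential s' + t + 1 ≤ L.potential s := by
  set x := s.arr αA (s.reg ρnA - 1) with hx
  have hcur : cur s = insert x (stack (s.arr αA) (s.reg ρnA - 1)) := by
    have := stack_push (s.arr αA) (s.reg ρnA - 1) x
    rwa [hx, Function.update_eq_self, Nat.sub_add_cancel hnA] at this
  rw [hcur] at hI
  obtain ⟨d0, -, hc⟩ := hI.visited x (.inr (.inl rfl))
  obtain ⟨g, a, v, hn, hxn⟩ := Cost.isNode wf hc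
  refine Runs.seq (Runs.mono (Within.block rfl rfl) ?_)
  rintro t1 s1 ha1 ⟨ht1, rfl⟩
  have hL1 := hL.of_agree ha1 rfl rfl rfl
  have ht1' : t1 ≤ 3 := ht1
  refine Runs.ifLt (fun hc => ?_) (fun hc => ?_)
  · have hnew : s.arr αVis x < s.reg ρMark := by simpa [hL.one, ← hx] using hc
    refine Runs.seq (Runs.mono (Within.block rfl rfl) ?_)
    rintro t2 s2 ha2 ⟨ht2, rfl⟩
    have ht2' : t2 ≤ 5 := ht2
    have hL2 := hL1.of_agree ha2 rfl rfl rfl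
    have hx2 : (markNode.den
        ((sub ρnA ρnA ρOne ;; load ρx αA ρnA ;; load ρy αVis ρx).den s)).reg ρx = x := by
      simp [markNode, hL.one]
      split_ifs <;> simp [hx]
    have hv2 : (markNode.den
        ((sub ρnA ρnA ρOne ;; load ρx αA ρnA ;; load ρy αVis ρx).den s)).arr αVis =
        Function.update (s.arr αVis) x (s.reg ρMark) := by
      simp [markNode, hL.one]
      split_ifs <;> simp [hx]
    have hn2 : (markNode.den
        ((sub ρnA ρnA ρOne ;; load ρx αA ρnA ;; load ρy αVis ρx).den s)).reg ρnA =
        s.reg ρnA - 1 := by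
      simp [markNode, hL.one]
      split_ifs <;> simp
    have hgoal : s.arr αGoal x = if L.Goal x then 1 else 0 := by
      rw [hxn, hL.goal _ _ _ hn]
      congr 1
      refine propext ⟨fun h => ⟨g, a, v, hn, rfl, h⟩, ?_⟩
      rintro ⟨g', a', v', hn', e, h⟩
      obtain ⟨rfl, rfl, rfl⟩ := idx_inj hn hn' e
      exact h
    have hans2 : (markNode.den
        ((sub ρnA ρnA ρOne ;; load ρx αA ρnA ;; load ρy αVis ρx).den s)).reg ρAns =
        if s.reg ρAns = 0 ∧ L.Goal x then d + 1 else s.reg ρAns := by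
      by_cases h0 : s.reg ρAns = 0 <;> by_cases h1 : L.Goal x <;>
        simp [markNode, hL.one, hL.zero, h0, h1, ← hx, hgoal, hd]
    generalize hs2 : markNode.den
        ((sub ρnA ρnA ρOne ;; load ρx αA ρnA ;; load ρy αVis ρx).den s) = s2
      at hx2 hv2 hn2 hans2 ha2 hL2
    have hA2 : s2.arr αA = s.arr αA := by rw [ha2.arr αA rfl, ha1.arr αA rfl]
    have hB2 : s2.arr αB = s.arr αB := by rw [ha2.arr αB rfl, ha1.arr αB rfl]
    have hnB2 : s2.reg ρnB = s.reg ρnB := by rw [ha2.reg ρnB rfl, ha1.reg ρnB rfl]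
    have hK2 : s2.reg ρKind = s.reg ρKind := by rw [ha2.reg ρKind rfl, ha1.reg ρKind rfl]
    have hM2 : s2.reg ρMark = s.reg ρMark := by rw [ha2.reg ρMark rfl, ha1.reg ρMark rfl]
    refine Runs.mono (expand_spec wf hL2 hn (hx2.trans hxn)) ?_
    rintro t3 s3 ha3 ⟨ht3, h1, h2, h3⟩
    rw [hx2, hK2] at h1 h2
    have hvis3 : visited s3 = insert x (visited s) := by
      ext y
      simp only [visited, ha3.arr αVis rfl, ha3.reg ρMark rfl, hM2, hv2, Set.mem_ofPred_eq,
        Set.mem_insert_iff]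
      by_cases hy : y = x <;> simp [hy]
    refine ⟨⟨?_, ?_⟩, ?_⟩
    · intro y
      rw [ha3.arr αVis rfl, ha3.reg ρMark rfl, hM2, hv2]
      by_cases hy : y = x
      · simp [hy]
      · rw [Function.update_of_ne hy]; exact hM y
    · have hcur2 : cur s2 = stack (s.arr αA) (s.reg ρnA - 1) := by simp only [cur, hA2, hn2]
      have hnxt2 : nxt s2 = nxt s := by simp only [nxt, hB2, hnB2]
      rw [h1, h2, hvis3, hcur2, hnxt2, ha3.reg ρAns rfl, hans2]
      refine hI.pop_new (by simpa [visited] using hnew) (fun h h' => if_pos ⟨h, h'⟩) (fun h => if_neg ?_)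
      rintro ⟨h4, h5⟩
      rcases h with h | h
      exacts [h h4, h h5]
    -- The visit of a new node releases 60 units per possible edge: 20 for the time of the
    -- expansion, 10 for an entry pushed on the current stack, 30 for one pushed on the next. The
    -- remaining 60 cover the constant overhead.
    · have hun := unvisited_mark (N := L.numNodes) (hxn ▸ idx_lt hn) hnew
        ((ha3.reg ρMark rfl).trans hM2) ((ha3.arr αVis rfl).trans hv2) le_rfl
      have hun' : unvisited L.numNodes s = unvisited L.numNodes s3 + 1 := hun.symm
      unfold potential
      rw [hun', Nat.mul_succ ((L.S + L.D) * 60 + 60) (unvisited _ _)]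
      rw [hn2, hnB2] at h3
      omega
  · have hold : x ∈ visited s := by simpa [hL.one, ← hx, visited] using hc
    refine Runs.mono (Within.block rfl rfl) ?_
    rintro t2 s2 ha2 ⟨ht2, rfl⟩
    have ht2' : t2 ≤ 1 := ht2
    refine ⟨⟨hM, by simpa [cur, nxt, visited, hL.one] using hI.pop_old hold⟩, ?_⟩
    simp [potential, unvisited, hL.one]
    omega

theorem level_spec {L : Tables} (wf : L.WF) {s : State} (hL : L.Layout s) (hnB : 0 < s.reg ρnB)
    (hnA : s.reg ρnA = 0) (hM : MarksLe s)
    (hI : Between L.Source L.Goal (L.Free (s.reg ρKind)) (L.Paid (s.reg ρKind)) (s.reg ρDist)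
      (s.reg ρAns) (visited s) (nxt s)) :
    Runs level s fun t s' => (s'.reg ρnA = 0 ∧ MarksLe s' ∧
      Between L.Source L.Goal (L.Free (s.reg ρKind)) (L.Paid (s.reg ρKind)) (s'.reg ρDist)
      (s'.reg ρAns) (visited s') (nxt s')) ∧ L.potential s' + t + 1 ≤ L.potential s := by
  refine Runs.seq (Runs.mono (Within.forLt (N := s.reg ρnB) (B := 2)
    (fun j s' => ∀ i < j, s'.arr αA i = s.arr αB i) rfl rfl (by simp) ?_) ?_)
  · rintro j s' hj h hr ha
    refine Within.mono (Within.block rfl ?_) (by decide) (fun _ _ h => h)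
    intro i hi
    have hB : s'.arr αB = s.arr αB := ha.arr αB rfl
    by_cases hij : i = j
    · simp [hij, hr, hB]
    · simp [hr, hB, hij, h i (by omega)]
  rintro t1 s1 ha1 ⟨ht1, h1⟩
  refine Runs.seq (Runs.mono (Within.block rfl rfl) ?_)
  rintro t2 s2 ha2 ⟨ht2, hs2⟩
  have ht2' : t2 ≤ 4 := ht2
  have hL2 := (hL.of_agree ha1 rfl rfl rfl).of_agree ha2 rfl rfl rfl
  have hd2 : s2.reg ρDist = s.reg ρDist + 1 := by rw [← hs2]; simp [ha1.reg ρDist rfl]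
  have hnA2 : s2.reg ρnA = s.reg ρnB := by rw [← hs2]; simp [ha1.reg ρnB rfl]
  have hnB2 : s2.reg ρnB = 0 := by rw [← hs2]; simp
  have hM2 : s2.reg ρMark = s.reg ρMark := by rw [ha2.reg ρMark rfl, ha1.reg ρMark rfl]
  have hK2 : s2.reg ρKind = s.reg ρKind := by rw [ha2.reg ρKind rfl, ha1.reg ρKind rfl]
  have hans2 : s2.reg ρAns = s.reg ρAns := by rw [ha2.reg ρAns rfl, ha1.reg ρAns rfl]
  have hV2 : s2.arr αVis = s.arr αVis := by rw [ha2.arr αVis rfl, ha1.arr αVis rfl]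
  have hcur2 : cur s2 = nxt s := by
    ext y
    simp only [cur, nxt, stack, hnA2, ha2.arr αA rfl, Set.mem_ofPred_eq]
    exact exists_congr fun j => and_congr_right fun hj => by rw [h1 j hj]
  have hnxt2 : nxt s2 = ∅ := by simp [nxt, stack, hnB2]
  have hvis2 : visited s2 = visited s := by simp [visited, hM2, hV2]
  -- An entry moved from the next stack to the current one loses 20 units. Copying takes 5 of them,
  -- and since there is at least one entry the rest pays for the overhead of the level.
  have hpot : L.potential s2 + 20 * s.reg ρnB = L.potential s := by
    simp only [potential, unvisited, hnA2, hnB2, hnA, hM2, hV2]; omega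
  have hD : During L.Source L.Goal (L.Free (s.reg ρKind)) (L.Paid (s.reg ρKind)) (s.reg ρDist)
      (s2.reg ρAns) (visited s2) (cur s2) (nxt s2) := by
    rw [hans2, hcur2, hnxt2, hvis2]; exact hI.during
  have hMl2 : MarksLe s2 := fun x => by rw [hV2, hM2]; exact hM x
  refine Runs.mono (Runs.whileLt (fun s' => MarksLe s' ∧ During L.Source L.Goal
    (L.Free (s.reg ρKind)) (L.Paid (s.reg ρKind)) (s.reg ρDist) (s'.reg ρAns) (visited s') (cur s')
    (nxt s')) L.potential ⟨hMl2, hD⟩ ?_) ?_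
  · rintro s3 ⟨hMl3, h3⟩ hc ha3
    have hL3 := hL2.of_agree ha3 rfl rfl rfl
    have hK3 : s3.reg ρKind = s.reg ρKind := (ha3.reg ρKind rfl).trans hK2
    have := visit_spec wf hL3 ((ha3.reg ρDist rfl).trans hd2) (by rwa [hL3.zero] at hc) hMl3 (by rwa [hK3])
    rwa [hK3] at this
  · rintro t3 s3 ha3 ⟨⟨hMl3, h3⟩, hc, ht3⟩
    have hL3 := hL2.of_agree ha3 rfl rfl rfl
    have hnA3 : s3.reg ρnA = 0 := by rw [hL3.zero] at hc; omega
    have hcur3 : cur s3 = ∅ := by simp [cur, stack, hnA3]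
    rw [hcur3] at h3
    refine ⟨⟨hnA3, hMl3, ?_⟩, by omega⟩
    rw [ha3.reg ρDist rfl, hd2]
    exact h3.between

theorem bfs_spec {L : Tables} (wf : L.WF) {s : State} (hL : L.Layout s) (hnA : s.reg ρnA = 0)
    (hM : MarksLe s) (hv : visited s = ∅) (hs : nxt s = {y | L.Source y}) :
    Within bfs s (L.potential s + 10) fun s' => s'.reg ρnA = 0 ∧ MarksLe s' ∧
      ((s'.reg ρAns = 0 ∧
        ∀ d x, Cost L.Source (L.Free (s.reg ρKind)) (L.Paid (s.reg ρKind)) d x → ¬ L.Goal x) ∨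
      (0 < s'.reg ρAns ∧ IsLeast {d | ∃ x, L.Goal x ∧
        Cost L.Source (L.Free (s.reg ρKind)) (L.Paid (s.reg ρKind)) d x} (s'.reg ρAns))) := by
  refine Runs.seq (Runs.mono (Within.block rfl rfl) ?_)
  rintro t1 s1 ha1 ⟨ht1, hs1⟩
  have ht1' : t1 ≤ 2 := ht1
  have hL1 := hL.of_agree ha1 rfl rfl rfl
  have hd1 : s1.reg ρDist = 0 := by rw [← hs1]; simp
  have hans1 : s1.reg ρAns = 0 := by rw [← hs1]; simp
  have hM1 : s1.reg ρMark = s.reg ρMark := ha1.reg ρMark rfl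
  have hK1 : s1.reg ρKind = s.reg ρKind := ha1.reg ρKind rfl
  have hvis1 : visited s1 = ∅ := by rw [← hv]; simp [visited, hM1, ha1.arr αVis rfl]
  have hMl1 : MarksLe s1 := fun x => by rw [hM1, ha1.arr αVis rfl]; exact hM x
  have hnxt1 : nxt s1 = {y | L.Source y} := by
    rw [← hs]; simp [nxt, ha1.arr αB rfl, ha1.reg ρnB rfl]
  have hpot : L.potential s1 = L.potential s := by
    simp [potential, unvisited, hM1, ha1.arr αVis rfl, ha1.reg ρnB rfl, ha1.reg ρnA rfl]
  -- Entering at a source already costs 1, so at distance 0 there is nothing that should have been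
  -- visited.
  have hpos : ∀ {d x}, Cost L.Source (L.Free (s.reg ρKind)) (L.Paid (s.reg ρKind)) d x → 0 < d := by
    intro d x h
    induction h <;> omega
  have hB : Between L.Source L.Goal (L.Free (s.reg ρKind)) (L.Paid (s.reg ρKind)) (s1.reg ρDist)
      (s1.reg ρAns) (visited s1) (nxt s1) := by
    rw [hd1, hans1, hvis1, hnxt1]
    refine ⟨by simp, fun x hx => ⟨1, le_rfl, .source hx⟩, by simp, by simp, fun x hx => .inr hx,
      ?_, .inl ⟨rfl, by simp⟩⟩
    intro d x hd hx
    have := hpos hx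
    omega
  refine Runs.mono (Runs.whileLt (fun s' => s'.reg ρnA = 0 ∧ MarksLe s' ∧ Between L.Source L.Goal
    (L.Free (s.reg ρKind)) (L.Paid (s.reg ρKind)) (s'.reg ρDist) (s'.reg ρAns) (visited s') (nxt s'))
    L.potential ⟨by rw [ha1.reg ρnA rfl, hnA], hMl1, hB⟩ ?_) ?_
  · rintro s2 ⟨h2, hMl2, h3⟩ hc ha2
    have hL2 := hL1.of_agree ha2 rfl rfl rfl
    have hK2 : s2.reg ρKind = s.reg ρKind := (ha2.reg ρKind rfl).trans hK1
    have := level_spec wf hL2 (by rwa [hL2.zero] at hc) h2 hMl2 (by rwa [hK2])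
    rwa [hK2] at this
  · rintro t2 s2 ha2 ⟨⟨h2, hMl2, h3⟩, hc, ht2⟩
    have hL2 := hL1.of_agree ha2 rfl rfl rfl
    have hnB2 : s2.reg ρnB = 0 := by rw [hL2.zero] at hc; omega
    have hnxt2 : nxt s2 = ∅ := by simp [nxt, stack, hnB2]
    rw [hnxt2] at h3
    exact ⟨by omega, h2, hMl2, h3.final⟩

/-- The bounds on `αVis` before and after let searches be chained: if all old entries are below the
mark nothing is visited at the start, and afterwards no entry exceeds the mark. The time is the
initial potential, at most the full price for every node and 30 for every source, plus the time to
push the sources. -/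
theorem search_spec {L : Tables} (wf : L.WF) {s : State} (hL : L.Layout s) (kind mark out : ℕ)
    (hout : out ≠ ρnA)
    (hnA : s.reg ρnA = 0) (hv : ∀ x, s.arr αVis x < mark) :
    Within (search kind mark out) s (L.numNodes * ((L.S + L.D) * 60 + 60) + L.D * (L.S * 50 + 20) + 100)
      fun s' => s'.reg ρnA = 0 ∧ (∀ x, s'.arr αVis x ≤ mark) ∧
      ((s'.reg out = 0 ∧ ∀ d x, Cost L.Source (L.Free kind) (L.Paid kind) d x → ¬ L.Goal x) ∨
      (0 < s'.reg out ∧ IsLeast {d | ∃ x, L.Goal x ∧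
        Cost L.Source (L.Free kind) (L.Paid kind) d x} (s'.reg out))) := by
  refine Within.mono (Within.seq (B := 2) (B' := L.D * (L.S * 20 + 20) + 20 +
      (L.numNodes * ((L.S + L.D) * 60 + 60) + 30 * (L.D * L.S) + 10 + 1))
    (Within.mono (Within.block rfl rfl) le_rfl ?_)) ?_ (fun _ _ h => h)
  · rintro s1 ha1 hs1
    have hL1 := hL.of_agree ha1 rfl rfl rfl
    refine Within.seq (Within.mono (sources_spec wf hL1) le_rfl ?_)
    rintro s2 ha2 ⟨h1, h2⟩
    have hL2 := hL1.of_agree ha2 rfl rfl rfl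
    have hK2 : s2.reg ρKind = kind := by rw [ha2.reg ρKind rfl, ← hs1]; simp
    have hM2 : s2.reg ρMark = mark := by rw [ha2.reg ρMark rfl, ← hs1]; simp
    have hnA2 : s2.reg ρnA = 0 := by rw [ha2.reg ρnA rfl, ha1.reg ρnA rfl, hnA]
    have hV2 : s2.arr αVis = s.arr αVis := by rw [ha2.arr αVis rfl, ha1.arr αVis rfl]
    have hpot : L.potential s2 ≤ L.numNodes * ((L.S + L.D) * 60 + 60) + 30 * (L.D * L.S) := by
      have h3 : unvisited L.numNodes s2 ≤ L.numNodes :=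
        (Finset.card_filter_le _ _).trans_eq (Finset.card_range _)
      have h4 := Nat.mul_le_mul_right ((L.S + L.D) * 60 + 60) h3
      simp only [potential, hnA2, Nat.mul_comm ((L.S + L.D) * 60 + 60)]
      omega
    refine Within.seq (Within.mono (bfs_spec wf hL2 hnA2 ?_ ?_ h1)
      (Nat.add_le_add_right hpot 10) ?_)
    · intro x; rw [hV2, hM2]; exact (hv x).le
    · ext x; simp [visited, hM2, hV2, hv x]
    rintro s3 ha3 ⟨h3, hMl3, h4⟩
    rw [hK2] at h4
    have hV3 : ∀ x, s3.arr αVis x ≤ mark := fun x => by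
      rw [← hM2, ← ha3.reg ρMark rfl]; exact hMl3 x
    refine Within.mono (Within.block rfl ?_) le_rfl (fun _ _ h => h)
    simpa [hout.symm, h3, hV3] using h4
  · have : L.D * (L.S * 50 + 20) = L.D * (L.S * 20 + 20) + 30 * (L.D * L.S) := by ring
    omega

end LetterBoxed

/-! ## Computing the tables -/

namespace LetterBoxed

open RAM RAM.Prog Tables

/-- The odometer rule. It is applied once to the unit, for the remainder and the carry, and once to
the digit, which wraps around after the multiplicity. -/
theorem succ_div_mod {u : ℕ} (hu : 0 < u) (v : ℕ) :
    (v + 1) / u = (if v % u + 1 < u then v / u else v / u + 1) ∧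
    (v + 1) % u = if v % u + 1 < u then v % u + 1 else 0 := by
  have h := Nat.div_add_mod v u
  have hlt := Nat.mod_lt v hu
  generalize v / u = k at *
  generalize v % u = r at *
  subst h
  rw [Nat.add_assoc, Nat.mul_add_div hu, Nat.mul_add_mod]
  split_ifs with h1
  · rw [Nat.mod_eq_of_lt h1, Nat.div_eq_of_lt h1]; simp
  · obtain rfl : u = r + 1 := by omega
    simp

namespace Tables

/-- The node tables hold the right values for one node. -/
structure Entry (L : Tables) (s : State) (g a v : ℕ) : Prop where
  arrive : s.arr αArrive (L.idx g a v) =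
    if 0 < L.mult (L.pair g a) then L.idx g a (L.cap v (L.pair g a)) + 1 else 0
  pos : s.arr αPos (L.idx g a v) = g
  side : s.arr αSide (L.idx g a v) = a
  code : s.arr αCode (L.idx g a v) = v
  goal : s.arr αGoal (L.idx g a v) = if L.rem g < 2 ∧ v + 1 = L.V then 1 else 0

/-- The node tables are right for the nodes below `ρx`. -/
def Filled (L : Tables) (s : State) : Prop :=
  ∀ g a v, L.IsNode g a v → L.idx g a v < s.reg ρx → L.Entry s g a v

end Tables

theorem entry_spec {L : Tables} {s : State} (hL : L.Base s) {g a v : ℕ} (hn : L.IsNode g a v)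
    (hu : 0 < L.unit (L.pair g a)) (hx : s.reg ρx = L.idx g a v) (hg : s.reg ρg = g)
    (ha : s.reg ρa = a) (hv : s.reg ρv = v) (hm : s.reg ρm = L.mult (L.pair g a))
    (hun : s.reg ρu = L.unit (L.pair g a)) (hrem : s.reg ρRem = L.rem g)
    (hr : s.reg ρr = v % L.unit (L.pair g a))
    (hd : s.reg ρd = v / L.unit (L.pair g a) % (L.mult (L.pair g a) + 1)) (hF : L.Filled s) :
    Within (entryArrive ;; entryNode ;; entryNext) s 30 fun s' =>
      s'.reg ρx = L.idx g a (v + 1) ∧ s'.reg ρr = (v + 1) % L.unit (L.pair g a) ∧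
      s'.reg ρd = (v + 1) / L.unit (L.pair g a) % (L.mult (L.pair g a) + 1) ∧ L.Filled s' := by
  refine Within.mono (B := 7 + (9 + 10)) (Within.seq (Within.mono (B' := 7) (Within.block rfl rfl) (by decide) ?_)) (by omega)
    (fun _ _ h => h)
  rintro s1 ha1 hs1
  have e1 : s1.arr αArrive = Function.update (s.arr αArrive) (L.idx g a v)
      (if 0 < L.mult (L.pair g a) then L.idx g a (L.cap v (L.pair g a)) + 1 else 0) := by
    rw [← hs1]
    simp only [cap]
    by_cases h1 : 0 < L.mult (L.pair g a)
    · by_cases h2 : v / L.unit (L.pair g a) % (L.mult (L.pair g a) + 1) < L.mult (L.pair g a)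
      · simp [entryArrive, hm, hd, hx, hun, hL.zero, h1, h2]
        congr 1; unfold idx; omega
      · simp [entryArrive, hm, hd, hx, hL.zero, h1, h2]
    · simp [entryArrive, hm, hx, hL.zero, h1]
  refine Within.seq (Within.mono (B' := 9) (Within.block rfl rfl) (by decide) ?_)
  rintro s2 ha2 hs2
  have hL1 := hL.of_agree ha1 rfl rfl
  have e2 : s2.arr αPos = Function.update (s.arr αPos) (L.idx g a v) g := by
    rw [← ha1.arr αPos rfl, ← hx, ← ha1.reg ρx rfl, ← hg, ← ha1.reg ρg rfl, ← hs2]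
    simp [entryNode]; split_ifs <;> simp
  have e3 : s2.arr αSide = Function.update (s.arr αSide) (L.idx g a v) a := by
    rw [← ha1.arr αSide rfl, ← hx, ← ha1.reg ρx rfl, ← ha, ← ha1.reg ρa rfl, ← hs2]
    simp [entryNode]; split_ifs <;> simp
  have e4 : s2.arr αCode = Function.update (s.arr αCode) (L.idx g a v) v := by
    rw [← ha1.arr αCode rfl, ← hx, ← ha1.reg ρx rfl, ← hv, ← ha1.reg ρv rfl, ← hs2]
    simp [entryNode]; split_ifs <;> simp
  have e5 : s2.arr αGoal = Function.update (s.arr αGoal) (L.idx g a v)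
      (if L.rem g < 2 ∧ v + 1 = L.V then 1 else 0) := by
    have h1 := (ha1.reg ρx rfl).trans hx
    have h2 := (ha1.reg ρv rfl).trans hv
    have h3 := (ha1.reg ρRem rfl).trans hrem
    rw [← ha1.arr αGoal rfl, ← hs2]
    have hlt := hn.2.2
    by_cases h4 : L.rem g < 2
    · by_cases h5 : v + 1 < L.V
      · simp [entryNode, h1, h2, h3, hL1.one, hL1.two, hL1.V, h4, h5, h5.ne]
      · have : v + 1 = L.V := by omega
        simp [entryNode, h1, h2, h3, hL1.one, hL1.two, hL1.V, h4, this]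
    · simp [entryNode, h1, h2, h3, hL1.two, h4]
  refine Within.mono (Within.block rfl rfl) (by decide) ?_
  rintro s3 ha3 hs3
  have h2 : ∀ r, entryArrive.writesReg r = false → entryNode.writesReg r = false →
      s2.reg r = s.reg r := fun r h h' => (ha2.reg r h').trans (ha1.reg r h)
  have e6 : s3.reg ρx = L.idx g a (v + 1) := by
    have : s3.reg ρx = s2.reg ρx + 1 := by
      rw [← hs3]; simp [entryNext]; split_ifs <;> simp
    rw [this, h2 ρx rfl rfl, hx]
    unfold idx; ring
  obtain ⟨hdiv, hmod⟩ := succ_div_mod hu v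
  obtain ⟨-, hmod'⟩ := succ_div_mod (Nat.succ_pos (L.mult (L.pair g a))) (v / L.unit (L.pair g a))
  refine ⟨e6, ?_, ?_, ?_⟩
  · rw [← hs3, hmod]
    by_cases hc : v % L.unit (L.pair g a) + 1 < L.unit (L.pair g a)
    · simp [entryNext, h2 ρr rfl rfl, h2 ρu rfl rfl, hr, hun, hc]
    · simp [entryNext, h2 ρr rfl rfl, h2 ρu rfl rfl, hr, hun, hc]
      split_ifs <;> simp
  · rw [← hs3, hdiv]
    by_cases hc : v % L.unit (L.pair g a) + 1 < L.unit (L.pair g a)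
    · simp [entryNext, h2 ρr rfl rfl, h2 ρu rfl rfl, h2 ρd rfl rfl, hr, hun, hd, hc]
    · simp only [if_neg hc, hmod', Nat.succ_eq_add_one, Nat.add_lt_add_iff_right]
      by_cases hc' : v / L.unit (L.pair g a) % (L.mult (L.pair g a) + 1) < L.mult (L.pair g a)
      · simp [entryNext, h2 ρr rfl rfl, h2 ρu rfl rfl, h2 ρd rfl rfl, h2 ρm rfl rfl, hr, hun, hd, hm,
          hc, hc']
      · simp [entryNext, h2 ρr rfl rfl, h2 ρu rfl rfl, h2 ρd rfl rfl, h2 ρm rfl rfl, hr, hun, hd, hm,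
          hc, hc']
  · intro g' a' v' hn' hlt
    rw [e6] at hlt
    by_cases he : L.idx g' a' v' = L.idx g a v
    · obtain ⟨rfl, rfl, rfl⟩ := idx_inj hn' hn he
      constructor
      · rw [ha3.arr αArrive rfl, ha2.arr αArrive rfl, e1, Function.update_self]
      · rw [ha3.arr αPos rfl, e2, Function.update_self]
      · rw [ha3.arr αSide rfl, e3, Function.update_self]
      · rw [ha3.arr αCode rfl, e4, Function.update_self]
      · rw [ha3.arr αGoal rfl, e5, Function.update_self]
    · have h1 : L.idx g a (v + 1) = L.idx g a v + 1 := by unfold idx; ring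
      have hE := hF g' a' v' hn' (by omega)
      constructor
      · rw [ha3.arr αArrive rfl, ha2.arr αArrive rfl, e1, Function.update_of_ne he, hE.arrive]
      · rw [ha3.arr αPos rfl, e2, Function.update_of_ne he, hE.pos]
      · rw [ha3.arr αSide rfl, e3, Function.update_of_ne he, hE.side]
      · rw [ha3.arr αCode rfl, e4, Function.update_of_ne he, hE.code]
      · rw [ha3.arr αGoal rfl, e5, Function.update_of_ne he, hE.goal]

/-- The five node tables are the consecutively numbered arrays from `αArrive` to `αGoal`. -/
theorem Tables.Filled.of_arr {L : Tables} {s s' : State} (h : L.Filled s) (hx : s'.reg ρx = s.reg ρx)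
    (hA : ∀ b, αArrive ≤ b → b ≤ αGoal → s'.arr b = s.arr b) : L.Filled s' := by
  intro g a v hn hlt
  obtain ⟨h1, h2, h3, h4, h5⟩ := h g a v hn (hx ▸ hlt)
  constructor <;> rw [hA _ (by omega) (by omega)] <;> assumption

theorem fill_spec {L : Tables} {s : State} (hL : L.Base s)
    (hm : ∀ g < L.M, ∀ a < L.S, s.arr αMult (L.pair g a) = L.mult (L.pair g a))
    (hu : ∀ g < L.M, ∀ a < L.S, s.arr αUnit (L.pair g a) = L.unit (L.pair g a))
    (hpos : ∀ g < L.M, ∀ a < L.S, 0 < L.unit (L.pair g a)) :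
    Within fill s (L.M * (L.S * (L.V * 33 + 11) + 9) + 3) L.Layout := by
  refine Within.mono (B := 1 + (L.M * (((4 + (L.S * ((5 + (L.V * (30 + 3) + 2 + 1)) + 3) + 2))) + 3) + 2))
    (Within.seq (Within.mono (B' := 1) (Within.block rfl rfl) (by decide) ?_)) (le_of_eq (by ring))
    (fun _ _ h => h)
  rintro s1 ha1 hs1
  have hL1 := hL.of_agree ha1 rfl rfl
  refine Within.mono (Within.forLt (N := L.M) (fun g s' => s'.reg ρx = L.idx g 0 0 ∧
    (∀ g' < g, s'.arr αBase g' = L.idx g' 0 0) ∧ L.Filled s') rfl hL1.M ?_ ?_) le_rfl ?_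
  · rw [← hs1]
    refine ⟨by simp [idx], by simp, ?_⟩
    intro g a v _ h
    simp at h
  · rintro g s2 hg ⟨h1, h2, h3⟩ hrg ha2
    have hL2 := hL1.of_agree ha2 rfl rfl
    refine Within.seq (Within.mono (B' := 4) (Within.block rfl rfl) (by decide) ?_)
    rintro s3 ha3 hs3
    have hL3 := hL2.of_agree ha3 rfl rfl
    have hl3 : s3.reg ρl = L.letter g := by rw [← hs3]; simp [hrg, hL2.letter g hg]
    have hrem3 : s3.reg ρRem = L.rem g := by rw [← hs3]; simp [hrg, hL2.rem g hg]
    have hg3 : s3.reg ρg = g := (ha3.reg ρg rfl).trans hrg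
    have hbase3 : ∀ g' < g + 1, s3.arr αBase g' = L.idx g' 0 0 := by
      intro g' hg'
      rw [← hs3]
      by_cases he : g' = g
      · simp [he, hrg, h1]
      · simp [hrg, he, h2 g' (by omega)]
    have hF3 : L.Filled s3 := h3.of_arr (ha3.reg ρx rfl) fun b hb hb' => by
      rw [← hs3]
      simp [show b ≠ αBase by omega]
    refine Within.mono (Within.forLt (N := L.S) (fun a s' => s'.reg ρi = a * L.q ∧
      s'.reg ρx = L.idx g a 0 ∧ L.Filled s') rfl hL3.S ?_ ?_) le_rfl ?_
    · refine ⟨by rw [← hs3]; simp, by simp [ha3.reg ρx rfl, h1], hF3.of_arr (by simp) (by simp)⟩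
    · rintro a s4 ha ⟨h4, h5, h6⟩ hra ha4
      have hL4 := hL3.of_agree ha4 rfl rfl
      refine Within.seq (Within.mono (B' := 5) (Within.block rfl rfl) (by decide) ?_)
      rintro s5 ha5 hs5
      have hL5 := hL4.of_agree ha5 rfl rfl
      have hmult : s4.arr αMult = s.arr αMult := by
        rw [ha4.arr αMult rfl, ha3.arr αMult rfl, ha2.arr αMult rfl, ha1.arr αMult rfl]
      have hunit : s4.arr αUnit = s.arr αUnit := by
        rw [ha4.arr αUnit rfl, ha3.arr αUnit rfl, ha2.arr αUnit rfl, ha1.arr αUnit rfl]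
      have hl4 : s4.reg ρl = L.letter g := (ha4.reg ρl rfl).trans hl3
      have hm5 : s5.reg ρm = L.mult (L.pair g a) := by
        rw [← hs5, ← hm g hg a ha]; simp [h4, hl4, hmult, pair]
      have hu5 : s5.reg ρu = L.unit (L.pair g a) := by
        rw [← hs5, ← hu g hg a ha]; simp [h4, hl4, hunit, pair]
      refine Within.seq (Within.mono (Within.forLt (N := L.V) (B := 30) (fun v s' =>
        s'.reg ρx = L.idx g a v ∧ s'.reg ρr = v % L.unit (L.pair g a) ∧
        s'.reg ρd = v / L.unit (L.pair g a) % (L.mult (L.pair g a) + 1) ∧ L.Filled s')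
        rfl hL5.V ?_ ?_) le_rfl ?_)
      · refine ⟨by simp [ha5.reg ρx rfl, h5], by rw [← hs5]; simp, by rw [← hs5]; simp, ?_⟩
        exact h6.of_arr (by simp [ha5.reg ρx rfl]) (by rw [← hs5]; simp)
      · rintro v s6 hv ⟨h7, h8, h9, h10⟩ hrv ha6
        refine Within.mono (entry_spec (hL5.of_agree ha6 rfl rfl) ⟨hg, ha, hv⟩ (hpos g hg a ha) h7
          ?_ ?_ hrv ?_ ?_ ?_ h8 h9 h10) le_rfl ?_
        · rw [ha6.reg ρg rfl, ha5.reg ρg rfl, ha4.reg ρg rfl, hg3]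
        · rw [ha6.reg ρa rfl, ha5.reg ρa rfl, hra]
        · rw [ha6.reg ρm rfl, hm5]
        · rw [ha6.reg ρu rfl, hu5]
        · rw [ha6.reg ρRem rfl, ha5.reg ρRem rfl, ha4.reg ρRem rfl, hrem3]
        · rintro s7 - ⟨h11, h12, h13, h14⟩
          exact ⟨by simp [h11], by simp [h12], by simp [h13], h14.of_arr (by simp) (by simp)⟩
      · rintro s6 ha6 ⟨h7, -, -, h8⟩
        refine Within.mono (Within.block rfl ?_) le_rfl (fun _ _ h => h)
        refine ⟨?_, ?_, h8.of_arr (by simp) (by simp)⟩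
        · simp [ha6.reg ρi rfl, ha5.reg ρi rfl, h4, ha6.reg ρq rfl, hL5.q]
          ring
        · simp [h7]; unfold idx; ring
    · rintro s4 ha4 ⟨-, h4, h5⟩
      refine ⟨?_, ?_, h5.of_arr (by simp) (by simp)⟩
      · simp [h4]; unfold idx; ring
      · simpa [ha4.arr αBase rfl] using hbase3
  · rintro s2 ha2 ⟨h1, h2, h3⟩
    -- At the end the counter stands at the number of nodes, above every address, so all entries are
    -- filled.
    have hE : ∀ g a v, L.IsNode g a v → L.Entry s2 g a v := fun g a v hn =>
      h3 g a v hn (by rw [h1]; exact (idx_lt hn).trans_eq (by unfold idx; ring))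
    exact ⟨hL1.of_agree ha2 rfl rfl, h2, fun g a v hn => (hE g a v hn).arrive,
      fun g a v hn => (hE g a v hn).pos, fun g a v hn => (hE g a v hn).side,
      fun g a v hn => (hE g a v hn).code, fun g a v hn => (hE g a v hn).goal⟩

end LetterBoxed

/-! ## Reading the input -/

namespace LetterBoxed

open RAM RAM.Prog Tables

/-- The input as numbers: `side a j` is the `j`-th letter of side `a`, and `word i j` is the `j`-th
letter of the `i`-th word, which has `len i` letters. -/
structure Input where
  S : ℕ
  q : ℕ
  n : ℕ
  D : ℕ
  side : ℕ → ℕ → ℕ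
  len : ℕ → ℕ
  word : ℕ → ℕ → ℕ

namespace Input

variable (I : Input)

/-- The start of a word in the concatenation of the dictionary. -/
def start (i : ℕ) : ℕ := ∑ i' ∈ Finset.range i, I.len i'

theorem start_succ (i : ℕ) : I.start (i + 1) = I.start i + I.len i := Finset.sum_range_succ _ _

theorem start_mono : Monotone I.start := fun _ _ h =>
  Finset.sum_le_sum_of_subset (Finset.range_mono h)

theorem start_add_lt {i i' j : ℕ} (hi : i' < i) (hj : j < I.len i') : I.start i' + j < I.start i :=
  calc I.start i' + j < I.start (i' + 1) := by rw [start_succ]; omega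
    _ ≤ I.start i := I.start_mono hi

/-- The multiplicity of a letter on a side. -/
def count (a c : ℕ) : ℕ := Nat.count (fun j => I.side a j = c) I.n

/-- The letter occurs in the dictionary. -/
def Occurs (c : ℕ) : Prop := ∃ i < I.D, ∃ j < I.len i, I.word i j = c

/-- The array contains the input. -/
structure Holds (f : ℕ → ℕ) : Prop where
  S : f 0 = I.S
  q : f 1 = I.q
  n : f 2 = I.n
  D : f 3 = I.D
  side : ∀ a < I.S, ∀ j < I.n, f (4 + a * I.n + j) = I.side a j
  len : ∀ i < I.D, f (4 + I.S * I.n + I.start i + i) = I.len i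
  word : ∀ i < I.D, ∀ j < I.len i, f (4 + I.S * I.n + I.start i + i + 1 + j) = I.word i j

/-- The registers contain the header of the input. -/
structure Header (s : State) : Prop where
  zero : s.reg ρZero = 0
  one : s.reg ρOne = 1
  two : s.reg ρTwo = 2
  S : s.reg ρS = I.S
  q : s.reg ρq = I.q
  n : s.reg ρn = I.n
  D : s.reg ρD = I.D

variable {I}

theorem Header.of_agree {p : Prog} {s s' : State} (h : I.Header s) (ha : Agree p s s')
    (hr : ([ρZero, ρOne, ρTwo, ρS, ρq, ρn, ρD].all fun r => !p.writesReg r) = true) :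
    I.Header s' := by
  simp only [List.all_cons, List.all_nil, Bool.and_true, Bool.and_eq_true, Bool.not_eq_true'] at hr
  obtain ⟨r1, r2, r3, r4, r5, r6, r7⟩ := hr
  constructor
  · rw [ha.reg _ r1, h.zero]
  · rw [ha.reg _ r2, h.one]
  · rw [ha.reg _ r3, h.two]
  · rw [ha.reg _ r4, h.S]
  · rw [ha.reg _ r5, h.q]
  · rw [ha.reg _ r6, h.n]
  · rw [ha.reg _ r7, h.D]

theorem header_spec {s : State} (h : I.Holds (s.arr αIn)) :
    Within header s 9 fun s' => I.Header s' ∧ s'.reg ρp = 4 := by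
  refine Within.mono (Within.block rfl ?_) (by decide) (fun _ _ h => h)
  refine ⟨⟨?_, ?_, ?_, ?_, ?_, ?_, ?_⟩, ?_⟩ <;> simp [header, h.S, h.q, h.n, h.D]

theorem readSides_spec {s : State} (h : I.Holds (s.arr αIn)) (hH : I.Header s)
    (hp : s.reg ρp = 4) (h0 : s.arr αMult = 0)
    (hlt : ∀ a < I.S, ∀ j < I.n, I.side a j < I.q) :
    Within readSides s (I.S * (I.n * 11 + 6) + 3) fun s' => s'.reg ρp = 4 + I.S * I.n ∧
      ∀ a < I.S, ∀ c < I.q, s'.arr αMult (a * I.q + c) = I.count a c := by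
  refine Within.mono (B := 1 + (I.S * ((I.n * (8 + 3) + 2 + 1) + 3) + 2))
    (Within.seq (Within.mono (B' := 1) (Within.block rfl rfl) (by decide) ?_)) (le_of_eq (by ring))
    (fun _ _ h => h)
  rintro s1 ha1 hs1
  have hH1 := hH.of_agree ha1 rfl
  refine Within.mono (Within.forLt (N := I.S) (fun a s' => s'.reg ρi = a * I.q ∧
    s'.reg ρp = 4 + a * I.n ∧ ∀ a' c, c < I.q → s'.arr αMult (a' * I.q + c) =
      if a' < a then I.count a' c else 0) rfl hH1.S ?_ ?_) le_rfl ?_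
  · refine ⟨by simp [← hs1], by simp [← hs1, hp], by simp [← hs1, h0]⟩
  · rintro a s2 ha ⟨h1, h2, h3⟩ hra ha2
    have hH2 := hH1.of_agree ha2 rfl
    refine Within.seq (B' := 1) (Within.mono (Within.forLt (N := I.n) (B := 8) (fun j s' =>
      s'.reg ρp = 4 + a * I.n + j ∧ ∀ a' c, c < I.q → s'.arr αMult (a' * I.q + c) =
      if a' < a then I.count a' c else if a' = a then Nat.count (fun j => I.side a j = c) j else 0)
      rfl hH2.n ?_ ?_) le_rfl ?_)
    · refine ⟨by simp [h2], ?_⟩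
      intro a' c hc
      simp [h3 a' c hc]
    · rintro j s3 hj ⟨h4, h5⟩ hrj ha3
      refine Within.mono (Within.block rfl ?_) (by decide) (fun _ _ h => h)
      have hin : s3.arr αIn (4 + a * I.n + j) = I.side a j := by
        rw [← h.side a ha j hj, ha3.arr αIn rfl, ha2.arr αIn rfl, ha1.arr αIn rfl]
      have hi : s3.reg ρi = a * I.q := by rw [ha3.reg ρi rfl, h1]
      refine ⟨by simp [h4]; ring, ?_⟩
      intro a' c hc
      have hs := hlt a ha j hj
      simp only [den, State.reg_setReg, State.arr_setReg, State.reg_setArr, State.arr_setArr]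
      simp [h4, hin, hi]
      -- As letters are below `q`, different pairs of side and letter have different cells, so
      -- exactly one count changes.
      by_cases he : a' * I.q + c = a * I.q + I.side a j
      · obtain ⟨rfl, rfl⟩ := mul_add_inj hc hs he
        simp [h5 _ _ hc, Nat.count_succ]
      · rw [Function.update_of_ne he, h5 _ _ hc]
        by_cases hae : a' = a
        · subst hae
          have : ¬ I.side a' j = c := fun h => he (by rw [h])
          simp [Nat.count_succ, this]
        · simp [hae]
    · rintro s3 ha3 ⟨h4, h5⟩
      refine Within.mono (Within.block rfl ?_) le_rfl (fun _ _ h => h)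
      refine ⟨?_, ?_, ?_⟩
      · simp [ha3.reg ρi rfl, h1, ha3.reg ρq rfl, hH2.q]; ring
      · simp [h4]; ring
      · intro a' c hc
        simp [h5 a' c hc]
        rcases Nat.lt_trichotomy a' a with hl | rfl | hl
        · simp [hl, hl.le]
        · simp [count]
        · simp [hl.not_gt, hl.ne', hl.not_ge]
  · rintro s2 - ⟨-, h2, h3⟩
    exact ⟨h2, fun a ha c hc => by simp [h3 a c hc, ha]⟩

end Input

end LetterBoxed

namespace LetterBoxed

open RAM RAM.Prog Tables

namespace Input

variable {I : Input}

/-- Position `j'` of word `i'` comes before position `j` of word `i`. -/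
def Before (I : Input) (i j i' j' : ℕ) : Prop := i' < i ∧ j' < I.len i' ∨ i' = i ∧ j' < j

/-- The dictionary has been read up to position `j` of word `i`. -/
structure ReadUpTo (I : Input) (s : State) (i j : ℕ) : Prop where
  M : s.reg ρM = I.start i + j
  letter : ∀ i' j', I.Before i j i' j' → s.arr αLetter (I.start i' + j') = I.word i' j'
  rem : ∀ i' j', I.Before i j i' j' → s.arr αRem (I.start i' + j') = I.len i' - j'
  occ : ∀ c, 0 < s.arr αOcc c ↔ ∃ i' j', I.Before i j i' j' ∧ I.word i' j' = c

theorem ReadUpTo.congr {s s' : State} {i j i' j' : ℕ} (h : I.ReadUpTo s i j)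
    (hM : s'.reg ρM = s.reg ρM) (hA : ∀ b ∈ [αLetter, αRem, αOcc], s'.arr b = s.arr b)
    (hij : I.start i + j = I.start i' + j')
    (hB : ∀ i₁ j₁, I.Before i j i₁ j₁ ↔ I.Before i' j' i₁ j₁) : I.ReadUpTo s' i' j' := by
  constructor
  · rw [hM, h.M, hij]
  · rw [hA _ (by simp)]
    exact fun i₁ j₁ hb => h.letter i₁ j₁ ((hB _ _).2 hb)
  · rw [hA _ (by simp)]
    exact fun i₁ j₁ hb => h.rem i₁ j₁ ((hB _ _).2 hb)
  · rw [hA _ (by simp)]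
    simpa only [hB] using h.occ

theorem readWords_spec {s : State} (h : I.Holds (s.arr αIn)) (hH : I.Header s)
    (hp : s.reg ρp = 4 + I.S * I.n) (h0 : s.arr αOcc = 0) {Λ : ℕ} (hΛ : ∀ i < I.D, I.len i ≤ Λ) :
    Within readWords s (I.D * (Λ * 12 + 9) + 4) fun s' => I.ReadUpTo s' I.D 0 ∧
      (∀ i < I.D, s'.arr αStart i = I.start i) ∧
      s'.reg ρK = s.arr αIn (4 + I.S * I.n + I.start I.D + I.D) := by
  refine Within.mono (B := 1 + ((I.D * ((4 + (Λ * (9 + 3) + 2)) + 3) + 2) + 1))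
    (Within.seq (Within.mono (B' := 1) (Within.block rfl rfl) (by decide) ?_)) (le_of_eq (by ring))
    (fun _ _ h => h)
  rintro s1 ha1 hs1
  have hH1 := hH.of_agree ha1 rfl
  refine Within.seq (B' := 1) (Within.mono (Within.forLt (N := I.D) (fun i s' =>
    s'.reg ρp = 4 + I.S * I.n + I.start i + i ∧ I.ReadUpTo s' i 0 ∧
    ∀ i' < i, s'.arr αStart i' = I.start i') rfl hH1.D ?_ ?_) le_rfl ?_)
  · refine ⟨by simp [← hs1, hp, start], ⟨?_, ?_, ?_, ?_⟩, by simp⟩ <;>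
      simp [← hs1, start, Before, h0]
  · rintro i s2 hi ⟨h1, h2, h3⟩ hri ha2
    have hH2 := hH1.of_agree ha2 rfl
    have hin2 : s2.arr αIn = s.arr αIn := by rw [ha2.arr αIn rfl, ha1.arr αIn rfl]
    refine Within.seq (Within.mono (B' := 4) (Within.block rfl rfl) (by decide) ?_)
    rintro s3 ha3 hs3
    have hH3 := hH2.of_agree ha3 rfl
    have hl3 : s3.reg ρl = I.len i := by rw [← hs3]; simp [hin2, h1, h.len i hi]
    have hp3 : s3.reg ρp = 4 + I.S * I.n + I.start i + i + 1 := by rw [← hs3]; simp [h1]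
    have hst3 : ∀ i' < i + 1, s3.arr αStart i' = I.start i' := by
      intro i' hi'
      rw [← hs3]
      by_cases he : i' = i
      · simp [he, hri, h2.M]
      · simp [hri, he, h3 i' (by omega)]
    have h3R : I.ReadUpTo s3 i 0 := h2.congr (ha3.reg ρM rfl) (by rw [← hs3]; simp) rfl fun _ _ => .rfl
    refine Within.mono (Within.forLt (N := I.len i) (B := 9) (fun j s' =>
      s'.reg ρp = 4 + I.S * I.n + I.start i + i + 1 + j ∧ I.ReadUpTo s' i j) rfl hl3 ?_ ?_) ?_ ?_
    · exact ⟨by simp [hp3], h3R.congr (by simp) (by simp) rfl fun _ _ => .rfl⟩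
    · rintro j s4 hj ⟨h4, h5⟩ hrj ha4
      have hH4 := hH3.of_agree ha4 rfl
      have hin : s4.arr αIn (4 + I.S * I.n + I.start i + i + 1 + j) = I.word i j := by
        rw [← h.word i hi j hj, ha4.arr αIn rfl, ha3.arr αIn rfl, hin2]
      have hl4 : s4.reg ρl = I.len i := (ha4.reg ρl rfl).trans hl3
      have hB : ∀ i' j', I.Before i (j + 1) i' j' ↔ I.Before i j i' j' ∨ i' = i ∧ j' = j := by
        intro i' j'
        unfold Before
        omega
      -- The cell being written was not used before, so what has been read stays intact.
      have hne : ∀ i' j', I.Before i j i' j' → I.start i' + j' ≠ I.start i + j := by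
        rintro i' j' (⟨h1, h2⟩ | ⟨rfl, h2⟩)
        · have := I.start_add_lt h1 h2
          omega
        · omega
      refine Within.mono (Within.block rfl ?_) (by decide) (fun _ _ h => h)
      refine ⟨by simp [h4]; ring, ?_, ?_, ?_, ?_⟩
      · simp [h5.M]; ring
      · simp [h4, hin, h5.M]
        intro i' j' hb
        rcases (hB i' j').1 hb with hb | ⟨rfl, rfl⟩
        · rw [Function.update_of_ne (hne _ _ hb), h5.letter _ _ hb]
        · simp
      · simp [hl4, hrj, h5.M]
        intro i' j' hb
        rcases (hB i' j').1 hb with hb | ⟨rfl, rfl⟩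
        · rw [Function.update_of_ne (hne _ _ hb), h5.rem _ _ hb]
        · simp
      · simp [h4, hin, hH4.one, hB]
        intro c
        by_cases hc : c = I.word i j
        · subst hc
          simp only [Function.update_self, zero_lt_one, true_iff]
          exact ⟨i, j, .inr ⟨rfl, rfl⟩, rfl⟩
        · rw [Function.update_of_ne hc, h5.occ]
          constructor
          · rintro ⟨i', j', hb, e⟩; exact ⟨i', j', .inl hb, e⟩
          · rintro ⟨i', j', hb | ⟨rfl, rfl⟩, e⟩
            · exact ⟨i', j', hb, e⟩
            · exact absurd e.symm hc
    · have := Nat.mul_le_mul_right (9 + 3) (hΛ i hi)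
      omega
    · rintro s4 ha4 ⟨h4, h5⟩
      refine ⟨?_, h5.congr (by simp) (by simp) (by rw [start_succ]; omega) ?_, ?_⟩
      · simp [h4, start_succ]; omega
      -- Having read all of word `i` is the same as having read nothing of word `i + 1`.
      · intro i' j'
        unfold Before
        constructor
        · rintro (⟨h1, h2⟩ | ⟨rfl, h2⟩)
          · exact .inl ⟨by omega, h2⟩
          · exact .inl ⟨by omega, h2⟩
        · rintro (⟨k1, k2⟩ | ⟨rfl, k2⟩)
          · rcases Nat.lt_succ_iff_lt_or_eq.1 k1 with k1 | rfl
            · exact .inl ⟨k1, k2⟩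
            · exact .inr ⟨rfl, k2⟩
          · omega
      · simpa [ha4.arr αStart rfl] using hst3
  · rintro s2 ha2 ⟨h1, h2, h3⟩
    refine Within.mono (Within.block rfl ?_) le_rfl (fun _ _ h => h)
    refine ⟨h2.congr (by simp) (by simp) rfl fun _ _ => .rfl, by simpa using h3, ?_⟩
    simp [h1, ha2.arr αIn rfl, ha1.arr αIn rfl]

/-- The mixed radix unit of a letter-side pair, where the digits are the multiplicities. -/
def unitOf (m : ℕ → ℕ) (i : ℕ) : ℕ := ∏ i' ∈ Finset.range i, (m i' + 1)

theorem unitOf_succ (m : ℕ → ℕ) (i : ℕ) : unitOf m (i + 1) = unitOf m i * (m i + 1) :=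
  Finset.prod_range_succ _ _

/-- `V` is a product, possibly exponentially large, but it is formed by at most `n` additions per
pair of side and letter. Hence the time is polynomial whatever the value of `V`. -/
theorem mkUnits_spec {s : State} (hH : I.Header s)
    (hm : ∀ i < I.S * I.q, s.arr αMult i ≤ I.n) :
    Within mkUnits s (I.S * (I.q * (I.n * 4 + 20) + 20) + 20) fun s' =>
      s'.reg ρV = unitOf (s.arr αMult) (I.S * I.q) ∧
      (∀ i < I.S * I.q, s'.arr αUnit i = unitOf (s.arr αMult) i) ∧
      (s'.reg ρbad = 0 ↔ ∀ a < I.S, ∀ c < I.q, 0 < s.arr αMult (a * I.q + c) → 0 < s.arr αOcc c) := by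
  refine Within.mono (B := 3 + (I.S * ((I.q * ((9 + (I.n * (1 + 3) + 2 + 3)) + 3) + 2) + 3) + 2))
    (Within.seq (Within.mono (B' := 3) (Within.block rfl rfl) (by decide) ?_)) ?_ (fun _ _ h => h)
  swap
  · have h1 := Nat.mul_le_mul_left I.q (show (9 + (I.n * (1 + 3) + 2 + 3)) + 3 ≤ I.n * 4 + 20 by omega)
    have h2 := Nat.mul_le_mul_left I.S
      (show I.q * ((9 + (I.n * (1 + 3) + 2 + 3)) + 3) + 2 + 3 ≤ I.q * (I.n * 4 + 20) + 20 by omega)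
    omega
  rintro s1 ha1 hs1
  have hH1 := hH.of_agree ha1 rfl
  set m := s.arr αMult with hmdef
  set occ := s.arr αOcc with hocc
  refine Within.mono (Within.forLt (N := I.S) (fun a s' => s'.reg ρi = a * I.q ∧
    s'.reg ρV = unitOf m (a * I.q) ∧ (∀ i < a * I.q, s'.arr αUnit i = unitOf m i) ∧
    (s'.reg ρbad = 0 ↔ ∀ a' < a, ∀ c < I.q, 0 < m (a' * I.q + c) → 0 < occ c))
    rfl hH1.S ?_ ?_) le_rfl ?_
  · refine ⟨?_, ?_, ?_, ?_⟩ <;> simp [← hs1, unitOf]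
  · rintro a s2 ha ⟨h1, h2, h3, h4⟩ hra ha2
    have hH2 := hH1.of_agree ha2 rfl
    refine Within.mono (Within.forLt (N := I.q) (fun c s' => s'.reg ρi = a * I.q + c ∧
      s'.reg ρV = unitOf m (a * I.q + c) ∧ (∀ i < a * I.q + c, s'.arr αUnit i = unitOf m i) ∧
      (s'.reg ρbad = 0 ↔ (∀ a' < a, ∀ c < I.q, 0 < m (a' * I.q + c) → 0 < occ c) ∧
        ∀ c' < c, 0 < m (a * I.q + c') → 0 < occ c')) rfl hH2.q ?_ ?_) le_rfl ?_
    · refine ⟨?_, ?_, ?_, ?_⟩ <;> simp [h1, h2, h4]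
      exact h3
    · rintro c s3 hc ⟨h5, h6, h7, h8⟩ hrc ha3
      have hH3 := hH2.of_agree ha3 rfl
      have hm3 : s3.arr αMult = m := by rw [ha3.arr αMult rfl, ha2.arr αMult rfl, ha1.arr αMult rfl]
      have hocc3 : s3.arr αOcc = occ := by rw [ha3.arr αOcc rfl, ha2.arr αOcc rfl, ha1.arr αOcc rfl]
      have hin : a * I.q + c < I.S * I.q := calc
        a * I.q + c < (a + 1) * I.q := by rw [Nat.add_mul]; omega
        _ ≤ _ := Nat.mul_le_mul_right _ ha
      refine Within.seq (Within.mono (B' := 9) (Within.block rfl rfl) (by decide) ?_)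
      rintro s4 ha4 hs4
      have hbad4 : s4.reg ρbad = 0 ↔ (∀ a' < a, ∀ c < I.q, 0 < m (a' * I.q + c) → 0 < occ c) ∧
          ∀ c' < c + 1, 0 < m (a * I.q + c') → 0 < occ c' := by
        have : (∀ c' < c + 1, 0 < m (a * I.q + c') → 0 < occ c') ↔
            (∀ c' < c, 0 < m (a * I.q + c') → 0 < occ c') ∧ (0 < m (a * I.q + c) → 0 < occ c) := by
          simp only [Nat.lt_succ_iff_lt_or_eq, or_imp, forall_and, forall_eq]
        rw [this, ← and_assoc, ← h8, ← hs4]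
        by_cases c1 : 0 < m (a * I.q + c)
        · by_cases c2 : 0 < occ c
          · have : ¬ occ c < 1 := by omega
            simp [h5, hrc, hm3, hocc3, hH3.zero, hH3.one, c1, c2, c2.ne']
          · have : occ c = 0 := by omega
            simp [h5, hrc, hm3, hocc3, hH3.zero, hH3.one, c1, this]
        · simp [h5, hrc, hm3, hocc3, hH3.zero, c1]
      have hu4 : ∀ i < a * I.q + (c + 1), s4.arr αUnit i = unitOf m i := by
        intro i hi
        have : s4.arr αUnit = Function.update (s3.arr αUnit) (a * I.q + c) (s3.reg ρV) := by
          rw [← hs4, ← h5]; simp; split_ifs <;> simp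
        rw [this]
        by_cases he : i = a * I.q + c
        · simp [he, h6]
        · rw [Function.update_of_ne he, h7 i (by omega)]
      have hx4 : s4.reg ρx = s3.reg ρV := by
        rw [← hs4]; simp; split_ifs <;> simp
      have hm4 : s4.reg ρm = m (a * I.q + c) := by
        rw [← hs4, ← h5, ← hm3]; simp; split_ifs <;> simp
      -- Starting from the current unit and adding it as often as the multiplicity says multiplies
      -- it by the multiplicity plus one.
      refine Within.seq (B' := 3) (Within.mono (B' := I.n * (1 + 3) + 2) (Within.forLt (N := m (a * I.q + c))
        (B := 1) (fun j s' => s'.reg ρx = unitOf m (a * I.q + c) * (j + 1)) rfl hm4 ?_ ?_) ?_ ?_)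
      · simp [hx4, h6]
      · rintro j s5 hj h9 hrj ha5
        refine Within.mono (Within.block rfl ?_) (by decide) (fun _ _ h => h)
        have : s5.reg ρV = unitOf m (a * I.q + c) := by rw [ha5.reg ρV rfl, ha4.reg ρV rfl, h6]
        simp [h9, this]
        ring
      · have := Nat.mul_le_mul_right (1 + 3) (hm _ hin)
        omega
      · rintro s5 ha5 h9
        refine Within.mono (Within.block rfl ?_) (by decide) (fun _ _ h => h)
        refine ⟨?_, ?_, ?_, ?_⟩
        · simp [ha5.reg ρi rfl, ha4.reg ρi rfl, h5]; ring
        · simp [h9, ← unitOf_succ]; rfl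
        · simpa [ha5.arr αUnit rfl] using hu4
        · simpa [ha5.reg ρbad rfl] using hbad4
    · rintro s3 ha3 ⟨h5, h6, h7, h8⟩
      have e : (a + 1) * I.q = a * I.q + I.q := by ring
      refine ⟨by simp [h5, e], by simp [h6, e], by simpa [e] using h7, ?_⟩
      have : (∀ a' < a + 1, ∀ c < I.q, 0 < m (a' * I.q + c) → 0 < occ c) ↔
          (∀ a' < a, ∀ c < I.q, 0 < m (a' * I.q + c) → 0 < occ c) ∧
            ∀ c < I.q, 0 < m (a * I.q + c) → 0 < occ c := by
        simp only [Nat.lt_succ_iff_lt_or_eq, or_imp, forall_and, forall_eq]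
      rw [this, ← h8]
      simp
  · rintro s2 - ⟨-, h2, h3, h4⟩
    exact ⟨h2, h3, h4⟩

end Input

end LetterBoxed

/-! ## Mixed radix codes -/

namespace LetterBoxed

namespace Input

theorem unitOf_pos (m : ℕ → ℕ) (i : ℕ) : 0 < unitOf m i :=
  Finset.prod_pos fun _ _ => Nat.succ_pos _

theorem unitOf_dvd (m : ℕ → ℕ) {i N : ℕ} (h : i ≤ N) : unitOf m i ∣ unitOf m N :=
  Finset.prod_dvd_prod_of_subset _ _ _ (Finset.range_mono h)

/-- The number with digits `f`. -/
def enc (m f : ℕ → ℕ) (N : ℕ) : ℕ := ∑ i ∈ Finset.range N, f i * unitOf m i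

theorem enc_succ (m f : ℕ → ℕ) (N : ℕ) : enc m f (N + 1) = enc m f N + f N * unitOf m N :=
  Finset.sum_range_succ _ _

/-- A telescoping sum, as for 99…9 + 1: a maximal digit contributes the difference of two successive
units. So the code with all digits maximal is `V - 1`, which is the test for a goal. -/
theorem enc_self_add_one (m : ℕ → ℕ) (N : ℕ) : enc m m N + 1 = unitOf m N := by
  induction N with
  | zero => simp [enc, unitOf]
  | succ N ih => rw [enc_succ, unitOf_succ, Nat.mul_succ, ← ih]; ring

theorem enc_lt {m f : ℕ → ℕ} {N : ℕ} (h : ∀ i < N, f i ≤ m i) : enc m f N < unitOf m N := by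
  rw [← enc_self_add_one, Nat.lt_succ_iff]
  exact Finset.sum_le_sum fun i hi => Nat.mul_le_mul_right _ (h i (Finset.mem_range.1 hi))

/-- The terms above place `i` are multiples of the unit of place `i + 1` and vanish modulo the
radix; the terms below sum to less than the unit of place `i` and vanish on division. -/
theorem digit_enc {m f : ℕ → ℕ} {N : ℕ} (h : ∀ i < N, f i ≤ m i) {i : ℕ} (hi : i < N) :
    enc m f N / unitOf m i % (m i + 1) = f i := by
  induction N with
  | zero => omega
  | succ N ih =>
    have h' : ∀ i < N, f i ≤ m i := fun i hi => h i (by omega)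
    rw [enc_succ]
    rcases Nat.lt_succ_iff_lt_or_eq.1 hi with hi | rfl
    · obtain ⟨k, hk⟩ := unitOf_dvd m (Nat.succ_le_of_lt hi)
      rw [Nat.succ_eq_add_one, unitOf_succ] at hk
      rw [hk, show f N * (unitOf m i * (m i + 1) * k) = unitOf m i * ((m i + 1) * (f N * k)) by ring,
        Nat.add_mul_div_left _ _ (unitOf_pos m i), Nat.add_mul_mod_self_left, ih h' hi]
    · rw [Nat.add_mul_div_right _ _ (unitOf_pos m i), Nat.div_eq_of_lt (enc_lt h'), Nat.zero_add,
        Nat.mod_eq_of_lt (Nat.lt_succ_of_le (h i (Nat.lt_succ_self _)))]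

theorem enc_eq_iff {m f : ℕ → ℕ} {N : ℕ} (h : ∀ i < N, f i ≤ m i) :
    enc m f N + 1 = unitOf m N ↔ ∀ i < N, f i = m i := by
  constructor
  · intro e i hi
    rw [← enc_self_add_one, Nat.succ.injEq] at e
    rw [← digit_enc h hi, e, digit_enc (fun _ _ => le_rfl) hi]
  · intro e
    rw [← enc_self_add_one, Nat.succ.injEq]
    exact Finset.sum_congr rfl fun i hi => by rw [e i (Finset.mem_range.1 hi)]

theorem enc_update (m f : ℕ → ℕ) {N i : ℕ} (hi : i < N) :
    enc m (Function.update f i (f i + 1)) N = enc m f N + unitOf m i := by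
  have : ∀ i' ∈ Finset.range N, Function.update f i (f i + 1) i' * unitOf m i' =
      f i' * unitOf m i' + if i' = i then unitOf m i else 0 := by
    intro i' _
    by_cases h : i' = i
    · subst h; simp; ring
    · simp [h]
  rw [enc, Finset.sum_congr rfl this, Finset.sum_add_distrib, enc]
  simp [hi]

/-- If the digit at place `i` is not maximal, raising it causes no carry. The quotient by the unit
is not the last of its block of `m i + 1` numbers, and the number of quotients is a multiple of that
block length, so the next quotient is still admissible. -/
theorem add_unitOf_lt {m : ℕ → ℕ} {N i v : ℕ} (hi : i < N) (hv : v < unitOf m N)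
    (hd : v / unitOf m i % (m i + 1) < m i) : v + unitOf m i < unitOf m N := by
  obtain ⟨k, hk⟩ := unitOf_dvd m (Nat.succ_le_of_lt hi)
  rw [Nat.succ_eq_add_one, unitOf_succ] at hk
  have hu := unitOf_pos m i
  rw [hk] at hv ⊢
  have h1 : v / unitOf m i < (m i + 1) * k := by
    rw [Nat.div_lt_iff_lt_mul hu]; calc v < _ := hv
      _ = _ := by ring
  have h2 : v / unitOf m i / (m i + 1) < k := by
    rw [Nat.div_lt_iff_lt_mul (Nat.succ_pos _)]; rwa [Nat.mul_comm]
  have h3 : v / unitOf m i + 1 < (m i + 1) * k := by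
    rw [← Nat.div_add_mod (v / unitOf m i) (m i + 1)]
    calc _ < (m i + 1) * (v / unitOf m i / (m i + 1)) + (m i + 1) := by omega
      _ = (m i + 1) * (v / unitOf m i / (m i + 1) + 1) := by ring
      _ ≤ _ := Nat.mul_le_mul_left _ h2
  have h4 := Nat.lt_mul_div_succ v hu
  calc v + unitOf m i < unitOf m i * (v / unitOf m i + 1) + unitOf m i := by omega
    _ = unitOf m i * (v / unitOf m i + 1 + 1) := by ring
    _ ≤ unitOf m i * ((m i + 1) * k) := Nat.mul_le_mul_left _ h3
    _ = _ := by ring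

/-- The digits, capped at the multiplicities. -/
def capped (m f : ℕ → ℕ) : ℕ → ℕ := fun i => min (f i) (m i)

/-- Capping commutes with counting: the new capped count depends only on the old one. This is why
the graph can forget the true counts. -/
theorem cap_enc {L : Tables} {N : ℕ} (hu : ∀ i < N, L.unit i = unitOf L.mult i) (f : ℕ → ℕ) {i : ℕ}
    (hi : i < N) : L.cap (enc L.mult (capped L.mult f) N) i =
      enc L.mult (capped L.mult (Function.update f i (f i + 1))) N := by
  have hle : ∀ i < N, capped L.mult f i ≤ L.mult i := fun i _ => min_le_right _ _
  rw [Tables.cap, hu i hi, digit_enc hle hi]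
  split_ifs with h
  · rw [← enc_update _ _ hi]
    congr 1
    ext j
    by_cases hj : j = i
    · subst hj
      simp only [capped, Function.update_self] at h ⊢
      omega
    · simp [capped, hj]
  · congr 1
    ext j
    by_cases hj : j = i
    · subst hj
      simp only [capped, Function.update_self] at h ⊢
      omega
    · simp [capped, hj]

end Input

end LetterBoxed

/-! ## The whole program -/

namespace LetterBoxed

open RAM RAM.Prog Tables

namespace Input

theorem exists_start_add (I : Input) {D g : ℕ} (h : g < I.start D) :
    ∃ i < D, ∃ j < I.len i, g = I.start i + j := by
  induction D with
  | zero => simp [start] at h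
  | succ D ih =>
    by_cases hg : g < I.start D
    · obtain ⟨i, hi, j, hj, e⟩ := ih hg
      exact ⟨i, by omega, j, hj, e⟩
    · rw [start_succ] at h
      exact ⟨D, by omega, g - I.start D, by omega, by omega⟩

theorem start_le (I : Input) {Λ : ℕ} (hΛ : ∀ i < I.D, I.len i ≤ Λ) : I.start I.D ≤ I.D * Λ := by
  have := Finset.sum_le_card_nsmul (Finset.range I.D) I.len Λ fun i hi => hΛ i (Finset.mem_range.1 hi)
  simpa [start] using this

/-- The tables hold the data of the input. -/
structure Describes (I : Input) (L : Tables) : Prop where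
  S : L.S = I.S
  q : L.q = I.q
  D : L.D = I.D
  V : L.V = unitOf L.mult (I.S * I.q)
  M : L.M = I.start I.D
  start : ∀ i < I.D, L.start i = I.start i
  letter : ∀ i < I.D, ∀ j < I.len i, L.letter (I.start i + j) = I.word i j
  rem : ∀ i < I.D, ∀ j < I.len i, L.rem (I.start i + j) = I.len i - j
  mult : ∀ a < I.S, ∀ c < I.q, L.mult (a * I.q + c) = I.count a c
  unit : ∀ i < I.S * I.q, L.unit i = unitOf L.mult i

/-- Letters are below `q`, and words are nonempty. -/
structure Valid (I : Input) : Prop where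
  side_lt : ∀ a < I.S, ∀ j < I.n, I.side a j < I.q
  word_lt : ∀ i < I.D, ∀ j < I.len i, I.word i j < I.q
  len_pos : ∀ i < I.D, 0 < I.len i

variable {I : Input}

theorem pair_lt {a c : ℕ} (ha : a < I.S) (hc : c < I.q) : a * I.q + c < I.S * I.q := calc
  a * I.q + c < (a + 1) * I.q := by rw [Nat.add_mul]; omega
  _ ≤ _ := Nat.mul_le_mul_right _ ha

theorem exists_pair {i : ℕ} (h : i < I.S * I.q) : ∃ a < I.S, ∃ c < I.q, i = a * I.q + c := by
  have hq : 0 < I.q := Nat.pos_of_ne_zero (by rintro e; simp [e] at h)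
  exact ⟨i / I.q, (Nat.div_lt_iff_lt_mul hq).2 h, i % I.q, Nat.mod_lt _ hq,
    by rw [Nat.mul_comm]; exact (Nat.div_add_mod _ _).symm⟩

theorem Describes.wf {L : Tables} (h : I.Describes L) (hv : I.Valid) : L.WF where
  V_pos := by rw [h.V]; exact unitOf_pos _ _
  start_lt i hi := by
    rw [h.D] at hi
    rw [h.M, h.start i hi]
    exact I.start_add_lt hi (hv.len_pos i hi)
  next_lt g hg hr := by
    rw [h.M] at hg ⊢
    obtain ⟨i, hi, j, hj, rfl⟩ := I.exists_start_add hg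
    rw [h.rem i hi j hj] at hr
    exact I.start_add_lt (j := j + 1) hi (by omega)
  cap_lt g hg a ha v hlt := by
    rw [h.M] at hg
    rw [h.S] at ha
    obtain ⟨i, hi, j, hj, rfl⟩ := I.exists_start_add hg
    have hp : L.pair (I.start i + j) a < I.S * I.q := by
      rw [pair, h.letter i hi j hj, h.q]
      exact pair_lt ha (hv.word_lt i hi j hj)
    rw [h.V] at hlt ⊢
    rw [cap, h.unit _ hp]
    split_ifs with hd
    · exact add_unitOf_lt hp hlt hd
    · exact hlt

/-- Every letter of a side occurs in the dictionary. -/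
def AllOccur (I : Input) : Prop := ∀ a < I.S, ∀ c < I.q, 0 < I.count a c → I.Occurs c

/-- The outcome of the two searches. -/
def Result (L : Tables) (s : State) : Prop :=
  (s.reg 0 = 1 ∧ IsLeast {d | ∃ x, L.Goal x ∧ Cost L.Source (L.Free 1) (L.Paid 1) d x} (s.reg 1) ∧
    IsLeast {d | ∃ x, L.Goal x ∧ Cost L.Source (L.Free 0) (L.Paid 0) d x} (s.reg 2)) ∨
  (s.reg 0 = 0 ∧ ∀ d x, Cost L.Source (L.Free 1) (L.Paid 1) d x → ¬ L.Goal x)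

/-- The two searches divide the same edges differently into free and paid, so they reach the same
nodes. -/
theorem exists_cost {src : ℕ → Prop} {F P F' P' : ℕ → ℕ → Prop}
    (h : ∀ x y, F x y ∨ P x y → F' x y ∨ P' x y) {d x : ℕ} (hc : Cost src F P d x) :
    ∃ d', Cost src F' P' d' x := by
  induction hc with
  | source hs => exact ⟨_, .source hs⟩
  | free _ hF ih =>
    obtain ⟨d', hd⟩ := ih
    rcases h _ _ (.inl hF) with h | h
    exacts [⟨_, hd.free h⟩, ⟨_, hd.paid h⟩]
  | paid _ hF ih =>
    obtain ⟨d', hd⟩ := ih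
    rcases h _ _ (.inr hF) with h | h
    exacts [⟨_, hd.free h⟩, ⟨_, hd.paid h⟩]

/-- The dominant term is the number of nodes times S + D; since both are at least 1, each of S and D
is at most S·D. -/
theorem searches_time {S D V M Λ : ℕ} (hS : 0 < S) (hD : 0 < D) (hV : 0 < V) (hΛ : 0 < Λ)
    (hM : M ≤ D * Λ) : M * (S * (V * 33 + 11) + 9) + 3 +
      2 * (M * S * V * ((S + D) * 60 + 60) + D * (S * 50 + 20) + 100) + 3 ≤
      1000 * (S ^ 2 * V * D ^ 2 * Λ) := by
  set X := D * Λ * S * V with hX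
  have h1 : M * S * V ≤ X := Nat.mul_le_mul_right _ (Nat.mul_le_mul_right _ hM)
  have hW : S ^ 2 * V * D ^ 2 * Λ = X * S * D := by rw [hX]; ring
  have h2 : X * S ≤ X * S * D := Nat.le_mul_of_pos_right _ hD
  have h3 : X * D ≤ X * S * D := Nat.mul_le_mul_right _ (Nat.le_mul_of_pos_right _ hS)
  have h4 : X ≤ X * S := Nat.le_mul_of_pos_right _ hS
  have h5 : M * S ≤ M * S * V := Nat.le_mul_of_pos_right _ hV
  have h6 : M ≤ M * S := Nat.le_mul_of_pos_right _ hS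
  have h7 : D * S ≤ X := by
    have e : X = D * S * (Λ * V) := by rw [hX]; ring
    rw [e]; exact Nat.le_mul_of_pos_right _ (Nat.mul_pos hΛ hV)
  have h8 : D ≤ D * S := Nat.le_mul_of_pos_right _ hS
  have h9 := Nat.mul_le_mul_right S h1
  have h10 := Nat.mul_le_mul_right D h1
  rw [hW, show M * (S * (V * 33 + 11) + 9) = 33 * (M * S * V) + 11 * (M * S) + 9 * M by ring,
    show M * S * V * ((S + D) * 60 + 60) =
      60 * (M * S * V * S) + 60 * (M * S * V * D) + 60 * (M * S * V) by ring,
    show D * (S * 50 + 20) = 50 * (D * S) + 20 * D by ring]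
  omega

/-- The part of the program after the input has been read. -/
theorem searches_spec {L : Tables} (wf : L.WF) {s : State} (hL : L.Base s)
    (hm : s.arr αMult = L.mult) (hu : s.arr αUnit = L.unit)
    (hpos : ∀ g < L.M, ∀ a < L.S, 0 < L.unit (L.pair g a))
    (hnA : s.reg ρnA = 0) (hvis : s.arr αVis = 0) (h0 : s.reg 0 = 0) {Λ : ℕ}
    (hS : 0 < L.S) (hD : 0 < L.D) (hΛ : 0 < Λ) (hM : L.M ≤ L.D * Λ) :
    Within (fill ;; search 0 1 2 ;; search 1 2 1 ;; ifLt ρZero 1 (const 0 1) skip) s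
      (1000 * (L.S ^ 2 * L.V * L.D ^ 2 * Λ)) (Result L) := by
  have ht := searches_time hS hD wf.V_pos hΛ hM
  obtain ⟨T, hT⟩ : ∃ T, T = L.numNodes * ((L.S + L.D) * 60 + 60) + L.D * (L.S * 50 + 20) + 100 :=
    ⟨_, rfl⟩
  obtain ⟨T₀, hT₀⟩ : ∃ T₀, T₀ = L.M * (L.S * (L.V * 33 + 11) + 9) + 3 := ⟨_, rfl⟩
  rw [← hT, ← hT₀] at ht
  refine Within.mono (B := T₀ + (T + (T + 2))) (Within.seq (Within.mono
    (fill_spec hL (fun _ _ _ _ => by rw [hm]) (fun _ _ _ _ => by rw [hu]) hpos) hT₀.ge ?_))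
    (by omega) (fun _ _ h => h)
  intro s1 ha1 hL1
  refine Within.seq (Within.mono (search_spec wf hL1 0 1 2 (by decide) (by rw [ha1.reg ρnA rfl, hnA])
    (by simp [ha1.arr αVis rfl, hvis])) hT.ge ?_)
  rintro s2 ha2 ⟨hnA2, hv2, h2⟩
  have hL2 := hL1.of_agree ha2 rfl rfl rfl
  refine Within.seq (Within.mono (search_spec wf hL2 1 2 1 (by decide) hnA2
    (fun x => Nat.lt_succ_of_le (hv2 x))) hT.ge ?_)
  rintro s3 ha3 ⟨-, -, h3⟩
  have hL3 := hL2.of_agree ha3 rfl rfl rfl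
  have h00 : s3.reg 0 = 0 := by rw [ha3.reg 0 rfl, ha2.reg 0 rfl, ha1.reg 0 rfl, h0]
  have h22 : s3.reg 2 = s2.reg 2 := ha3.reg 2 rfl
  refine Within.mono (Within.block rfl ?_) (by decide) (fun _ _ h => h)
  rcases h3 with ⟨e, hno⟩ | ⟨hlt, hl⟩
  · exact .inr ⟨by simp [e, hL3.zero, h00], hno⟩
  · have hl2 : IsLeast {d | ∃ x, L.Goal x ∧ Cost L.Source (L.Free 0) (L.Paid 0) d x} (s2.reg 2) := by
      rcases h2 with ⟨-, hno⟩ | ⟨-, h2⟩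
      · obtain ⟨x, hg, hc⟩ := hl.1
        obtain ⟨d', hc'⟩ := exists_cost (F' := L.Free 0) (P' := L.Paid 0)
          (by simp [Free, Paid, or_comm]) hc
        exact absurd hg (hno _ _ hc')
      · exact h2
    refine .inl ⟨?_, ?_, ?_⟩
    · simp [hL3.zero, hlt]
    · simpa [hL3.zero, hlt] using hl
    · simpa [hL3.zero, hlt, h22] using hl2

theorem unitOf_mul (m : ℕ → ℕ) (S q : ℕ) :
    unitOf m (S * q) = ∏ a ∈ Finset.range S, ∏ c ∈ Finset.range q, (m (a * q + c) + 1) := by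
  induction S with
  | zero => simp [unitOf]
  | succ S ih =>
    rw [Finset.prod_range_succ, ← ih, Nat.succ_mul, unitOf, Finset.prod_range_add]
    rfl

theorem reading_time {S q n D Λ : ℕ} (hS : 0 < S) (hq : 0 < q) (hn : 0 < n) :
    9 + (S * (n * 11 + 6) + 3) + (D * (Λ * 12 + 9) + 4) + (S * (q * (n * 4 + 20) + 20) + 20) + 3 ≤
      200 * (S * q * n + D * (Λ + 1)) := by
  have h1 : S ≤ S * q := Nat.le_mul_of_pos_right _ hq
  have h2 : S * q ≤ S * q * n := Nat.le_mul_of_pos_right _ hn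
  have h3 : S * n ≤ S * q * n := Nat.mul_le_mul_right _ h1
  rw [show S * (n * 11 + 6) = 11 * (S * n) + 6 * S by ring,
    show D * (Λ * 12 + 9) = 12 * (D * Λ) + 9 * D by ring,
    show S * (q * (n * 4 + 20) + 20) = 4 * (S * q * n) + 20 * (S * q) + 20 * S by ring,
    show D * (Λ + 1) = D * Λ + D by ring]
  have h4 : 0 < S * q * n := Nat.mul_pos (Nat.mul_pos hS hq) hn
  omega

-- The time splits into a part for reading, which does not involve the number of codes, and a part
-- for the searches, which is spent only if every letter of the sides occurs in the dictionary. The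
-- corollary depends on this.
open Classical in
theorem core_spec {s : State} (h : I.Holds (s.arr αIn)) (hv : I.Valid)
    (hnA : s.reg ρnA = 0) (hz : ∀ b, b ≠ αIn → s.arr b = 0) {Λ : ℕ} (hΛ : ∀ i < I.D, I.len i ≤ Λ)
    (hΛ0 : 0 < Λ) (hS : 0 < I.S) (hq : 0 < I.q) (hn : 0 < I.n) (hD : 0 < I.D) :
    Within core s (200 * (I.S * I.q * I.n + I.D * (Λ + 1)) + if I.AllOccur then
        1000 * (I.S ^ 2 * (∏ a ∈ Finset.range I.S, ∏ c ∈ Finset.range I.q, (I.count a c + 1)) *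
          I.D ^ 2 * Λ) else 0)
      fun s' => s'.reg ρK = s.arr αIn (4 + I.S * I.n + I.start I.D + I.D) ∧
        (I.AllOccur ∧ (∃ L, I.Describes L ∧ Result L s') ∨ ¬ I.AllOccur ∧ s'.reg 0 = 0) := by
  set W := if I.AllOccur then 1000 * (I.S ^ 2 * (∏ a ∈ Finset.range I.S, ∏ c ∈ Finset.range I.q,
    (I.count a c + 1)) * I.D ^ 2 * Λ) else 0 with hW
  have ht := reading_time (D := I.D) (Λ := Λ) hS hq hn
  refine Within.mono (B := 9 + ((I.S * (I.n * 11 + 6) + 3) + ((I.D * (Λ * 12 + 9) + 4) +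
    ((I.S * (I.q * (I.n * 4 + 20) + 20) + 20) + (1 + (max W 1 + 1))))))
    (Within.seq (Within.mono (header_spec h) le_rfl ?_)) ?_ (fun _ _ h => h)
  swap
  · have : max W 1 ≤ W + 1 := by omega
    omega
  rintro s1 ha1 ⟨hH1, hp1⟩
  have hin1 : s1.arr αIn = s.arr αIn := ha1.arr αIn rfl
  refine Within.seq (Within.mono (readSides_spec (hin1 ▸ h) hH1 hp1
    (by rw [ha1.arr αMult rfl, hz _ (by decide)]) hv.side_lt) le_rfl ?_)
  rintro s2 ha2 ⟨hp2, hmult2⟩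
  have hH2 := hH1.of_agree ha2 rfl
  have hin2 : s2.arr αIn = s.arr αIn := (ha2.arr αIn rfl).trans hin1
  refine Within.seq (Within.mono (readWords_spec (hin2 ▸ h) hH2 hp2
    (by rw [ha2.arr αOcc rfl, ha1.arr αOcc rfl, hz _ (by decide)]) hΛ) le_rfl ?_)
  rintro s3 ha3 ⟨hR, hstart, hK⟩
  have hH3 := hH2.of_agree ha3 rfl
  have hmult3 : ∀ a < I.S, ∀ c < I.q, s3.arr αMult (a * I.q + c) = I.count a c := by
    rw [ha3.arr αMult rfl]; exact hmult2
  refine Within.seq (Within.mono (mkUnits_spec hH3 ?_) le_rfl ?_)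
  · intro i hi
    obtain ⟨a, ha, c, hc, rfl⟩ := exists_pair hi
    rw [hmult3 a ha c hc]
    exact Nat.count_le _
  rintro s4 ha4 ⟨hV, hunit, hbad⟩
  have hH4 := hH3.of_agree ha4 rfl
  have hall : s4.reg ρbad = 0 ↔ I.AllOccur := by
    rw [hbad]
    refine forall₂_congr fun a ha => forall₂_congr fun c hc => ?_
    rw [hmult3 a ha c hc, hR.occ]
    refine imp_congr_right fun _ => ?_
    simp [Before, Occurs, and_assoc]
  refine Within.seq (Within.mono (B' := 1) (Within.block rfl rfl) (by decide) ?_)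
  rintro s5 ha5 hs5
  have h05 : s5.reg 0 = 0 := by rw [← hs5]; simp
  have hK5 : s5.reg ρK = s.arr αIn (4 + I.S * I.n + I.start I.D + I.D) := by
    rw [ha5.reg ρK rfl, ha4.reg ρK rfl, hK, hin2]
  have hH5 := hH4.of_agree ha5 rfl
  -- The tables of the graph are taken from the machine state itself, so that `Base` is almost
  -- definitional and only `Describes` needs proof.
  let L : Tables := ⟨I.S, I.q, I.D, s5.reg ρV, s5.reg ρM, s5.arr αStart, s5.arr αLetter, s5.arr αRem,
    s5.arr αMult, s5.arr αUnit⟩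
  have hmL : L.mult = s3.arr αMult := by
    change s5.arr αMult = _
    rw [ha5.arr αMult rfl, ha4.arr αMult rfl]
  have hdesc : I.Describes L := by
    refine ⟨rfl, rfl, rfl, ?_, ?_, ?_, ?_, ?_, ?_, ?_⟩
    · rw [hmL, ← hV]; exact ha5.reg ρV rfl
    · change s5.reg ρM = _
      rw [ha5.reg ρM rfl, ha4.reg ρM rfl, hR.M]; rfl
    · change ∀ i < I.D, s5.arr αStart i = _
      rwa [ha5.arr αStart rfl, ha4.arr αStart rfl]
    · change ∀ i < I.D, ∀ j < I.len i, s5.arr αLetter _ = _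
      rw [ha5.arr αLetter rfl, ha4.arr αLetter rfl]
      exact fun i hi j hj => hR.letter i j (.inl ⟨hi, hj⟩)
    · change ∀ i < I.D, ∀ j < I.len i, s5.arr αRem _ = _
      rw [ha5.arr αRem rfl, ha4.arr αRem rfl]
      exact fun i hi j hj => hR.rem i j (.inl ⟨hi, hj⟩)
    · rwa [hmL]
    · rw [hmL]
      change ∀ i < _, s5.arr αUnit i = _
      rwa [ha5.arr αUnit rfl]
  have wf := hdesc.wf hv
  have hbad5 : s5.reg ρbad = s4.reg ρbad := ha5.reg ρbad rfl
  refine Within.ifLt (fun hc => ?_) (fun hc => ?_)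
  · have hA : I.AllOccur := hall.1 (by rw [hH5.one, hbad5] at hc; omega)
    have hVe : L.V = ∏ a ∈ Finset.range I.S, ∏ c ∈ Finset.range I.q, (I.count a c + 1) := by
      rw [hdesc.V, unitOf_mul]
      exact Finset.prod_congr rfl fun a ha => Finset.prod_congr rfl fun c hc => by
        rw [hdesc.mult a (Finset.mem_range.1 ha) c (Finset.mem_range.1 hc)]
    refine Within.mono (searches_spec wf (s := s5) ?_ rfl rfl ?_ ?_ ?_ h05 hS hD hΛ0 ?_) ?_ ?_
    · exact ⟨hH5.zero, hH5.one, hH5.two, hH5.S, hH5.q, hH5.D, rfl, rfl, fun _ _ => rfl,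
        fun _ _ => rfl, fun _ _ => rfl⟩
    · intro g hg a ha
      rw [hdesc.M] at hg
      obtain ⟨i, hi, j, hj, rfl⟩ := I.exists_start_add hg
      have hp : L.pair (I.start i + j) a < I.S * I.q := by
        rw [pair, hdesc.letter i hi j hj]
        exact pair_lt ha (hv.word_lt i hi j hj)
      rw [hdesc.unit _ hp]
      exact unitOf_pos _ _
    · rw [ha5.reg ρnA rfl, ha4.reg ρnA rfl, ha3.reg ρnA rfl, ha2.reg ρnA rfl, ha1.reg ρnA rfl, hnA]
    · rw [ha5.arr αVis rfl, ha4.arr αVis rfl, ha3.arr αVis rfl, ha2.arr αVis rfl, ha1.arr αVis rfl,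
        hz _ (by decide)]
    · rw [hdesc.M]; exact I.start_le hΛ
    · rw [hW, if_pos hA, hVe]; exact le_max_left _ _
    · intro s6 ha6 hres
      exact ⟨(ha6.reg ρK rfl).trans hK5, .inl ⟨hA, L, hdesc, hres⟩⟩
  · have hA : ¬ I.AllOccur := fun h => by
      rw [hH5.one, hbad5, hall.2 h] at hc; omega
    refine Within.mono (Within.block rfl ?_) (le_max_right _ _) (fun _ _ h => h)
    exact ⟨hK5, .inr ⟨hA, h05⟩⟩

end Input

end LetterBoxed

/-! ## Solutions as walks -/

namespace LetterBoxed

section lists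

variable {α : Type*}

theorem isWordEnd_lt {words : List (List α)} {j : ℕ} (h : IsWordEnd words j) :
    j < words.flatten.length := by
  obtain ⟨m, -, hj⟩ := h
  have : (words.take (m + 1)).flatten.length ≤ words.flatten.length :=
    ((List.take_prefix (m + 1) words).sublist.flatten).length_le
  omega

theorem isWordEnd_append_singleton (words : List (List α)) (w : List α) (j : ℕ) :
    IsWordEnd (words ++ [w]) j ↔
      IsWordEnd words j ∨ j + 1 = words.flatten.length + w.length := by
  constructor
  · rintro ⟨m, hm, hj⟩
    rw [List.length_append, List.length_singleton] at hm
    rcases Nat.lt_succ_iff_lt_or_eq.1 hm with hm | rfl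
    · rw [List.take_append_of_le_length hm] at hj
      exact .inl ⟨m, hm, hj⟩
    · right
      rw [List.take_of_length_le (by simp)] at hj
      simpa using hj.symm
  · rintro (⟨m, hm, hj⟩ | hj)
    · exact ⟨m, by simp; omega, by rwa [List.take_append_of_le_length hm]⟩
    · exact ⟨words.length, by simp, by rw [List.take_of_length_le (by simp)]; simpa using hj.symm⟩

/-- The total length of the first `i` words. -/
def prefixLen (words : List (List α)) (i : ℕ) : ℕ := (words.take i).flatten.length

theorem prefixLen_succ {words : List (List α)} {i : ℕ} {w : List α} (h : words[i]? = some w) :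
    prefixLen words (i + 1) = prefixLen words i + w.length := by
  simp [prefixLen, List.take_add_one, h]

theorem prefixLen_mono (words : List (List α)) : Monotone (prefixLen words) := fun _ _ h =>
  ((List.take_prefix_take_left h).sublist.flatten).length_le

theorem prefixLen_length (words : List (List α)) :
    prefixLen words words.length = words.flatten.length := by simp [prefixLen]

theorem getElem?_flatten {words : List (List α)} {i p : ℕ} {w : List α} (h : words[i]? = some w)
    (hp : p < w.length) : words.flatten[prefixLen words i + p]? = w[p]? := by
  have hi := (List.getElem?_eq_some_iff.1 h).1
  have e : words = words.take i ++ w :: words.drop (i + 1) := by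
    rw [← (List.getElem?_eq_some_iff.1 h).2, List.cons_getElem_drop_succ, List.take_append_drop]
  conv_lhs => rw [e]
  rw [List.flatten_append, List.flatten_cons, ← e, prefixLen,
    List.getElem?_append_right (by omega), Nat.add_sub_cancel_left, List.getElem?_append_left hp]

/-- Because words are nonempty, the prefix lengths increase strictly, and a position inside word `i`
cannot be the end of another word. -/
theorem isWordEnd_prefixLen {words : List (List α)} (hne : ∀ w ∈ words, w ≠ []) {i p : ℕ}
    {w : List α} (h : words[i]? = some w) (hp : p < w.length) :
    IsWordEnd words (prefixLen words i + p) ↔ p + 1 = w.length := by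
  have hs := prefixLen_succ h
  constructor
  · rintro ⟨m, hm, hj⟩
    change prefixLen words (m + 1) = _ at hj
    rcases Nat.lt_trichotomy m i with hmi | rfl | hmi
    · have := prefixLen_mono words (show m + 1 ≤ i from hmi)
      omega
    · omega
    · have h1 := prefixLen_mono words (show i + 1 ≤ m from hmi)
      have h2 : words[m]? = some words[m] := List.getElem?_eq_getElem hm
      have h3 := prefixLen_succ h2
      have h4 := List.length_pos_of_ne_nil (hne _ (List.getElem_mem hm))
      omega
  · intro e
    refine ⟨i, (List.getElem?_eq_some_iff.1 h).1, ?_⟩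
    change prefixLen words (i + 1) = _
    omega

theorem getElem?_snoc {l : List α} {x y : α} {j : ℕ} (h : (l ++ [x])[j]? = some y) :
    j < l.length ∧ l[j]? = some y ∨ j = l.length ∧ y = x := by
  by_cases hj : j < l.length
  · rw [List.getElem?_append_left hj] at h
    exact .inl ⟨hj, h⟩
  · rw [List.getElem?_append_right (by omega)] at h
    have h0 := (List.getElem?_eq_some_iff.1 h).1
    simp at h0
    have : j = l.length := by omega
    subst this
    simp at h
    exact .inr ⟨rfl, h.symm⟩

theorem getElem?_flatten_snoc (words : List (List α)) (w : List α) (p : ℕ) :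
    (words ++ [w]).flatten[words.flatten.length + p]? = w[p]? := by
  rw [List.flatten_append, List.getElem?_append_right (by omega)]
  simp

end lists

variable {S q : ℕ}

/-- Count one more letter `c` on side `a`. -/
def bump (f : Fin S → Fin q → ℕ) (a : Fin S) (c : Fin q) : Fin S → Fin q → ℕ :=
  fun a' c' => f a' c' + if a' = a ∧ c' = c then 1 else 0

/-- `Reach P k l w p a f`: in the course of a solution with `k` words and `l` letters so far, position
`p` of the word `w` is played on side `a`, and `f` counts the letters played. -/
inductive Reach (P : Puzzle S q) :
    ℕ → ℕ → List (Fin q) → ℕ → Fin S → (Fin S → Fin q → ℕ) → Prop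
  | start {w c a} : w ∈ P.dict → w[0]? = some c → c ∈ P.side a → Reach P 1 1 w 0 a (bump 0 a c)
  | step {k l w p a f b c} : Reach P k l w p a f → w[p + 1]? = some c → a ≠ b → c ∈ P.side b →
      Reach P k (l + 1) w (p + 1) b (bump f b c)
  | switch {k l w p a f w'} : Reach P k l w p a f → p + 1 = w.length → w' ∈ P.dict →
      w.getLast? = w'.head? → Reach P (k + 1) l w' 0 a f

open Classical in
/-- The number of positions before `t` that are not the end of a word, with a given letter and
side. -/
noncomputable def countBefore (words : List (List (Fin q))) (sides : List (Fin S)) (t : ℕ)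
    (a : Fin S) (c : Fin q) : ℕ :=
  ((Finset.range t).filter fun j => words.flatten[j]? = some c ∧ sides[j]? = some a ∧
    ¬ IsWordEnd words j).card

open Classical in
theorem countBefore_succ (words : List (List (Fin q))) (sides : List (Fin S)) (t : ℕ)
    (a : Fin S) (c : Fin q) : countBefore words sides (t + 1) a c = countBefore words sides t a c +
      if words.flatten[t]? = some c ∧ sides[t]? = some a ∧ ¬ IsWordEnd words t then 1 else 0 := by
  simp only [countBefore, Finset.range_add_one, Finset.filter_insert]
  split_ifs with h
  · rw [Finset.card_insert_of_notMem (by simp)]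
  · rfl

-- The last position of a solution counts although it ends a word; among the earlier ones only those
-- that do not end a word count.
open Classical in
theorem ncard_cover {words : List (List (Fin q))} {t : ℕ} (ht : words.flatten.length = t + 1)
    (sides : List (Fin S)) (a : Fin S) (c : Fin q) :
    Set.ncard {j : ℕ | words.flatten[j]? = some c ∧ sides[j]? = some a ∧
      (j + 1 = words.flatten.length ∨ ¬ IsWordEnd words j)} =
    countBefore words sides t a c +
      if words.flatten[t]? = some c ∧ sides[t]? = some a then 1 else 0 := by
  have e : {j : ℕ | words.flatten[j]? = some c ∧ sides[j]? = some a ∧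
      (j + 1 = words.flatten.length ∨ ¬ IsWordEnd words j)} =
      ↑((Finset.range (t + 1)).filter fun j => words.flatten[j]? = some c ∧ sides[j]? = some a ∧
      (j + 1 = words.flatten.length ∨ ¬ IsWordEnd words j)) := by
    ext j
    simp only [Set.mem_ofPred_eq, Finset.coe_filter, Finset.mem_range]
    refine ⟨fun h => ⟨?_, h⟩, fun h => h.2⟩
    rw [← ht]
    exact (List.getElem?_eq_some_iff.1 h.1).1
  rw [e, Set.ncard_coe_finset, Finset.range_add_one, Finset.filter_insert]
  have e2 : ((Finset.range t).filter fun j => words.flatten[j]? = some c ∧ sides[j]? = some a ∧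
      (j + 1 = words.flatten.length ∨ ¬ IsWordEnd words j)).card = countBefore words sides t a c := by
    unfold countBefore
    congr 1
    refine Finset.filter_congr fun j hj => ?_
    have : j + 1 ≠ words.flatten.length := by
      have := Finset.mem_range.1 hj
      omega
    simp only [this, false_or]
  simp only [ht, true_or, and_true] at e2 ⊢
  split_ifs with h
  · rw [Finset.card_insert_of_notMem (by simp), e2]
  · rw [e2]; rfl

open Classical in
theorem countBefore_congr {words words' : List (List (Fin q))} {sides sides' : List (Fin S)} {t : ℕ}
    (h : ∀ j < t, words.flatten[j]? = words'.flatten[j]? ∧ sides[j]? = sides'[j]? ∧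
      (IsWordEnd words j ↔ IsWordEnd words' j)) (a : Fin S) (c : Fin q) :
    countBefore words sides t a c = countBefore words' sides' t a c := by
  unfold countBefore
  congr 1
  refine Finset.filter_congr fun j hj => ?_
  obtain ⟨h1, h2, h3⟩ := h j (Finset.mem_range.1 hj)
  rw [h1, h2, h3]

/-- A solution that has been played up to position `p` of the word `w`. -/
structure Partial (P : Puzzle S q) (done : List (List (Fin q))) (sides : List (Fin S))
    (w : List (Fin q)) (p : ℕ) (a : Fin S) (f : Fin S → Fin q → ℕ) : Prop where
  mem_dict : ∀ u ∈ done ++ [w], u ∈ P.dict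
  lt : p < w.length
  length_sides : sides.length = done.flatten.length + p + 1
  last : sides[done.flatten.length + p]? = some a
  linked : ∀ (i : ℕ) u v, (done ++ [w])[i]? = some u → (done ++ [w])[i + 1]? = some v →
    u.getLast? = v.head?
  side_ne : ∀ (j : ℕ) a b, sides[j]? = some a → sides[j + 1]? = some b →
    ¬ IsWordEnd (done ++ [w]) j → a ≠ b
  side_eq : ∀ (j : ℕ) a b, sides[j]? = some a → sides[j + 1]? = some b →
    IsWordEnd (done ++ [w]) j → a = b
  mem_side : ∀ (j : ℕ) (c : Fin q) (a : Fin S), (done ++ [w]).flatten[j]? = some c →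
    sides[j]? = some a → c ∈ P.side a
  count : ∀ a' c', f a' c' = countBefore (done ++ [w]) sides (done.flatten.length + p) a' c' +
    if a' = a ∧ w[p]? = some c' then 1 else 0

/-- The play is rebuilt by recording words and sides. Each completed word repeats its last letter as
the first of the next, so the number of positions exceeds the letters played by `done.length`. -/
theorem Reach.exists_partial {P : Puzzle S q} {k l : ℕ} {w : List (Fin q)} {p : ℕ} {a : Fin S}
    {f : Fin S → Fin q → ℕ} (h : Reach P k l w p a f) :
    ∃ done sides, Partial P done sides w p a f ∧ done.length + 1 = k ∧
      l + done.length = done.flatten.length + p + 1 := by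
  induction h with
  | @start w c a hw hc ha =>
    refine ⟨[], [a], ⟨by simpa using hw, (List.getElem?_eq_some_iff.1 hc).1, by simp, by simp,
      ?_, ?_, ?_, ?_, ?_⟩, rfl, by simp⟩
    · rintro i u v - hv
      simp at hv
    · rintro j b b' - hb'
      simp at hb'
    · rintro j b b' - hb'
      simp at hb'
    · rintro j c' b hc' hb
      have hj : j < [a].length := (List.getElem?_eq_some_iff.1 hb).1
      obtain rfl : j = 0 := by simpa using hj
      simp at hb hc'
      rw [hc'] at hc
      cases hc
      rwa [← hb]
    · intro a' c'
      simp [bump, countBefore, hc, eq_comm]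
  | @step k l w p a f b c _ hc hab hb ih =>
    obtain ⟨done, sides, h, hk, hl⟩ := ih
    have hp1 : p + 1 < w.length := (List.getElem?_eq_some_iff.1 hc).1
    have hne : ¬ IsWordEnd (done ++ [w]) (done.flatten.length + p) := by
      rw [isWordEnd_append_singleton]
      rintro (he | he)
      · have := isWordEnd_lt he
        omega
      · omega
    have hT := h.length_sides
    have hlast : ∀ {x}, sides[done.flatten.length + p]? = some x → x = a := fun hx => by
      rw [h.last] at hx; exact (Option.some.inj hx).symm
    refine ⟨done, sides ++ [b], ⟨h.mem_dict, hp1, by rw [List.length_append, hT]; rfl, ?_, h.linked, ?_, ?_, ?_, ?_⟩, hk,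
      by omega⟩
    · rw [List.getElem?_append_right (by omega)]
      simp [hT, Nat.add_assoc]
    · intro j x y hx hy hj
      rcases getElem?_snoc hy with ⟨h1, h2⟩ | ⟨h1, rfl⟩
      · rw [List.getElem?_append_left (by omega)] at hx
        exact h.side_ne j x y hx h2 hj
      · rw [List.getElem?_append_left (by omega)] at hx
        obtain rfl : j = done.flatten.length + p := by omega
        rw [hlast hx]
        exact hab
    · intro j x y hx hy hj
      rcases getElem?_snoc hy with ⟨h1, h2⟩ | ⟨h1, rfl⟩
      · rw [List.getElem?_append_left (by omega)] at hx
        exact h.side_eq j x y hx h2 hj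
      · obtain rfl : j = done.flatten.length + p := by omega
        exact absurd hj hne
    · intro j c' x hc' hx
      rcases getElem?_snoc hx with ⟨h1, h2⟩ | ⟨h1, rfl⟩
      · exact h.mem_side j c' x hc' h2
      · rw [h1, hT, Nat.add_assoc, getElem?_flatten_snoc, hc] at hc'
        rwa [← Option.some.inj hc']
    · intro a' c'
      have e := countBefore_congr (words := done ++ [w]) (words' := done ++ [w])
        (sides := sides ++ [b]) (sides' := sides) (t := done.flatten.length + p)
        (fun j hj => ⟨rfl, List.getElem?_append_left (by omega), .rfl⟩) a' c'
      rw [← Nat.add_assoc, countBefore_succ, e, getElem?_flatten_snoc,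
        List.getElem?_append_left (by omega), h.last, bump, h.count, hc]
      simp only [hne, not_false_eq_true, and_true, Option.some.injEq, @eq_comm _ a a',
        @eq_comm _ c c', @and_comm (w[p]? = some c')]
  | @switch k l w p a f w' _ hp hw' hlink ih =>
    obtain ⟨done, sides, h, hk, hl⟩ := ih
    have hT := h.length_sides
    have hTw : (done ++ [w]).flatten.length = done.flatten.length + p + 1 := by simp; omega
    have hend : IsWordEnd (done ++ [w]) (done.flatten.length + p) :=
      (isWordEnd_append_singleton _ _ _).2 (.inr (by omega))
    have hw0 : w'[0]? = w[p]? := by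
      rw [← List.head?_eq_getElem?, ← hlink, List.getLast?_eq_getElem?]
      congr 1
      omega
    have hne : 0 < w'.length := List.length_pos_of_ne_nil (P.word_ne_nil _ hw')
    have hlast : ∀ {x}, sides[done.flatten.length + p]? = some x → x = a := fun hx => by
      rw [h.last] at hx; exact (Option.some.inj hx).symm
    have hiff : ∀ j, j ≤ done.flatten.length + p →
        (IsWordEnd (done ++ [w] ++ [w']) j ↔ IsWordEnd (done ++ [w]) j) := by
      intro j hj
      rw [isWordEnd_append_singleton (done ++ [w])]
      refine or_iff_left ?_
      omega
    refine ⟨done ++ [w], sides ++ [a], ⟨?_, hne, by rw [List.length_append, hT, hTw]; rfl, ?_, ?_, ?_, ?_, ?_, ?_⟩,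
      by simp [hk], by rw [hTw, List.length_append, List.length_singleton]; omega⟩
    · intro u hu
      rcases List.mem_append.1 hu with hu | hu
      · exact h.mem_dict u hu
      · rwa [List.mem_singleton.1 hu]
    · rw [List.getElem?_append_right (by omega)]
      simp only [hT, hTw]
      simp
    · intro i u v hu hv
      rcases getElem?_snoc hv with ⟨h1, h2⟩ | ⟨h1, rfl⟩
      · rw [List.getElem?_append_left (by omega)] at hu
        exact h.linked i u v hu h2
      · rw [List.getElem?_append_left (by omega)] at hu
        have : i = done.length := by simp at h1; omega
        subst this
        simp at hu
        rw [← hu, hlink]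
    · intro j x y hx hy hj
      rcases getElem?_snoc hy with ⟨h1, h2⟩ | ⟨h1, rfl⟩
      · rw [List.getElem?_append_left (by omega)] at hx
        exact h.side_ne j x y hx h2 (by rwa [← hiff j (by omega)])
      · obtain rfl : j = done.flatten.length + p := by omega
        exact absurd ((hiff _ le_rfl).2 hend) hj
    · intro j x y hx hy hj
      rcases getElem?_snoc hy with ⟨h1, h2⟩ | ⟨h1, rfl⟩
      · rw [List.getElem?_append_left (by omega)] at hx
        exact h.side_eq j x y hx h2 (by rwa [← hiff j (by omega)])
      · rw [List.getElem?_append_left (by omega)] at hx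
        obtain rfl : j = done.flatten.length + p := by omega
        exact hlast hx
    · intro j c' x hc' hx
      rcases getElem?_snoc hx with ⟨h1, h2⟩ | ⟨h1, rfl⟩
      · refine h.mem_side j c' x ?_ h2
        rw [List.flatten_append, List.getElem?_append_left (by omega)] at hc'
        exact hc'
      · refine h.mem_side (done.flatten.length + p) c' x ?_ h.last
        have : j = (done ++ [w]).flatten.length + 0 := by omega
        rw [this, getElem?_flatten_snoc, hw0] at hc'
        rw [getElem?_flatten_snoc, hc']
    · intro a' c'
      have e := countBefore_congr (words := done ++ [w] ++ [w']) (words' := done ++ [w])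
        (sides := sides ++ [a]) (sides' := sides) (t := done.flatten.length + p)
        (fun j hj => ⟨by rw [List.flatten_append, List.getElem?_append_left (by omega)],
          List.getElem?_append_left (by omega), hiff j (by omega)⟩) a' c'
      -- The end of `w` ceases to count and the start of `w'` counts instead; letter and side agree,
      -- so `f` does not change.
      rw [hTw, Nat.add_zero, countBefore_succ, e, if_neg, h.count, hw0, Nat.add_zero]
      rintro ⟨-, -, h3⟩
      exact h3 ((hiff _ le_rfl).2 hend)

/-- The converse of `Reach.exists_partial`: the play is followed along the solution, by induction on
the word and then on the position in it. The first position of a later word is reached from the last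
position of the word before by `switch`. -/
theorem IsSolution.reach {P : Puzzle S q} {words : List (List (Fin q))} {sides : List (Fin S)}
    (h : IsSolution P words sides) (i : ℕ) : ∀ (p : ℕ) (w : List (Fin q)), words[i]? = some w →
    p < w.length → ∃ a f l, sides[prefixLen words i + p]? = some a ∧
      Reach P (i + 1) l w p a f ∧ l + i = prefixLen words i + p + 1 ∧
      ∀ a' c', f a' c' = countBefore words sides (prefixLen words i + p) a' c' +
        if a' = a ∧ w[p]? = some c' then 1 else 0 := by
  have hne : ∀ w ∈ words, w ≠ [] := fun w hw => P.word_ne_nil w (h.mem_dict w hw)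
  have hside : ∀ i p w, words[i]? = some w → p < w.length →
      ∃ a, sides[prefixLen words i + p]? = some a := by
    intro i p w hw hp
    have h1 := prefixLen_succ hw
    have h2 := prefixLen_mono words (Nat.succ_le_of_lt (List.getElem?_eq_some_iff.1 hw).1)
    rw [prefixLen_length, ← h.length_sides, Nat.succ_eq_add_one] at h2
    exact ⟨_, List.getElem?_eq_getElem (by omega)⟩
  have hstep : ∀ i p w, words[i]? = some w → p + 1 < w.length → (∃ a f l,
      sides[prefixLen words i + p]? = some a ∧
      Reach P (i + 1) l w p a f ∧ l + i = prefixLen words i + p + 1 ∧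
      ∀ a' c', f a' c' = countBefore words sides (prefixLen words i + p) a' c' +
        if a' = a ∧ w[p]? = some c' then 1 else 0) → ∃ a f l,
      sides[prefixLen words i + (p + 1)]? = some a ∧
      Reach P (i + 1) l w (p + 1) a f ∧ l + i = prefixLen words i + (p + 1) + 1 ∧
      ∀ a' c', f a' c' = countBefore words sides (prefixLen words i + (p + 1)) a' c' +
        if a' = a ∧ w[p + 1]? = some c' then 1 else 0 := by
    rintro i p w hw hp ⟨a, f, l, ha, hr, hl, hf⟩
    obtain ⟨b, hb⟩ := hside i (p + 1) w hw hp
    have hc : w[p + 1]? = some w[p + 1] := List.getElem?_eq_getElem hp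
    have hend : ¬ IsWordEnd words (prefixLen words i + p) := by
      rw [isWordEnd_prefixLen hne hw (by omega)]; omega
    refine ⟨b, _, _, hb, hr.step hc (h.side_ne _ _ _ ha hb hend)
      (h.mem_side _ _ _ ((getElem?_flatten hw hp).trans hc) hb), by omega, ?_⟩
    intro a' c'
    rw [← Nat.add_assoc, countBefore_succ, getElem?_flatten hw (by omega), ha, bump, hf, hc]
    simp only [hend, not_false_eq_true, and_true, Option.some.injEq, @eq_comm _ a a',
      @eq_comm _ _ c', @and_comm (w[p]? = some c')]
  induction i with
  | zero =>
    intro p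
    induction p with
    | zero =>
      intro w hw hp
      obtain ⟨a, ha⟩ := hside 0 0 w hw hp
      have hc : w[0]? = some w[0] := List.getElem?_eq_getElem hp
      refine ⟨a, _, _, ha, .start (h.mem_dict w (List.mem_of_getElem? hw)) hc
        (h.mem_side _ _ _ ((getElem?_flatten hw hp).trans hc) ha), by simp [prefixLen], ?_⟩
      intro a' c'
      simp [bump, countBefore, prefixLen, hc, @eq_comm _ _ c']
    | succ p ih => exact fun w hw hp => hstep 0 p w hw hp (ih w hw (by omega))
  | succ i ihi =>
    intro p
    induction p with
    | zero =>
      intro w hw hp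
      have hi : i < words.length := by
        have := (List.getElem?_eq_some_iff.1 hw).1
        omega
      have hw' : words[i]? = some words[i] := List.getElem?_eq_getElem hi
      have hpos := List.length_pos_of_ne_nil (hne _ (List.getElem_mem hi))
      obtain ⟨a, f, l, ha, hr, hl, hf⟩ := ihi (words[i].length - 1) _ hw' (by omega)
      obtain ⟨b, hb⟩ := hside (i + 1) 0 w hw hp
      have hlink := h.linked i _ _ hw' hw
      have hpl := prefixLen_succ hw'
      have hend : IsWordEnd words (prefixLen words i + (words[i].length - 1)) := by
        rw [isWordEnd_prefixLen hne hw' (by omega)]; omega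
      have hidx : prefixLen words (i + 1) + 0 = prefixLen words i + (words[i].length - 1) + 1 := by
        omega
      obtain rfl : a = b := h.side_eq _ _ _ ha (by rwa [← hidx]) hend
      have hw0 : w[0]? = words[i][words[i].length - 1]? := by
        rw [← List.head?_eq_getElem?, ← hlink, List.getLast?_eq_getElem?]
      refine ⟨a, _, _, hb, hr.switch (by omega) (h.mem_dict w (List.mem_of_getElem? hw)) hlink,
        by omega, ?_⟩
      intro a' c'
      rw [hidx, countBefore_succ, if_neg (fun h => h.2.2 hend), hf, hw0, Nat.add_zero]
    | succ p ih => exact fun w hw hp => hstep (i + 1) p w hw hp (ih w hw (by omega))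

/-- Once the last word is complete, the running count `f` is exactly the number of plays demanded by
`cover`, and the other conditions are local to each move. -/
theorem isSolution_iff_reach {P : Puzzle S q} (hS : 0 < S) (k l : ℕ) :
    (∃ words sides, IsSolution P words sides ∧ words.length = k ∧ numLetters words = l) ↔
    ∃ w p a f, Reach P k l w p a f ∧ p + 1 = w.length ∧ ∀ a c, (P.side a).count c ≤ f a c := by
  constructor
  · rintro ⟨words, sides, h, rfl, rfl⟩
    -- The empty sequence fails to cover: there is a side, and it has a letter.
    have hwords : words ≠ [] := by
      rintro rfl
      have hcard : 0 < (P.side ⟨0, hS⟩).card := by rw [P.card_side]; exact P.n_pos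
      obtain ⟨c, hc⟩ := Multiset.card_pos_iff_exists_mem.1 hcard
      have := h.cover _ c hc
      simp at this
      exact this hc
    have hpos := List.length_pos_of_ne_nil hwords
    have hi : words.length - 1 < words.length := by omega
    have hw : words[words.length - 1]? = some words[words.length - 1] := List.getElem?_eq_getElem hi
    set w := words[words.length - 1] with hwdef
    have hwpos : 0 < w.length :=
      List.length_pos_of_ne_nil (P.word_ne_nil _ (h.mem_dict _ (List.getElem_mem hi)))
    obtain ⟨a, f, l, ha, hr, hl, hf⟩ := h.reach _ (w.length - 1) w hw (by omega)
    have hlen : words.flatten.length = prefixLen words (words.length - 1) + (w.length - 1) + 1 := by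
      have h1 := prefixLen_succ hw
      rw [Nat.sub_add_cancel hpos, prefixLen_length] at h1
      omega
    rw [Nat.sub_add_cancel hpos] at hr
    have hll : numLetters words = l := by
      unfold numLetters
      omega
    rw [hll]
    refine ⟨w, _, a, f, hr, by omega, ?_⟩
    intro a' c'
    by_cases hc' : c' ∈ P.side a'
    · refine (h.cover a' c' hc').trans (le_of_eq ?_)
      rw [ncard_cover hlen, hf, ha, getElem?_flatten hw (by omega)]
      simp only [Option.some.injEq, @eq_comm _ a a', @and_comm _ (a' = a)]
    · rw [Multiset.count_eq_zero_of_notMem hc']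
      exact Nat.zero_le _
  · rintro ⟨w, p, a, f, hr, hp, hf⟩
    obtain ⟨done, sides, h, hk, hl⟩ := hr.exists_partial
    have hlen : (done ++ [w]).flatten.length = done.flatten.length + p + 1 := by simp; omega
    refine ⟨done ++ [w], sides, ⟨h.mem_dict, by rw [hlen, h.length_sides], h.linked, h.side_ne,
      h.side_eq, h.mem_side, ?_⟩, by simp [hk], ?_⟩
    · intro a' c' _
      refine (hf a' c').trans (le_of_eq ?_)
      rw [ncard_cover hlen, h.count, h.last, getElem?_flatten_snoc]
      simp only [Option.some.injEq, @eq_comm _ a a', @and_comm _ (a' = a)]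
    · rw [numLetters, hlen, List.length_append, List.length_singleton]
      omega

end LetterBoxed

/-! ## Walks as paths in the graph of the program -/

namespace LetterBoxed

open RAM RAM.Prog Tables

variable {S q : ℕ}

/-- A function of side and letter as a function of the number of the pair. -/
def flat (f : Fin S → Fin q → ℕ) (i : ℕ) : ℕ :=
  if h : i / q < S ∧ 0 < q then f ⟨i / q, h.1⟩ ⟨i % q, Nat.mod_lt _ h.2⟩ else 0

theorem flat_pair (f : Fin S → Fin q → ℕ) (a : Fin S) (c : Fin q) : flat f (a * q + c) = f a c := by
  have hq : 0 < q := Fin.pos c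
  have h1 : (a * q + c : ℕ) / q = a := by
    rw [Nat.mul_comm, Nat.mul_add_div hq, Nat.div_eq_of_lt c.2, Nat.add_zero]
  have h2 : (a * q + c : ℕ) % q = c := by
    rw [Nat.mul_comm, Nat.mul_add_mod, Nat.mod_eq_of_lt c.2]
  simp [flat, h1, h2, hq]

theorem flat_bump (f : Fin S → Fin q → ℕ) (a : Fin S) (c : Fin q) :
    flat (bump f a c) =
      Function.update (flat f) (a * q + c) (flat f (a * q + c) + 1) := by
  funext i
  by_cases hi : i = a * q + c
  · subst hi
    rw [Function.update_self, flat_pair, flat_pair, bump, if_pos ⟨rfl, rfl⟩]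
  · rw [Function.update_of_ne hi]
    unfold flat
    split_ifs with h
    · rw [bump, if_neg, Nat.add_zero]
      rintro ⟨e1, e2⟩
      refine hi ?_
      rw [← e1, ← e2]
      change i = i / q * q + i % q
      rw [Nat.mul_comm, Nat.div_add_mod]
    · rfl

/-- The numbers describe the puzzle, with the words of the dictionary in the order of `ws`. -/
structure Input.Represents (I : Input) (P : Puzzle S q) (ws : List (List (Fin q))) : Prop where
  S_eq : I.S = S
  q_eq : I.q = q
  D_eq : I.D = ws.length
  mem : ∀ w, w ∈ ws ↔ w ∈ P.dict
  len : ∀ i w, ws[i]? = some w → I.len i = w.length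
  word : ∀ i w, ws[i]? = some w → ∀ (j : ℕ) (c : Fin q), w[j]? = some c → I.word i j = c
  count : ∀ (a : Fin S) (c : Fin q), I.count a c = (P.side a).count c

/-- A letter of a side must be played at least once. This justifies answering no as soon as `ρbad`
is set. -/
theorem IsSolution.exists_word {P : Puzzle S q} {words : List (List (Fin q))} {sides : List (Fin S)}
    (h : IsSolution P words sides) {a : Fin S} {c : Fin q} (hc : c ∈ P.side a) :
    ∃ w ∈ P.dict, c ∈ w := by
  have h1 := (Multiset.count_pos.2 hc).trans_le (h.cover _ _ hc)
  obtain ⟨j, hj, -, -⟩ := Set.nonempty_of_ncard_ne_zero h1.ne'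
  obtain ⟨w, hw, hcw⟩ := List.mem_flatten.1 (List.mem_of_getElem? hj)
  exact ⟨w, h.mem_dict w hw, hcw⟩

namespace Input

variable {I : Input} {P : Puzzle S q} {ws : List (List (Fin q))} {L : Tables}

/-- The node of the graph for a state of the game. -/
def node (I : Input) (L : Tables) (i p : ℕ) (a : Fin S) (f : Fin S → Fin q → ℕ) : ℕ :=
  L.idx (I.start i + p) a (enc L.mult (capped L.mult (flat f)) (S * q))

theorem capped_le (m f : ℕ → ℕ) (N : ℕ) : ∀ i < N, capped m f i ≤ m i := fun _ _ => min_le_right _ _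

section

variable (hI : I.Represents P ws) (hL : I.Describes L)

include hI

theorem Represents.lt {i : ℕ} {w : List (Fin q)} (hw : ws[i]? = some w) : i < I.D := by
  rw [hI.D_eq]; exact (List.getElem?_eq_some_iff.1 hw).1

include hL

theorem Represents.letter {i p : ℕ} {w : List (Fin q)} {c : Fin q} (hw : ws[i]? = some w)
    (hc : w[p]? = some c) : L.letter (I.start i + p) = c := by
  rw [hL.letter i (hI.lt hw) p (by rw [hI.len i w hw]; exact (List.getElem?_eq_some_iff.1 hc).1),
    hI.word i w hw p c hc]

theorem Represents.rem {i p : ℕ} {w : List (Fin q)} (hw : ws[i]? = some w) (hp : p < w.length) :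
    L.rem (I.start i + p) = w.length - p := by
  rw [hL.rem i (hI.lt hw) p (by rwa [hI.len i w hw]), hI.len i w hw]

theorem Represents.pair {i p : ℕ} {w : List (Fin q)} {c : Fin q} (hw : ws[i]? = some w)
    (hc : w[p]? = some c) (a : ℕ) : L.pair (I.start i + p) a = a * q + c := by
  rw [Tables.pair, hI.letter hL hw hc, hL.q, hI.q_eq]

theorem Represents.mult (a : Fin S) (c : Fin q) : L.mult (a * q + c) = (P.side a).count c := by
  rw [← hI.count, ← hL.mult a (by rw [hI.S_eq]; exact a.2) c (by rw [hI.q_eq]; exact c.2), hI.q_eq]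

theorem Represents.isNode {i p : ℕ} {w : List (Fin q)} (hw : ws[i]? = some w) (hp : p < w.length)
    (a : Fin S) (f : Fin S → Fin q → ℕ) :
    L.IsNode (I.start i + p) a (enc L.mult (capped L.mult (flat f)) (S * q)) := by
  refine ⟨?_, ?_, ?_⟩
  · rw [hL.M]; exact I.start_add_lt (hI.lt hw) (by rwa [hI.len i w hw])
  · rw [hL.S, hI.S_eq]; exact a.2
  · rw [hL.V, hI.S_eq, hI.q_eq]; exact enc_lt (capped_le _ _ _)

theorem Represents.cap (f : Fin S → Fin q → ℕ) (a : Fin S) (c : Fin q) :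
    L.cap (enc L.mult (capped L.mult (flat f)) (S * q)) (a * q + c) =
      enc L.mult (capped L.mult (flat (bump f a c))) (S * q) := by
  have hu : ∀ i < S * q, L.unit i = unitOf L.mult i := by
    have := hL.unit
    rwa [hI.S_eq, hI.q_eq] at this
  have hp : (a * q + c : ℕ) < S * q := calc
    _ < (a + 1) * q := by rw [Nat.add_mul]; omega
    _ ≤ _ := Nat.mul_le_mul_right _ a.2
  rw [cap_enc hu _ hp, flat_bump]

theorem Represents.source {i : ℕ} {w : List (Fin q)} {c : Fin q} {a : Fin S} (hw : ws[i]? = some w)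
    (hc : w[0]? = some c) (ha : c ∈ P.side a) : L.Source (I.node L i 0 a (bump 0 a c)) := by
  have hp := hI.pair hL hw hc a
  have hs := hL.start i (hI.lt hw)
  refine ⟨i, a, by rw [hL.D]; exact hI.lt hw, by rw [hL.S, hI.S_eq]; exact a.2, ?_, ?_⟩
  · rw [hs]
    rw [Nat.add_zero] at hp
    rw [hp, hI.mult hL]
    exact Multiset.count_pos.2 ha
  · rw [hs]
    rw [Nat.add_zero] at hp
    rw [hp, node, ← hI.cap hL]
    congr 2
    -- Before the first letter all digits are zero, so the code is the 0 used in `Source`.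
    simp [enc, capped, flat]

theorem Represents.step {i p : ℕ} {w : List (Fin q)} {c : Fin q} {a b : Fin S}
    {f : Fin S → Fin q → ℕ} (hw : ws[i]? = some w)
    (hc : w[p + 1]? = some c) (hab : a ≠ b) (hb : c ∈ P.side b) :
    L.Step (I.node L i p a f) (I.node L i (p + 1) b (bump f b c)) := by
  have hlt := (List.getElem?_eq_some_iff.1 hc).1
  have hp := hI.pair hL hw hc b
  refine ⟨_, _, _, b, hI.isNode hL hw (by omega) a f, rfl, ?_, by rw [hL.S, hI.S_eq]; exact b.2, ?_, ?_, ?_⟩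
  · rw [hI.rem hL hw (by omega)]; omega
  · exact fun e => hab (Fin.ext e.symm)
  · rw [Nat.add_assoc, hp, hI.mult hL]
    exact Multiset.count_pos.2 hb
  · rw [Nat.add_assoc, hp, hI.cap hL]
    rfl

theorem Represents.switch {i p i' : ℕ} {w w' : List (Fin q)} {a : Fin S}
    {f : Fin S → Fin q → ℕ} (hw : ws[i]? = some w) (hp : p + 1 = w.length) (hw' : ws[i']? = some w')
    (hlink : w.getLast? = w'.head?) :
    L.Switch (I.node L i p a f) (I.node L i' 0 a f) := by
  have hc : w[p]? = some w[p] := List.getElem?_eq_getElem (by omega)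
  have hc' : w'[0]? = some w[p] := by
    rw [← List.head?_eq_getElem?, ← hlink, List.getLast?_eq_getElem?, ← hc]
    congr 1
    omega
  have hl := hI.letter hL hw' hc'
  rw [Nat.add_zero] at hl
  refine ⟨_, _, _, i', hI.isNode hL hw (by omega) a f, rfl, ?_, by rw [hL.D]; exact hI.lt hw', ?_, ?_⟩
  · rw [hI.rem hL hw (by omega)]; omega
  · rw [hL.start i' (hI.lt hw'), hl, hI.letter hL hw hc]
  · rw [hL.start i' (hI.lt hw')]
    rfl

theorem Represents.goal_iff {i p : ℕ} {w : List (Fin q)} {a : Fin S} {f : Fin S → Fin q → ℕ}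
    (hw : ws[i]? = some w) (hp : p < w.length) :
    L.Goal (I.node L i p a f) ↔ p + 1 = w.length ∧ ∀ a c, (P.side a).count c ≤ f a c := by
  have hr := hI.rem hL hw hp
  have hV : L.V = unitOf L.mult (S * q) := by rw [hL.V, hI.S_eq, hI.q_eq]
  have hcode : enc L.mult (capped L.mult (flat f)) (S * q) + 1 = L.V ↔
      ∀ a c, (P.side a).count c ≤ f a c := by
    rw [hV, enc_eq_iff (capped_le _ _ _)]
    constructor
    · intro h a c
      have := h (a * q + c) (by
        have := pair_lt (I := I) (by rw [hI.S_eq]; exact a.2) (by rw [hI.q_eq]; exact c.2)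
        rwa [hI.S_eq, hI.q_eq] at this)
      rw [← hI.mult hL, ← this, capped, flat_pair]
      exact min_le_left _ _
    · intro h j hj
      obtain ⟨a, ha, c, hc, e⟩ := exists_pair (I := I) (i := j) (by rwa [hI.S_eq, hI.q_eq])
      rw [hI.S_eq] at ha
      rw [hI.q_eq] at hc e
      obtain rfl : j = (⟨a, ha⟩ : Fin S) * q + (⟨c, hc⟩ : Fin q) := e
      rw [capped, flat_pair, hI.mult hL]
      exact min_eq_right (h _ _)
  constructor
  · rintro ⟨g, b, v, hn, he, hg, hv⟩
    obtain ⟨rfl, -, rfl⟩ := L.idx_inj (hI.isNode hL hw hp a f) hn he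
    exact ⟨by omega, hcode.1 hv⟩
  · rintro ⟨h1, h2⟩
    exact ⟨_, _, _, hI.isNode hL hw hp a f, rfl, by omega, hcode.2 h2⟩

/-- The cost of the walk is read off the play: the source accounts for the first letter and the
first word, and of the two kinds of moves the one that is paid raises the corresponding counter. -/
theorem Represents.cost_of_reach {κ k l p : ℕ} {w : List (Fin q)} {a : Fin S}
    {f : Fin S → Fin q → ℕ} (h : Reach P k l w p a f) : ∀ i, ws[i]? = some w →
      Cost L.Source (L.Free κ) (L.Paid κ) (if κ = 0 then l else k) (I.node L i p a f) := by
  induction h with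
  | start hw hc ha =>
    intro i hi
    rw [ite_self]
    exact .source (hI.source hL hi hc ha)
  | step _ hc hab hb ih =>
    intro i hi
    have h := ih i hi
    have hs := fun f => hI.step hL (f := f) hi hc hab hb
    by_cases hκ : κ = 0
    · rw [if_pos hκ] at h ⊢
      exact h.paid (.inl ⟨hκ, hs _⟩)
    · rw [if_neg hκ] at h ⊢
      exact h.free (.inl ⟨hκ, hs _⟩)
  | @switch k l w p a f w' hr hp hw' hlink ih =>
    intro i' hi'
    have hw : w ∈ ws := by
      rw [hI.mem]
      obtain ⟨_, _, h, _⟩ := hr.exists_partial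
      exact h.mem_dict _ (by simp)
    obtain ⟨i, hi⟩ := List.mem_iff_getElem?.1 hw
    have h := ih i hi
    have hs := hI.switch hL (a := a) (f := f) hi hp hi' hlink
    by_cases hκ : κ = 0
    · rw [if_pos hκ] at h ⊢
      exact h.free (.inr ⟨hκ, hs⟩)
    · rw [if_neg hκ] at h ⊢
      exact h.paid (.inr ⟨hκ, hs⟩)

/-- A node determines only the capped counts, but the walk is lifted edge by edge together with some
true counts `f`, and the moves available do not depend on which counts were lifted. -/
theorem Represents.reach_of_cost {κ d x : ℕ}
    (h : Cost L.Source (L.Free κ) (L.Paid κ) d x) : ∃ k l w p a f i, ws[i]? = some w ∧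
      Reach P k l w p a f ∧ x = I.node L i p a f ∧ d = if κ = 0 then l else k := by
  have hget : ∀ i < L.D, ∃ w, ws[i]? = some w ∧ w ∈ P.dict ∧ ∃ c, w[0]? = some c := by
    intro i hi
    rw [hL.D, hI.D_eq] at hi
    have hd : ws[i] ∈ P.dict := (hI.mem _).1 (List.getElem_mem hi)
    exact ⟨_, List.getElem?_eq_getElem hi, hd, _,
      List.getElem?_eq_getElem (List.length_pos_of_ne_nil (P.word_ne_nil _ hd))⟩
  have hlt : ∀ {k l w p a f}, Reach P k l w p a f → p < w.length := fun hr => by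
    obtain ⟨_, _, h, _⟩ := hr.exists_partial
    exact h.lt
  have hstep : ∀ {k l w p a f i y}, ws[i]? = some w → Reach P k l w p a f →
      L.Step (I.node L i p a f) y → ∃ p' b f', Reach P k (l + 1) w p' b f' ∧
        y = I.node L i p' b f' := by
    rintro k l w p a f i y hw hr ⟨g, a', v, b, hn, he, hrem, hb, hne, hm, rfl⟩
    obtain ⟨rfl, rfl, rfl⟩ := L.idx_inj (hI.isNode hL hw (hlt hr) a f) hn he
    rw [hI.rem hL hw (hlt hr)] at hrem
    have hc : w[p + 1]? = some w[p + 1] := List.getElem?_eq_getElem (by omega)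
    rw [hL.S, hI.S_eq] at hb
    have hp := hI.pair hL hw hc b
    rw [Nat.add_assoc, hp] at hm ⊢
    have hm' := hI.mult hL ⟨b, hb⟩ w[p + 1]
    rw [Fin.val_mk] at hm'
    rw [hm', Multiset.count_pos] at hm
    refine ⟨_, _, _, hr.step hc (b := ⟨b, hb⟩) (fun e => hne (by rw [e])) hm, ?_⟩
    rw [node, ← hI.cap hL]
  have hswitch : ∀ {k l w p a f i y}, ws[i]? = some w → Reach P k l w p a f →
      L.Switch (I.node L i p a f) y → ∃ w' i', ws[i']? = some w' ∧ Reach P (k + 1) l w' 0 a f ∧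
        y = I.node L i' 0 a f := by
    rintro k l w p a f i y hw hr ⟨g, a', v, i', hn, he, hrem, hi', hl, rfl⟩
    obtain ⟨rfl, rfl, rfl⟩ := L.idx_inj (hI.isNode hL hw (hlt hr) a f) hn he
    rw [hI.rem hL hw (hlt hr)] at hrem
    have := hlt hr
    obtain ⟨w', hw', hd, c, hc⟩ := hget i' hi'
    have hs := hL.start i' (hI.lt hw')
    have hl' := hI.letter hL hw' hc
    have hc2 : w[p]? = some w[p] := List.getElem?_eq_getElem this
    rw [Nat.add_zero] at hl'
    rw [hs, hl', hI.letter hL hw hc2] at hl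
    refine ⟨w', i', hw', hr.switch (by omega) hd ?_, by rw [hs]; rfl⟩
    rw [List.head?_eq_getElem?, List.getLast?_eq_getElem?, show w.length - 1 = p by omega, hc2, hc,
      Fin.ext hl]
  induction h with
  | source hs =>
    obtain ⟨i, a, hi, ha, hm, rfl⟩ := hs
    obtain ⟨w, hw, hd, c, hc⟩ := hget i hi
    rw [hL.S, hI.S_eq] at ha
    have hp := hI.pair hL hw hc a
    rw [hL.start i (hI.lt hw)]
    rw [hL.start i (hI.lt hw)] at hm
    rw [Nat.add_zero] at hp
    rw [hp] at hm ⊢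
    have hm' := hI.mult hL ⟨a, ha⟩ c
    rw [Fin.val_mk] at hm'
    rw [hm', Multiset.count_pos] at hm
    refine ⟨_, _, _, _, _, _, i, hw, .start hd hc hm, ?_, (ite_self _).symm⟩
    rw [node, ← hI.cap hL]
    simp [enc, capped, flat]
  | free _ hF ih =>
    obtain ⟨k, l, w, p, a, f, i, hw, hr, rfl, rfl⟩ := ih
    rcases hF with ⟨hκ, h⟩ | ⟨hκ, h⟩
    · obtain ⟨p', b, f', hr', rfl⟩ := hstep hw hr h
      exact ⟨_, _, _, _, _, _, _, hw, hr', rfl, by simp [hκ]⟩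
    · obtain ⟨w', i', hw', hr', rfl⟩ := hswitch hw hr h
      exact ⟨_, _, _, _, _, _, _, hw', hr', rfl, by simp [hκ]⟩
  | paid _ hF ih =>
    obtain ⟨k, l, w, p, a, f, i, hw, hr, rfl, rfl⟩ := ih
    rcases hF with ⟨hκ, h⟩ | ⟨hκ, h⟩
    · obtain ⟨p', b, f', hr', rfl⟩ := hstep hw hr h
      exact ⟨_, _, _, _, _, _, _, hw, hr', rfl, by simp [hκ]⟩
    · obtain ⟨w', i', hw', hr', rfl⟩ := hswitch hw hr h
      exact ⟨_, _, _, _, _, _, _, hw', hr', rfl, by simp [hκ]⟩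

theorem Represents.exists_goal_iff (hS : 0 < S) (κ d : ℕ) :
    (∃ x, L.Goal x ∧ Cost L.Source (L.Free κ) (L.Paid κ) d x) ↔
    ∃ words sides, IsSolution P words sides ∧
      (if κ = 0 then numLetters words else words.length) = d := by
  constructor
  · rintro ⟨x, hg, hc⟩
    obtain ⟨k, l, w, p, a, f, i, hw, hr, rfl, rfl⟩ := hI.reach_of_cost hL hc
    obtain ⟨_, _, hpt, _⟩ := hr.exists_partial
    obtain ⟨h1, h2⟩ := (hI.goal_iff hL hw hpt.lt).1 hg
    obtain ⟨words, sides, hs, rfl, rfl⟩ := (isSolution_iff_reach hS k l).2 ⟨w, p, a, f, hr, h1, h2⟩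
    exact ⟨words, sides, hs, rfl⟩
  · rintro ⟨words, sides, hs, rfl⟩
    obtain ⟨w, p, a, f, hr, h1, h2⟩ := (isSolution_iff_reach hS _ _).1 ⟨words, sides, hs, rfl, rfl⟩
    obtain ⟨_, _, hpt, _⟩ := hr.exists_partial
    obtain ⟨i, hi⟩ := List.mem_iff_getElem?.1 ((hI.mem w).2 (hpt.mem_dict _ (by simp)))
    exact ⟨_, (hI.goal_iff hL hi hpt.lt).2 ⟨h1, h2⟩, hI.cost_of_reach hL hr i hi⟩

theorem Represents.result (hS : 0 < S) {s : State} (h : Result L s) :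
    (s.reg 0 = 1 ∧ IsLeast P.wordCounts (s.reg 1) ∧ IsLeast P.letterCounts (s.reg 2)) ∨
      (s.reg 0 = 0 ∧ ¬ ∃ words sides, IsSolution P words sides) := by
  have h1 : {d | ∃ x, L.Goal x ∧ Cost L.Source (L.Free 1) (L.Paid 1) d x} = P.wordCounts := by
    ext d
    rw [Set.mem_ofPred_eq, hI.exists_goal_iff hL hS]
    simp [Puzzle.wordCounts]
  have h0 : {d | ∃ x, L.Goal x ∧ Cost L.Source (L.Free 0) (L.Paid 0) d x} = P.letterCounts := by
    ext d
    rw [Set.mem_ofPred_eq, hI.exists_goal_iff hL hS]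
    simp [Puzzle.letterCounts]
  rcases h with ⟨h, hw, hl⟩ | ⟨h, hn⟩
  · rw [h1] at hw
    rw [h0] at hl
    exact .inl ⟨h, hw, hl⟩
  · refine .inr ⟨h, ?_⟩
    rintro ⟨words, sides, hs⟩
    obtain ⟨x, hg, hc⟩ := (hI.exists_goal_iff hL hS 1 _).2 ⟨words, sides, hs, rfl⟩
    exact hn _ _ hc hg

omit hL

theorem Represents.allOccur_iff :
    I.AllOccur ↔ ∀ a, ∀ c ∈ P.side a, ∃ w ∈ P.dict, c ∈ w := by
  constructor
  · intro h a c hc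
    rw [← Multiset.count_pos, ← hI.count] at hc
    obtain ⟨i, hi, j, hj, e⟩ := h a (by rw [hI.S_eq]; exact a.2) c (by rw [hI.q_eq]; exact c.2) hc
    rw [hI.D_eq] at hi
    have hw : ws[i]? = some ws[i] := List.getElem?_eq_getElem hi
    rw [hI.len i _ hw] at hj
    rw [hI.word i _ hw j _ (List.getElem?_eq_getElem hj)] at e
    exact ⟨_, (hI.mem _).1 (List.getElem_mem hi), by rw [← Fin.ext e]; exact List.getElem_mem hj⟩
  · intro h a ha c hc hpos
    rw [hI.S_eq] at ha
    rw [hI.q_eq] at hc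
    have e := hI.count ⟨a, ha⟩ ⟨c, hc⟩
    rw [Fin.val_mk, Fin.val_mk] at e
    rw [e, Multiset.count_pos] at hpos
    obtain ⟨w, hw, hcw⟩ := h _ _ hpos
    obtain ⟨i, hi⟩ := List.mem_iff_getElem?.1 ((hI.mem w).2 hw)
    obtain ⟨p, hp⟩ := List.mem_iff_getElem?.1 hcw
    exact ⟨i, hI.lt hi, p, by rw [hI.len i w hi]; exact (List.getElem?_eq_some_iff.1 hp).1,
      hI.word i w hi p _ hp⟩

end

end Input

end LetterBoxed

/-! ## The representation of a puzzle -/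

namespace LetterBoxed

open RAM RAM.Prog Tables

variable {S q : ℕ}

theorem count_getElem? {α : Type*} [DecidableEq α] (l : List α) (c : α) :
    Nat.count (fun j => l[j]? = some c) l.length = l.count c := by
  induction l with
  | nil => simp
  | cons x l ih => simp [Nat.count_succ', List.count_cons, ih]

/-- The numbers in a representation of a puzzle. -/
def Input.ofLists (n : ℕ) (gs : Fin S → List (Fin q)) (ws : List (List (Fin q))) : Input where
  S := S
  q := q
  n := n
  D := ws.length
  side a j := ((List.ofFn gs)[a]?.bind fun g => g[j]?).elim 0 Fin.val
  len i := ws[i]?.elim 0 List.length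
  word i j := (ws[i]?.bind fun w => w[j]?).elim 0 Fin.val

namespace Input

variable {n : ℕ} {gs : Fin S → List (Fin q)} {ws : List (List (Fin q))}

theorem ofLists_side {a : Fin S} {j : ℕ} {c : Fin q} (h : (gs a)[j]? = some c) :
    (ofLists n gs ws).side a j = c := by
  simp [ofLists, h]

theorem ofLists_len {i : ℕ} {w : List (Fin q)} (h : ws[i]? = some w) :
    (ofLists n gs ws).len i = w.length := by
  simp [ofLists, h]

theorem ofLists_word {i j : ℕ} {w : List (Fin q)} {c : Fin q} (h : ws[i]? = some w)
    (hc : w[j]? = some c) : (ofLists n gs ws).word i j = c := by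
  simp [ofLists, h, hc]

/-- The additional `i` accounts for the length cells that precede the words. -/
theorem ofLists_start {i : ℕ} (hi : i ≤ ws.length) :
    (ofLists n gs ws).start i + i =
      prefixLen (ws.map fun w => w.length :: w.map Fin.val) i := by
  induction i with
  | zero => simp [start, prefixLen]
  | succ i ih =>
    have hw : ws[i]? = some ws[i] := List.getElem?_eq_getElem hi
    rw [prefixLen_succ (w := ws[i].length :: ws[i].map Fin.val) (by simp [hw]), ← ih (by omega),
      start_succ, ofLists_len hw, List.length_cons, List.length_map]
    omega

theorem prefixLen_ofFn (hgs : ∀ a, (gs a).length = n) {a : ℕ} (ha : a ≤ S) :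
    prefixLen (List.ofFn gs) a = a * n := by
  induction a with
  | zero => simp [prefixLen]
  | succ a ih =>
    rw [prefixLen_succ (w := gs ⟨a, ha⟩) (by simp [Nat.lt_of_succ_le ha]), ih (by omega), hgs,
      Nat.succ_mul]

theorem ofLists_valid (hgs : ∀ a, (gs a).length = n) (hws : ∀ w ∈ ws, w ≠ []) :
    (ofLists n gs ws).Valid where
  side_lt a ha j hj := by
    have : (gs ⟨a, ha⟩)[j]? = some _ := List.getElem?_eq_getElem (by rw [hgs]; exact hj)
    have h := ofLists_side (n := n) (ws := ws) this
    exact h.trans_lt (Fin.is_lt _)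
  word_lt i hi j hj := by
    have hw : ws[i]? = some ws[i] := List.getElem?_eq_getElem hi
    rw [ofLists_len hw] at hj
    rw [ofLists_word hw (List.getElem?_eq_getElem hj)]
    exact Fin.is_lt _
  len_pos i hi := by
    have hw : ws[i]? = some ws[i] := List.getElem?_eq_getElem hi
    rw [ofLists_len hw]
    exact List.length_pos_of_ne_nil (hws _ (List.getElem_mem hi))

theorem ofLists_represents {P : Puzzle S q} (hmem : ∀ w, w ∈ ws ↔ w ∈ P.dict)
    (hgs : ∀ a, (gs a : Multiset (Fin q)) = P.side a) : (ofLists P.n gs ws).Represents P ws where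
  S_eq := rfl
  q_eq := rfl
  D_eq := rfl
  mem := hmem
  len _ _ := ofLists_len
  word _ _ h _ _ := ofLists_word h
  count a c := by
    have hlen : (gs a).length = P.n := by rw [← P.card_side a, ← hgs, Multiset.coe_card]
    rw [← hgs, Multiset.coe_count, ← count_getElem?, hlen, count, Nat.count_eq_card_filter_range,
      Nat.count_eq_card_filter_range]
    congr 1
    refine Finset.filter_congr fun j hj => ?_
    have hj' : j < (gs a).length := by rw [hlen]; exact Finset.mem_range.1 hj
    have h := List.getElem?_eq_getElem hj'
    rw [ofLists_side h, h, Option.some.injEq, Fin.val_inj]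

theorem ofLists_holds (hgs : ∀ a, (gs a).length = n) (tail : List ℕ) :
    (ofLists n gs ws).Holds fun i => ([S, q, n, ws.length] ++ (List.ofFn gs).flatten.map Fin.val ++
      ws.flatMap (fun w => w.length :: w.map Fin.val) ++ tail).getD i 0 := by
  have hlen : (List.ofFn gs).flatten.length = S * n := by
    rw [← prefixLen_ofFn hgs le_rfl, ← prefixLen_length, List.length_ofFn]
  have hhead : ([S, q, n, ws.length] ++ (List.ofFn gs).flatten.map Fin.val).length = 4 + S * n := by
    rw [List.length_append, List.length_map, hlen]
    rfl
  -- Cell `t` of the block of word `i`: for `t = 0` it is the length, for `t = j + 1` the letter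
  -- `j`.
  have hword : ∀ i w t v, ws[i]? = some w → (w.length :: w.map Fin.val)[t]? = some v →
      ([S, q, n, ws.length] ++ (List.ofFn gs).flatten.map Fin.val ++
      ws.flatMap (fun w => w.length :: w.map Fin.val) ++ tail).getD
        (4 + S * n + (ofLists n gs ws).start i + i + t) 0 = v := by
    intro i w t v hw hv
    have hi := (List.getElem?_eq_some_iff.1 hw).1
    have h := getElem?_flatten (words := ws.map fun w => w.length :: w.map Fin.val) (i := i)
      (w := w.length :: w.map Fin.val) (by simp [hw]) (List.getElem?_eq_some_iff.1 hv).1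
    rw [hv, ← ofLists_start (n := n) (gs := gs) hi.le, ← List.flatMap_def] at h
    have h' := (List.getElem?_eq_some_iff.1 h).1
    rw [List.getD_eq_getElem?_getD, List.append_assoc, List.getElem?_append_right (by omega), hhead,
      show 4 + S * n + (ofLists n gs ws).start i + i + t - (4 + S * n) =
      (ofLists n gs ws).start i + i + t by omega, List.getElem?_append_left h', h]
    rfl
  refine ⟨rfl, rfl, rfl, rfl, ?_, ?_, ?_⟩
  · intro a ha j hj
    have hj' : j < (gs ⟨a, ha⟩).length := by rw [hgs]; exact hj
    have hc := List.getElem?_eq_getElem hj'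
    have h := getElem?_flatten (words := List.ofFn gs) (i := a) (w := gs ⟨a, ha⟩)
      (by simp [show a < S from ha]) hj'
    rw [hc, prefixLen_ofFn hgs (le_of_lt ha)] at h
    have h' := (List.getElem?_eq_some_iff.1 h).1
    refine Eq.trans ?_ (ofLists_side (n := n) (ws := ws) hc).symm
    change List.getD _ (4 + a * n + j) 0 = _
    rw [List.getD_eq_getElem?_getD, List.append_assoc, List.append_assoc,
      List.getElem?_append_right (by rw [Nat.add_assoc]; exact Nat.le_add_right 4 _),
      List.getElem?_append_left (by rw [List.length_map]; change 4 + a * n + j - 4 < _; omega),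
      show 4 + a * n + j - [S, q, n, ws.length].length = a * n + j from by
        change 4 + a * n + j - 4 = _; omega, List.getElem?_map, h]
    rfl
  · intro i hi
    have hw : ws[i]? = some ws[i] := List.getElem?_eq_getElem hi
    rw [ofLists_len hw]
    exact hword i _ 0 _ hw rfl
  · intro i hi j hj
    have hw : ws[i]? = some ws[i] := List.getElem?_eq_getElem hi
    rw [ofLists_len hw] at hj
    rw [ofLists_word hw (List.getElem?_eq_getElem hj)]
    change List.getD _ (4 + S * n + _ + _ + _ + _) 0 = _
    rw [Nat.add_assoc _ 1 j, Nat.add_comm 1 j]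
    refine hword i _ (j + 1) _ hw ?_
    simp [hj]

theorem ofLists_tail (hgs : ∀ a, (gs a).length = n) (tail : List ℕ) :
    ([S, q, n, ws.length] ++ (List.ofFn gs).flatten.map Fin.val ++
      ws.flatMap (fun w => w.length :: w.map Fin.val) ++ tail).getD
      (4 + S * n + (ofLists n gs ws).start ws.length + ws.length) 0 = tail.getD 0 0 := by
  have hlen : (List.ofFn gs).flatten.length = S * n := by
    rw [← prefixLen_ofFn hgs le_rfl, ← prefixLen_length, List.length_ofFn]
  have h : (ws.flatMap fun w => w.length :: w.map Fin.val).length =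
      (ofLists n gs ws).start ws.length + ws.length := by
    rw [ofLists_start le_rfl, List.flatMap_def, ← prefixLen_length, List.length_map]
  rw [List.getD_eq_getElem?_getD, List.getD_eq_getElem?_getD, List.getElem?_append_right]
  · congr 2
    rw [List.length_append, h, List.length_append, List.length_map, hlen]
    simp
    omega
  · rw [List.length_append, h, List.length_append, List.length_map, hlen]
    simp
    omega

end Input

end LetterBoxed

/-! ## Running times -/

namespace LetterBoxed

open RAM RAM.Prog Tables

variable {S q : ℕ}

namespace Puzzle

/-- Every letter of a side occurs in the dictionary. -/
def Playable (P : Puzzle S q) : Prop := ∀ a, ∀ c ∈ P.side a, ∃ w ∈ P.dict, c ∈ w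

/-- The number of vectors of capped letter counts. -/
def numCodes (P : Puzzle S q) : ℕ := ∏ a, ∏ c, ((P.side a).count c + 1)

theorem pos_of_sides (P : Puzzle S q) (hS : 0 < S) : 0 < q := by
  obtain ⟨c, -⟩ := Multiset.card_pos_iff_exists_mem.1
    (show 0 < (P.side ⟨0, hS⟩).card by rw [P.card_side]; exact P.n_pos)
  exact Fin.pos c

theorem length_le_maxLen (P : Puzzle S q) {w : List (Fin q)} (hw : w ∈ P.dict) :
    w.length ≤ P.maxLen := Finset.le_sup (f := List.length) hw

theorem maxLen_pos (P : Puzzle S q) (h : P.dict.Nonempty) : 0 < P.maxLen := by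
  obtain ⟨w, hw⟩ := h
  exact (List.length_pos_of_ne_nil (P.word_ne_nil w hw)).trans_le (P.length_le_maxLen hw)

theorem numCodes_le (P : Puzzle S q) : P.numCodes ≤ (P.n + 1) ^ (S * q) := by
  calc P.numCodes ≤ ∏ _a : Fin S, ∏ _c : Fin q, (P.n + 1) := by
        refine Finset.prod_le_prod' fun a _ => Finset.prod_le_prod' fun c _ => ?_
        rw [← P.card_side a]
        exact Nat.succ_le_succ (Multiset.count_le_card _ _)
    _ = _ := by
        simp only [Finset.prod_const, Finset.card_univ, Fintype.card_fin]
        rw [← pow_mul, Nat.mul_comm]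

/-- Uses m + 1 ≤ 2^m, and that the multiplicities on a side add up to `n`. -/
theorem numCodes_le_two_pow (P : Puzzle S q) : P.numCodes ≤ 2 ^ (S * P.n) := by
  calc P.numCodes ≤ ∏ _a : Fin S, 2 ^ P.n := by
        refine Finset.prod_le_prod' fun a _ => ?_
        calc ∏ c, ((P.side a).count c + 1) ≤ ∏ c, 2 ^ (P.side a).count c :=
              Finset.prod_le_prod' fun c _ => Nat.succ_le_of_lt Nat.lt_two_pow_self
          _ = _ := by
              rw [Finset.prod_pow_eq_pow_sum, ← P.card_side a,
                Multiset.sum_count_eq_card fun c _ => Finset.mem_univ c]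
    _ = _ := by
        rw [Finset.prod_const, Finset.card_univ, Fintype.card_fin, ← pow_mul, Nat.mul_comm]

/-- Letters outside the dictionary have multiplicity 0 and contribute factors 1, and at most `c * d`
letters occur in the dictionary. So the size of the alphabet does not matter. -/
theorem Playable.numCodes_le {P : Puzzle S q} (h : P.Playable) {c d : ℕ} (hc : P.dict.card ≤ c)
    (hd : P.maxLen ≤ d) : P.numCodes ≤ (P.n + 1) ^ (S * (c * d)) := by
  let T := P.dict.biUnion List.toFinset
  have hT : T.card ≤ c * d := calc
    T.card ≤ P.dict.card * d := Finset.card_biUnion_le_card_mul _ _ _ fun w hw =>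
      (List.toFinset_card_le w).trans ((P.length_le_maxLen hw).trans hd)
    _ ≤ _ := Nat.mul_le_mul_right _ hc
  calc P.numCodes ≤ ∏ _a : Fin S, (P.n + 1) ^ (c * d) := by
        refine Finset.prod_le_prod' fun a _ => ?_
        calc ∏ c, ((P.side a).count c + 1) = ∏ c ∈ T, ((P.side a).count c + 1) := by
              refine (Finset.prod_subset (Finset.subset_univ T) fun c _ hcT => ?_).symm
              have : c ∉ P.side a := fun hca => by
                obtain ⟨w, hw, hcw⟩ := h a c hca
                exact hcT (Finset.mem_biUnion.2 ⟨w, hw, List.mem_toFinset.2 hcw⟩)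
              rw [Multiset.count_eq_zero_of_notMem this, Nat.zero_add]
          _ ≤ (P.n + 1) ^ T.card := Finset.prod_le_pow_card _ _ _ fun c _ => by
              rw [← P.card_side a]
              exact Nat.succ_le_succ (Multiset.count_le_card _ _)
          _ ≤ _ := Nat.pow_le_pow_right (Nat.succ_pos _) hT
    _ = _ := by
        rw [Finset.prod_const, Finset.card_univ, Fintype.card_fin, ← pow_mul, Nat.mul_comm]

theorem card_dict_le_size (P : Puzzle S q) : P.dict.card ≤ P.size := by
  have : P.dict.card ≤ ∑ w ∈ P.dict, w.length := by
    rw [Finset.card_eq_sum_ones]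
    exact Finset.sum_le_sum fun w hw => List.length_pos_of_ne_nil (P.word_ne_nil w hw)
  unfold size
  omega

theorem maxLen_le_size (P : Puzzle S q) : P.maxLen ≤ P.size := by
  have : P.maxLen ≤ ∑ w ∈ P.dict, w.length := Finset.sup_le fun w hw =>
    Finset.single_le_sum (f := List.length) (fun _ _ => Nat.zero_le _) hw
  unfold size
  omega

end Puzzle

/-! ### Correctness and running time for puzzles, and the decision problem -/

/-- The plays that cover one side sit at distinct positions of the concatenation, whose length is at
most the number of words times the longest word. -/
theorem IsSolution.n_le {P : Puzzle S q} {words : List (List (Fin q))} {sides : List (Fin S)}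
    (h : IsSolution P words sides) (hS : 0 < S) : P.n ≤ words.length * P.maxLen := by
  have hle : P.side ⟨0, hS⟩ ≤ (words.flatten : Multiset (Fin q)) := by
    rw [Multiset.le_iff_count]
    intro c
    by_cases hc : c ∈ P.side ⟨0, hS⟩
    · refine (h.cover _ c hc).trans ?_
      rw [Multiset.coe_count, ← count_getElem?, Nat.count_eq_card_filter_range,
        ← Set.ncard_coe_finset]
      refine Set.ncard_le_ncard ?_ (Finset.finite_toSet _)
      intro j hj
      exact Finset.mem_coe.2 (Finset.mem_filter.2
        ⟨Finset.mem_range.2 (List.getElem?_eq_some_iff.1 hj.1).1, hj.1⟩)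
    · rw [Multiset.count_eq_zero_of_notMem hc]
      exact Nat.zero_le _
  have h1 := Multiset.card_le_card hle
  rw [P.card_side, Multiset.coe_card, List.length_flatten] at h1
  refine h1.trans ?_
  have := List.sum_le_card_nsmul (words.map List.length) P.maxLen (by
    intro m hm
    obtain ⟨w, hw, rfl⟩ := List.mem_map.1 hm
    exact P.length_le_maxLen (h.mem_dict w hw))
  simpa using this

/-- The answer of the algorithm. -/
def Answers (P : Puzzle S q) (s : State) : Prop :=
  (s.reg 0 = 1 ∧ IsLeast P.wordCounts (s.reg 1) ∧ IsLeast P.letterCounts (s.reg 2)) ∨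
    (s.reg 0 = 0 ∧ ¬ ∃ words sides, IsSolution P words sides)

/-- A bound for the number of codes is needed only for playable puzzles: for the others `core` stops
after reading. The list `tail` allows further input after the puzzle, whose first entry is left in
`ρK`. -/
theorem core_answers {P : Puzzle S q} (hS : 0 < S) (hD : P.dict.Nonempty) {x tail : List ℕ}
    (hx : P.Encodes x) {s : State} (hs : s.arr αIn = fun i => (x ++ tail).getD i 0)
    (hnA : s.reg ρnA = 0) (hz : ∀ b, b ≠ αIn → s.arr b = 0) {V : ℕ}
    (hV : P.Playable → P.numCodes ≤ V) :
    Within core s (200 * (S * q * P.n + P.dict.card * (P.maxLen + 1)) +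
      1000 * (S ^ 2 * V * P.dict.card ^ 2 * P.maxLen)) fun s' =>
        s'.reg ρK = tail.getD 0 0 ∧ Answers P s' := by
  obtain ⟨ws, gs, hnd, hdict, hgs, rfl⟩ := hx
  have hmem : ∀ w, w ∈ ws ↔ w ∈ P.dict := fun w => by rw [← hdict, List.mem_toFinset]
  have hcard : ws.length = P.dict.card := by rw [← hdict, List.toFinset_card_of_nodup hnd]
  have hlen : ∀ a, (gs a).length = P.n := fun a => by
    rw [← P.card_side a, ← hgs, Multiset.coe_card]
  let I := Input.ofLists P.n gs ws
  have hI : I.Represents P ws := Input.ofLists_represents hmem hgs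
  have hw : ∀ i < I.D, I.len i ≤ P.maxLen := by
    intro i hi
    have hw : ws[i]? = some ws[i] := List.getElem?_eq_getElem hi
    rw [hI.len i _ hw]
    exact P.length_le_maxLen ((hmem _).1 (List.getElem_mem hi))
  have hv : I.Valid := Input.ofLists_valid hlen fun w hw => P.word_ne_nil w ((hmem w).1 hw)
  have hcodes : ∏ a ∈ Finset.range I.S, ∏ c ∈ Finset.range I.q, (I.count a c + 1) = P.numCodes := by
    rw [hI.S_eq, hI.q_eq, Finset.prod_range, Puzzle.numCodes]
    refine Finset.prod_congr rfl fun a _ => ?_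
    rw [Finset.prod_range]
    exact Finset.prod_congr rfl fun c _ => by rw [hI.count]
  refine Within.mono (Input.core_spec (I := I) (by rw [hs]; exact Input.ofLists_holds hlen tail) hv
    hnA hz hw (P.maxLen_pos hD) hS (P.pos_of_sides hS) P.n_pos
    (by rw [hI.D_eq, hcard]; exact hD.card_pos)) ?_ ?_
  · rw [hcodes, hI.D_eq, hcard]
    refine Nat.add_le_add_left ?_ _
    split_ifs with h
    · exact Nat.mul_le_mul_left _ (Nat.mul_le_mul_right _ (Nat.mul_le_mul_right _
        (Nat.mul_le_mul_left _ (hV (hI.allOccur_iff.1 h)))))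
    · exact Nat.zero_le _
  · rintro s' - ⟨hK, h⟩
    rw [hs] at hK
    refine ⟨hK.trans (Input.ofLists_tail hlen tail), ?_⟩
    rcases h with ⟨-, L, hL, hres⟩ | ⟨hA, h0⟩
    · exact hI.result hL hS hres
    · refine .inr ⟨h0, ?_⟩
      rintro ⟨words, sides, hsol⟩
      exact hA (hI.allOccur_iff.2 fun a c hc => hsol.exists_word hc)

/-- The time for reading is absorbed by the time for searching. Only the term S·q·n is not obvious;
for it q·n ≤ (n+1)^q. -/
theorem core_time (S q n D Λ : ℕ) (hS : 0 < S) (hD : 0 < D) (hΛ : 0 < Λ) :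
    200 * (S * q * n + D * (Λ + 1)) + 1000 * (S ^ 2 * (n + 1) ^ (S * q) * D ^ 2 * Λ) ≤
      1600 * (S ^ 2 * (n + 1) ^ (S * q) * D ^ 2 * Λ) := by
  obtain ⟨W, hW⟩ : ∃ W, W = (n + 1) ^ (S * q) := ⟨_, rfl⟩
  rw [← hW]
  have h1 : q * n ≤ W := calc
    q * n ≤ (n + 1) ^ q := by
      -- Bernoulli's inequality, 1 + q·n ≤ (1 + n)^q.
      have := one_add_mul_le_pow_of_sq_nonneg (R := ℕ) (a := n) (Nat.zero_le _) (Nat.zero_le _)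
        (Nat.zero_le _) q
      rw [Nat.add_comm 1 n, Nat.cast_id] at this
      omega
    _ ≤ W := by
      rw [hW]
      exact Nat.pow_le_pow_right (Nat.succ_pos _) (Nat.le_mul_of_pos_left _ hS)
  have hW0 : 0 < W := by rw [hW]; positivity
  have h2 : S * q * n ≤ S ^ 2 * W * D ^ 2 * Λ := calc
    S * q * n = S * 1 * (q * n) * 1 * 1 := by ring
    _ ≤ S * S * W * D ^ 2 * Λ := by
      gcongr
      · exact hS
      · exact Nat.pow_pos hD
      · exact hΛ
    _ = _ := by ring
  have h3 : D * (Λ + 1) ≤ 2 * (S ^ 2 * W * D ^ 2 * Λ) := calc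
    D * (Λ + 1) ≤ D * (Λ + Λ) := by gcongr; exact hΛ
    _ = 2 * (1 * 1 * (D * 1) * Λ) := by ring
    _ ≤ 2 * (S ^ 2 * W * (D * D) * Λ) := by
      gcongr
      · exact Nat.pow_pos hS
      · exact hW0
      · exact hD
    _ = _ := by ring
  omega

/-- Decides whether there is a solution with at most `k` words. -/
def decideWords : Prog :=
  const ρOne 1 ;; const ρp 3 ;; load ρD αIn ρp ;;
  ifLt ρD ρOne (const 0 0) (core ;; ifLt ρK 1 (const 0 0) skip)

/-- The same, with the answer no if the sides have more than `m` letters. -/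
def decideFewLetters (m : ℕ) : Prog :=
  const ρp 2 ;; load ρn αIn ρp ;; const ρK m ;; ifLt ρK ρn (const 0 0) decideWords

theorem decideWords_spec {P : Puzzle 4 q} {k : ℕ} {x : List ℕ} (hx : P.Encodes x) {s : State}
    (hs : s.arr αIn = fun i => (x ++ [k]).getD i 0)
    (hnA : s.reg ρnA = 0) (hz : ∀ b, b ≠ αIn → s.arr b = 0) {V : ℕ}
    (hV : P.Playable → P.numCodes ≤ V) :
    Within decideWords s (200 * (4 * q * P.n + P.dict.card * (P.maxLen + 1)) +
      1000 * (4 ^ 2 * V * P.dict.card ^ 2 * P.maxLen) + 6) fun s' =>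
        (P.SolvableWithAtMost k → s'.reg 0 = 1) ∧ (¬ P.SolvableWithAtMost k → s'.reg 0 = 0) := by
  obtain ⟨B, hB⟩ : ∃ B, B = 200 * (4 * q * P.n + P.dict.card * (P.maxLen + 1)) +
      1000 * (4 ^ 2 * V * P.dict.card ^ 2 * P.maxLen) := ⟨_, rfl⟩
  rw [← hB]
  have hcardx : x.getD 3 0 = P.dict.card ∧ 3 < x.length := by
    obtain ⟨ws, gs, hnd, hdict, -, rfl⟩ := hx
    rw [← hdict, List.toFinset_card_of_nodup hnd]
    exact ⟨rfl, by simp⟩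
  have hcard : s.arr αIn 3 = P.dict.card := by
    rw [hs, ← hcardx.1]
    exact List.getD_append _ _ _ _ hcardx.2
  refine Within.mono (B := 1 + (1 + (1 + (B + 2 + 1)))) (Within.seq (Within.mono (B' := 1)
    (Within.block rfl rfl) (by decide) ?_)) (by omega) (fun _ _ h => h)
  rintro s1 ha1 hs1
  refine Within.seq (Within.mono (B' := 1) (Within.block rfl rfl) (by decide) ?_)
  rintro s2 ha2 hs2
  refine Within.seq (Within.mono (B' := 1) (Within.block rfl rfl) (by decide) ?_)
  rintro s3 ha3 hs3
  have hD3 : s3.reg ρD = P.dict.card := by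
    rw [← hs3, ← hs2, ← hs1, ← hcard]; simp
  have h13 : s3.reg ρOne = 1 := by rw [← hs3, ← hs2, ← hs1]; simp
  refine Within.ifLt (fun hc => ?_) (fun hc => ?_)
  -- The empty dictionary is treated separately, as `core_answers` needs a word. There is no
  -- solution then, because the sides are nonempty.
  · refine Within.mono (Within.block rfl rfl) (by simp [Prog.cost]) ?_
    rintro s4 - hs4
    have h0 : s4.reg 0 = 0 := by rw [← hs4]; simp
    refine ⟨?_, fun _ => h0⟩
    rintro ⟨k', -, words, sides, hsol, -⟩
    obtain ⟨c, hca⟩ := Multiset.card_pos_iff_exists_mem.1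
      (show 0 < (P.side 0).card by rw [P.card_side]; exact P.n_pos)
    obtain ⟨w, hw, -⟩ := hsol.exists_word hca
    have := Finset.card_pos.2 ⟨w, hw⟩
    omega
  · have hD : P.dict.Nonempty := Finset.card_pos.1 (by omega)
    refine Within.seq (Within.mono (B' := B) (core_answers (s := s3) (tail := [k]) (by decide) hD hx
      ?_ ?_ ?_ hV) (by rw [hB]) ?_)
    · rw [ha3.arr αIn rfl, ha2.arr αIn rfl, ha1.arr αIn rfl, hs]
    · rw [ha3.reg ρnA rfl, ha2.reg ρnA rfl, ha1.reg ρnA rfl, hnA]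
    · intro b hb
      rw [ha3.arr b rfl, ha2.arr b rfl, ha1.arr b rfl, hz b hb]
    · rintro s4 - ⟨hK, hans⟩
      change s4.reg ρK = k at hK
      refine Within.ifLt (B := 1) (fun hc => ?_) (fun hc => ?_)
      · refine Within.mono (Within.block rfl rfl) (by decide) ?_
        rintro s5 - hs5
        have h0 : s5.reg 0 = 0 := by rw [← hs5]; simp
        refine ⟨?_, fun _ => h0⟩
        rintro ⟨k', hk', hsol⟩
        rcases hans with ⟨-, hw, -⟩ | ⟨-, hno⟩
        · have := hw.2 hsol
          omega
        · obtain ⟨words, sides, h, -⟩ := hsol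
          exact absurd ⟨words, sides, h⟩ hno
      · refine Within.mono (Within.block rfl rfl) (by decide) ?_
        rintro s5 - hs5
        have h0 : s5 = s4 := by rw [← hs5]; rfl
        rw [h0]
        rcases hans with ⟨h1, hw, -⟩ | ⟨h1, hno⟩
        · exact ⟨fun _ => h1, fun h => absurd ⟨_, by omega, hw.1⟩ h⟩
        · refine ⟨?_, fun _ => h1⟩
          rintro ⟨k', hk', words, sides, h, -⟩
          exact absurd ⟨words, sides, h⟩ hno

/-- A polynomial time bound when the number of codes is at most `A * (n + 1) ^ e`. -/
noncomputable def timeBound (A e : ℕ) : Polynomial ℕ :=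
  200 * (4 * .X * .X + .X * (.X + 1)) +
    1000 * (4 ^ 2 * (.C A * (.X + 1) ^ e) * .X ^ 2 * .X) + 12

theorem time_le (P : Puzzle 4 q) (A e k : ℕ) :
    200 * (4 * q * P.n + P.dict.card * (P.maxLen + 1)) +
      1000 * (4 ^ 2 * (A * (P.n + 1) ^ e) * P.dict.card ^ 2 * P.maxLen) + 12 ≤
      (timeBound A e).eval (P.size + Nat.size k) := by
  have h1 := P.card_dict_le_size
  have h2 := P.maxLen_le_size
  have h3 : q ≤ P.size := by unfold Puzzle.size; omega
  have h4 : P.n ≤ P.size := by unfold Puzzle.size; omega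
  obtain ⟨M, hM⟩ : ∃ M, M = P.size + Nat.size k := ⟨_, rfl⟩
  rw [← hM, timeBound]
  simp only [Polynomial.eval_add, Polynomial.eval_mul, Polynomial.eval_X, Polynomial.eval_pow,
    Polynomial.eval_C, Polynomial.eval_one, Polynomial.eval_ofNat]
  gcongr <;> omega

theorem solvableInPolyTime_of_numCodes_le {A : ∀ {q : ℕ}, Puzzle 4 q → ℕ → Prop} {e : ℕ}
    (h : ∀ {q : ℕ} (P : Puzzle 4 q) (k : ℕ), A P k → P.Playable → P.numCodes ≤ (P.n + 1) ^ e) :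
    SolvableInPolyTime A := by
  refine ⟨decideWords, timeBound 1 e, fun q P k _ hA x hx => ?_⟩
  obtain ⟨t, s, hex, ht, hs⟩ := decideWords_spec (s := State.ofInput (x ++ [k])) hx rfl rfl
    (fun b hb => funext fun i => if_neg hb) (h P k hA)
  have := time_le P 1 e k
  rw [Nat.one_mul] at this
  exact ⟨t, s, hex, by omega, hs⟩

/-- A solution with at most `d` words of length at most `c` forces n ≤ d·c. Larger `n` are rejected
at once, and for the others the number of codes is at most the constant 2^(4dc). -/
theorem solvableInPolyTime_of_maxLen_le (c d : ℕ) :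
    SolvableInPolyTime (fun {_} P k => P.maxLen ≤ c ∧ k ≤ d) := by
  refine ⟨decideFewLetters (d * c), timeBound (2 ^ (4 * (d * c))) 0, ?_⟩
  rintro q P k - ⟨hc, hd⟩ x hx
  have hle := time_le P (2 ^ (4 * (d * c))) 0 k
  obtain ⟨B, hB⟩ : ∃ B, B = (timeBound (2 ^ (4 * (d * c))) 0).eval (P.size + Nat.size k) := ⟨_, rfl⟩
  rw [pow_zero, Nat.mul_one] at hle
  rw [← hB] at hle ⊢
  have hnx : x.getD 2 0 = P.n ∧ 2 < x.length := by
    obtain ⟨ws, gs, -, -, -, rfl⟩ := hx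
    exact ⟨rfl, by simp⟩
  have hn : (State.ofInput (x ++ [k])).arr αIn 2 = P.n := by
    rw [← hnx.1]
    exact List.getD_append _ _ _ _ hnx.2
  -- The constant 12 in `timeBound` leaves 6 steps for `decideWords` and 6 for the test of `n`.
  suffices Within (decideFewLetters (d * c)) (State.ofInput (x ++ [k]))
      (1 + (1 + (1 + (B - 6 + 1)))) fun s' =>
        (P.SolvableWithAtMost k → s'.reg 0 = 1) ∧ (¬ P.SolvableWithAtMost k → s'.reg 0 = 0) by
    obtain ⟨t, s, hex, ht, hs⟩ := this
    exact ⟨t, s, hex, by omega, hs⟩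
  refine Within.seq (Within.mono (B' := 1) (Within.block rfl rfl) (by decide) ?_)
  rintro s1 ha1 hs1
  refine Within.seq (Within.mono (B' := 1) (Within.block rfl rfl) (by decide) ?_)
  rintro s2 ha2 hs2
  refine Within.seq (Within.mono (B' := 1) (Within.block rfl rfl) le_rfl ?_)
  rintro s3 ha3 hs3
  have hn3 : s3.reg ρn = P.n := by rw [← hs3, ← hs2, ← hs1, ← hn]; simp
  have hK3 : s3.reg ρK = d * c := by rw [← hs3]; simp
  refine Within.ifLt (fun hlt => ?_) (fun hlt => ?_)
  · refine Within.mono (B := 1) (Within.block rfl rfl) (by omega) ?_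
    rintro s4 - hs4
    have h0 : s4.reg 0 = 0 := by rw [← hs4]; simp
    refine ⟨?_, fun _ => h0⟩
    rintro ⟨k', hk', words, sides, hsol, rfl⟩
    have h1 := hsol.n_le (by decide)
    have h2 : words.length * P.maxLen ≤ d * c := Nat.mul_le_mul (hk'.trans hd) hc
    omega
  · refine Within.mono (decideWords_spec (s := s3) (k := k) hx ?_ ?_ ?_
      (V := 2 ^ (4 * (d * c))) fun _ => ?_) (by omega) (fun _ _ h => h)
    · rw [ha3.arr αIn rfl, ha2.arr αIn rfl, ha1.arr αIn rfl]
      rfl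
    · rw [ha3.reg ρnA rfl, ha2.reg ρnA rfl, ha1.reg ρnA rfl]
      rfl
    · intro b hb
      rw [ha3.arr b rfl, ha2.arr b rfl, ha1.arr b rfl]
      exact funext fun i => if_neg hb
    · exact P.numCodes_le_two_pow.trans (Nat.pow_le_pow_right (by decide) (by omega))

end LetterBoxed

theorem mainTheorem3 :
    (∃ (prog : RAM.Prog) (C : ℕ), ∀ (S q : ℕ) (P : LetterBoxed.Puzzle S q), 1 ≤ S →
      P.dict.Nonempty → ∀ x : List ℕ, P.Encodes x →
        ∃ t s, RAM.Exec prog (RAM.State.ofInput x) t s ∧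
          t ≤ C * (S ^ 2 * (P.n + 1) ^ (S * q) * P.dict.card ^ 2 * P.maxLen) ∧
          ((s.reg 0 = 1 ∧ IsLeast P.wordCounts (s.reg 1) ∧ IsLeast P.letterCounts (s.reg 2)) ∨
            (s.reg 0 = 0 ∧ ¬ ∃ words sides, LetterBoxed.IsSolution P words sides))) ∧
    (∀ c : ℕ, LetterBoxed.SolvableInPolyTime (fun {q} _ _ => q ≤ c)) ∧
    (∀ c d : ℕ, LetterBoxed.SolvableInPolyTime
      (fun {_} P _ => P.dict.card ≤ c ∧ P.maxLen ≤ d)) ∧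
    (∀ c d : ℕ, LetterBoxed.SolvableInPolyTime (fun {_} P k => P.maxLen ≤ c ∧ k ≤ d)) := by
  refine ⟨⟨LetterBoxed.core, 1600, fun S q P hS hD x hx => ?_⟩, fun c => ?_, fun c d => ?_,
    LetterBoxed.solvableInPolyTime_of_maxLen_le⟩
  · obtain ⟨t, s, hex, ht, -, hs⟩ := LetterBoxed.core_answers (tail := []) hS hD hx
      (s := RAM.State.ofInput x) (by rw [List.append_nil]; rfl) rfl
      (fun b hb => funext fun i => if_neg hb) (fun _ => P.numCodes_le)
    exact ⟨t, s, hex, ht.trans (LetterBoxed.core_time S q P.n _ _ hS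
      hD.card_pos (P.maxLen_pos hD)), hs⟩
  · exact LetterBoxed.solvableInPolyTime_of_numCodes_le (e := 4 * c) fun {q} P _ hq _ =>
      P.numCodes_le.trans (Nat.pow_le_pow_right (Nat.succ_pos _) (Nat.mul_le_mul_left 4 hq))
  · exact LetterBoxed.solvableInPolyTime_of_numCodes_le (e := 4 * (c * d)) fun P _ h hp =>
      hp.numCodes_le h.1 h.2
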